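/- **Setting.** Let $E$, $V$, $V^r$ be measurable spaces with $\sigma$-finite canonical measures ($E$ and $V^r$ also carry topologies with their Borel $\sigma$-algebras). Consider a PDMP on $E$ and its time reversal, with measurable deterministic flow $(\Phi_t)_{t\in\mathbb R}$ (a group; the backward process uses $\Phi_{-t}$) and jump kernels parametrised by marks: a forward jump from $x$ goes to $\xi_x(v)$ with $v\in V$ drawn from a probability density $\nu_x$, a backward jump from $y$ goes to $\xi^r_y(u)$ with $u\in V^r$ drawn from a probability density $\nu^r_y$, where $\xi_x,\xi^r_y$ are injective. Everything is jointly measurable. Every jump can be undone in the other direction: there are measurable maps $m,m^r$ with $\xi^r_{\xi_x(v)}(m(x,v))=x$ and $\xi_{\xi^r_y(u)}(m^r(y,u))=y$. The path spaces on $[0,T]$ are $W_T=E\times\bigcup_k(]0,T[\times V)^k$ and $W^r_T=E\times\bigcup_k(]0,T[\times V^r)^k$ with increasing event times, with the canonical (product) measures $\lambda_{W_T}$, $\lambda_{W_T^r}$. A point $(z_0,(\tau_i,v_i)_{i\le k})$ encodes the path that starts from $z_0$, follows the flow and jumps at time $\tau_i$ with mark $v_i$. The reversal $R_T:W_T\to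 W_T^r$ maps a forward path to the backward path that starts from its terminal state, has the event times $T-\tau_i$, and undoes its jumps. Assume that there are measurable $\psi_T:W^r_T\to\,]0,\infty[$ with $(R_T)_*\lambda_{W_T}=\psi_T\,\lambda_{W_T^r}$ for all $T>0$, and put $\Psi_T(w)=1/\psi_T(R_T(w))$ for forward paths $w$ on $[0,T]$ (the volume change of $R_T^{-1}$). Assume that $R_t$ and its volume change are continuous in $t$: for every forward path $w$ the map $t\mapsto R_t(w)$, and for every backward path $w^r$ the map $t\mapsto\psi_t(w^r)$, is continuous on $[s,\infty[$, where $s$ is the time of the last event of the path ($s=0$ if there is none). (This includes paths with an event exactly at $t$.) **Approximate process.** Forward in time, started from $z$: given the initial state and the events so far, the last one at time $\tau$ with post-jump state $y$ (at first $\tau=0$, $y=z$), the waiting time for the next event is the first event time of an inhomogeneous Poisson process with rate $r\mapsto\tilde\lambda(r)$, where $\tilde\lambda\ge 0$ is measurable, locally integrable in $r$, and may depend on the initial state and on all the events so far; if it equals $r<\infty$, the mark has density $\nu_{\Phi_r(y)}$. Backward in time the process is built in the same way with $\Phi_{-t}$, $\xi^r$, $\nu^r$ and another such rate $\tilde\lambda^r$.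 The conditional density $q_{[0,T]}(w\mid z)$ of the approximate forward path on $[0,T]$ given its starting point is $$\prod_{i=1}^k\tilde\lambda_{i-1}(\tau_i-\tau_{i-1})\,e^{-\int_0^{\tau_i-\tau_{i-1}}\tilde\lambda_{i-1}}\,\nu_{\Phi_{\tau_i-\tau_{i-1}}(z_{i-1})}(v_i)\;\cdot\;e^{-\int_0^{T-\tau_k}\tilde\lambda_k},$$ where $\tau_0=0$, $z_i$ is the state after the $i$-th event and $\tilde\lambda_i$ the rate given the first $i$ events; $q^r$ is the analogue for backward paths. Starting from $Z_0$ with law of density $\pi$ with respect to the canonical measure of $E$ (the state after the velocity refreshment), let $(Z_t)_{t\in\mathbb R}$ be the two-sided trajectory whose forward and backward parts are conditionally independent given $Z_0$ and are approximate forward and backward processes; assume that it almost surely has finitely many events in every bounded interval. The distribution $\pi$ is not assumed to be invariant for anything. **Stopping criterion.** A measurable criterion declares path segments on compact intervals valid or not. It is consistent (if a segment is valid, so is its restriction to each compact subinterval; equivalently, extensions of invalid segments are invalid), and it depends only on the points where events occur: its value is determined, up to a common translation of time, by the times and the pre- and post-jump states of the events of the segment, and by which end points of the interval are event times. **Construction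 of $(X,l)$.** Let $\alpha\sim\mathrm{unif}(0,1)$ be independent of the trajectory, let $T=\sup\{t\ge0:\ (Z_s)_{s\in[-\alpha t,(1-\alpha)t]}\text{ is valid}\}$, and assume that almost surely this set is nonempty and bounded. Let $X=(Z_{t-\alpha T})_{t\in[0,T]}$, encoded by its length $T$, its events with times in $[0,T]$ (a possible event at time $0$ included) and its left limit at time $0$, and let $l=\alpha T$, so that $X_l=Z_0$. **Statement.** $X$ and $l$ are (almost everywhere equal to) random variables, and almost surely exactly one of the following holds: $X$ has an event at time $T$ (the process was stopped forward), or $X$ has an event at time $0$ (it was stopped backward). For almost every $X$, the conditional law of $l$ given $X$ is the probability measure $\nu$ on $[0,T]$ with density $$\nu(l)\ \propto\ \pi(X_l)\;q^r_{[-l,0]}\big((X_{t+l})_{t\in[-l,0]}\mid X_l\big)\;q_{[0,T-l]}\big((X_{t+l})_{t\in[0,T-l]}\mid X_l\big)\;\frac{T-l}{T^2}\;\Psi_l(X_{[0,l]})$$ if the process was stopped forward, and $$\nu(l)\ \propto\ \pi(X_l)\;q^r_{[-l,0]}\big((X_{t+l})_{t\in[-l,0]}\mid X_l\big)\;q_{[0,T-l]}\big((X_{t+l})_{t\in[0,T-l]}\mid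 X_l\big)\;\frac{l}{T^2}\;\Psi_l(X_{[0,l]})$$ if the process was stopped backward; in both cases the normalising integral over $[0,T]$ is positive and finite. Here $q^r_{[-l,0]}((X_{t+l})_{t\in[-l,0]}\mid X_l)$ is $q^r$ on $[0,l]$ evaluated at the backward path $R_l(X_{[0,l]})$. -/

import Mathlib

open MeasureTheory ProbabilityTheory Set
open scoped ENNReal NNReal

noncomputable section

namespace NutsPDMP

/-! ### Measurable structures on finite lists and on optional values -/

/-- Disjoint union sigma-algebra on `⋃ k, α ^ k`: a set of lists is measurable when, for each `k`,
its part of length `k` is measurable in `α ^ k`. -/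
instance instMeasurableSpaceList {α : Type*} [MeasurableSpace α] : MeasurableSpace (List α) :=
  ⨅ k : ℕ, MeasurableSpace.map (fun f : Fin k → α => List.ofFn f) inferInstance

/-- Disjoint union sigma-algebra on `α` with one additional point. -/
instance instMeasurableSpaceOption {α : Type*} [MeasurableSpace α] : MeasurableSpace (Option α) :=
  MeasurableSpace.map (some : α → Option α) inferInstance

/-! ### Skeletons of piecewise deterministic paths -/

/-- The skeleton of a path: the initial state and the list of its events (time, mark). -/
abbrev Path (E M : Type*) := E × List (ℝ × M)

/-- Event times are strictly increasing. -/
def Increasing {M : Type*} (ev : List (ℝ × M)) : Prop :=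
  ev.Pairwise fun e f => e.1 < f.1

/-- Time of the last event, `0` if there is none. -/
def lastTime {M : Type*} (ev : List (ℝ × M)) : ℝ :=
  ev.foldl (fun _ e => e.1) 0

/-- Translation of all event times by `c`. -/
def shift {M : Type*} (c : ℝ) (ev : List (ℝ × M)) : List (ℝ × M) :=
  ev.map fun e => (e.1 + c, e.2)

/-- The canonical measure on `⋃ k, (]0,T[ × M) ^ k` (lists of events with increasing times):
the sum over `k` of the product measures. -/
def eventMeasure (M : Type*) [MeasureSpace M] (T : ℝ) : Measure (List (ℝ × M)) :=
  Measure.sum fun k : ℕ =>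
    ((Measure.pi fun _ : Fin k => ((volume : Measure ℝ).restrict (Ioo 0 T)).prod
        (volume : Measure M)).restrict {f | StrictMono fun i => (f i).1}).map
      (fun f => List.ofFn f)

/-- The canonical measure on the path space `E × ⋃ k, (]0,T[ × M) ^ k`. -/
def pathMeasure (E M : Type*) [MeasureSpace E] [MeasureSpace M] (T : ℝ) : Measure (Path E M) :=
  (volume : Measure E).prod (eventMeasure M T)

/-- Deterministic motion, jump map `jump x : M → E` and density `markDensity x` on the mark space
`M`. A jump from `x` goes to `jump x v` with `v` drawn from `markDensity x`. -/
structure Dynamics (E M : Type*) where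
  flow : ℝ → E → E
  jump : E → M → E
  markDensity : E → M → ℝ≥0∞

namespace Dynamics

variable {E M M' : Type*} (D : Dynamics E M)

/-- From a state `p.1` at time `p.2`, flow until the time of the event `e` and jump. -/
def step (p : E × ℝ) (e : ℝ × M) : E × ℝ :=
  (D.jump (D.flow (e.1 - p.2) p.1) e.2, e.1)

/-- State right after the last event (the initial state if there is none), and its time. -/
def walk (w : Path E M) : E × ℝ :=
  w.2.foldl D.step (w.1, 0)

/-- State at time `T` of a path whose events all have times at most `T`. -/
def stateAt (T : ℝ) (w : Path E M) : E :=
  D.flow (T - (D.walk w).2) (D.walk w).1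

/-- Auxiliary recursion for `reverse`: `p` is the current state and its time, `acc` the part of
the path that is already reversed. -/
def reverseAux (rev : E → M → M') (T : ℝ) : E × ℝ → List (ℝ × M') → List (ℝ × M) → Path E M'
  | p, acc, [] => (D.flow (T - p.2) p.1, acc)
  | p, acc, e :: ev =>
      reverseAux rev T (D.step p e) ((T - e.1, rev (D.flow (e.1 - p.2) p.1) e.2) :: acc) ev

/-- The time reversal of a path on `[0,T]`: it starts from the terminal state, an event at time `t`
becomes an event at time `T - t`, and its mark `v`, used from the state `x`, becomes `rev x v`. -/
def reverse (rev : E → M → M') (T : ℝ) (w : Path E M) : Path E M' :=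
  D.reverseAux rev T (w.1, 0) [] w.2

/-- Auxiliary recursion for `eventPoints`. -/
def eventPointsAux : E × ℝ → List (ℝ × M) → List (ℝ × E × E)
  | _, [] => []
  | p, e :: ev =>
      (e.1, D.flow (e.1 - p.2) p.1, D.jump (D.flow (e.1 - p.2) p.1) e.2) ::
        eventPointsAux (D.step p e) ev

/-- The events of a path as points: (time, state before the jump, state after the jump). -/
def eventPoints (w : Path E M) : List (ℝ × E × E) :=
  D.eventPointsAux (w.1, 0) w.2

end Dynamics

/-- Approximate jump rate. `rate w r` is the rate at time `r` after the last event of `w`, where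
`w` consists of the initial state and of all events so far. -/
structure Rate (E M : Type*) [MeasurableSpace E] [MeasurableSpace M] where
  rate : Path E M → ℝ → ℝ≥0
  measurable_rate : Measurable fun p : Path E M × ℝ => rate p.1 p.2
  integrable_rate : ∀ (w : Path E M) (r : ℝ), 0 ≤ r →
    IntervalIntegrable (fun u => (rate w u : ℝ)) volume 0 r

/-- Probability of no event during a time `r` after the last event of `w`. -/
def Rate.survival {E M : Type*} [MeasurableSpace E] [MeasurableSpace M] (L : Rate E M)
    (w : Path E M) (r : ℝ) : ℝ≥0∞ :=
  ENNReal.ofReal (Real.exp (-∫ u in (0 : ℝ)..r, (L.rate w u : ℝ)))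

section Law

variable {E M : Type*} [MeasurableSpace E] [MeasureSpace M]

/-- Given the past `w`, density of the next event: its time is the first event time of an
inhomogeneous Poisson process with the approximate rate, its mark is drawn from the mark density at
the state reached by the flow. -/
def nextDensity (D : Dynamics E M) (L : Rate E M) (w : Path E M) (e : ℝ × M) : ℝ≥0∞ :=
  (L.rate w (e.1 - (D.walk w).2) : ℝ≥0∞) * L.survival w (e.1 - (D.walk w).2) *
    D.markDensity (D.flow (e.1 - (D.walk w).2) (D.walk w).1) e.2

/-- Given the past `w`, law of the next event. Its total mass may be less than one: the missing mass
is the probability that no further event ever happens. -/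
def nextEvent (D : Dynamics E M) (L : Rate E M) (w : Path E M) : Measure (ℝ × M) :=
  (((volume : Measure ℝ).restrict (Ioi (D.walk w).2)).prod (volume : Measure M)).withDensity
    (nextDensity D L w)

/-- The first `n` entries of a sequence of events (`none`: no further event). -/
def firstEvents (N : ℕ → Option (ℝ × M)) (n : ℕ) : List (ℝ × M) :=
  (List.range n).filterMap N

/-- `K z` is the law of the sequence of all events on `[0,∞[` of the approximate process that
starts from `z`: conditionally on the first `n` events, the next one has law `nextEvent`, and
`none` is followed by `none`. -/
structure IsEventLaw (D : Dynamics E M) (L : Rate E M)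
    (K : Kernel E (ℕ → Option (ℝ × M))) : Prop where
  none_none : ∀ (z : E) (n : ℕ), ∀ᵐ N ∂(K z), N n = none → N (n + 1) = none
  next : ∀ (z : E) (n : ℕ) (A : Set (List (ℝ × M))) (B : Set (ℝ × M)),
    MeasurableSet A → MeasurableSet B →
    K z {N | (firstEvents N n).length = n ∧ firstEvents N n ∈ A ∧ ∃ e ∈ B, N n = some e} =
      ∫⁻ N in {N | (firstEvents N n).length = n ∧ firstEvents N n ∈ A},
        nextEvent D L (z, firstEvents N n) B ∂(K z)

/-- Auxiliary recursion for `pathDensity`: `past` holds the events already passed. -/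
def pathDensityAux (D : Dynamics E M) (L : Rate E M) (T : ℝ) (z : E) :
    List (ℝ × M) → List (ℝ × M) → ℝ≥0∞
  | past, [] => L.survival (z, past) (T - (D.walk (z, past)).2)
  | past, e :: ev => nextDensity D L (z, past) e * pathDensityAux D L T z (past ++ [e]) ev

/-- Density of the approximate path on `[0,T]` conditionally on its starting point `z`: the product
of the densities of its events and of the probability of no event after the last one. -/
def pathDensity (D : Dynamics E M) (L : Rate E M) (T : ℝ) (z : E) (ev : List (ℝ × M)) : ℝ≥0∞ :=
  pathDensityAux D L T z [] ev

end Law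

/-- Only finitely many events before each time. -/
def NonExplosive {M : Type*} (N : ℕ → Option (ℝ × M)) : Prop :=
  ∀ t : ℝ, ∃ n, ∀ e ∈ N n, t < e.1

/-- The list of all events up to time `t` included (for a non-explosive increasing sequence). -/
def eventsUpTo {M : Type*} (N : ℕ → Option (ℝ × M)) (t : ℝ) : List (ℝ × M) :=
  (List.range (sInf {n | ∀ e ∈ N n, t < e.1})).filterMap N

/-! ### Processes with a time reversal -/

/-- Flow and jump kernel of a PDMP and of its time reversal, which are shared by the exact process
and by its approximations. `V` and `Vr` are the mark spaces of the forward and of the backward jump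
kernels. A forward jump from `x` with mark `v` is undone by the backward jump with mark
`mark x v`, and a backward jump from `y` with mark `u` is undone by the forward jump with mark
`rmark y u`, so that paths can be reversed. -/
structure ReversiblePDMP (E V Vr : Type*) [MeasureSpace E] [MeasureSpace V] [MeasureSpace Vr] where
  flow : ℝ → E → E
  flow_zero : ∀ x, flow 0 x = x
  flow_add : ∀ s t x, flow (s + t) x = flow s (flow t x)
  measurable_flow : Measurable fun p : ℝ × E => flow p.1 p.2
  jump : E → V → E
  jump_injective : ∀ x, Function.Injective (jump x)
  measurable_jump : Measurable fun p : E × V => jump p.1 p.2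
  density : E → V → ℝ≥0∞
  measurable_density : Measurable fun p : E × V => density p.1 p.2
  lintegral_density : ∀ x, ∫⁻ v, density x v = 1
  rjump : E → Vr → E
  rjump_injective : ∀ x, Function.Injective (rjump x)
  measurable_rjump : Measurable fun p : E × Vr => rjump p.1 p.2
  rdensity : E → Vr → ℝ≥0∞
  measurable_rdensity : Measurable fun p : E × Vr => rdensity p.1 p.2
  lintegral_rdensity : ∀ x, ∫⁻ u, rdensity x u = 1
  mark : E → V → Vr
  measurable_mark : Measurable fun p : E × V => mark p.1 p.2
  rjump_mark : ∀ x v, rjump (jump x v) (mark x v) = x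
  rmark : E → Vr → V
  measurable_rmark : Measurable fun p : E × Vr => rmark p.1 p.2
  jump_rmark : ∀ y u, jump (rjump y u) (rmark y u) = y

/-- A path on a time interval, seen from its left end: its length is the second component, the
event times lie in `[0, length]`, and the initial state is the left limit at the left end (so that
an event at time `0` is a jump from the initial state). -/
abbrev Segment (E V : Type*) := Path E V × ℝ

/-- Length, increasing event times in `[0, length]`. -/
def Segment.WellFormed {E V : Type*} (x : Segment E V) : Prop :=
  0 ≤ x.2 ∧ Increasing x.1.2 ∧ ∀ e ∈ x.1.2, 0 ≤ e.1 ∧ e.1 ≤ x.2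

/-- There is an event at time `t`. -/
def Segment.HasEventAt {E V : Type*} (x : Segment E V) (t : ℝ) : Prop :=
  ∃ e ∈ x.1.2, e.1 = t

/-- The segment ends with an event on the left. -/
def stoppedBackward (E V : Type*) : Set (Segment E V) := {x | x.HasEventAt 0}

/-- The segment ends with an event on the right. -/
def stoppedForward (E V : Type*) : Set (Segment E V) := {x | x.HasEventAt x.2}

namespace ReversiblePDMP

variable {E V Vr : Type*} [MeasureSpace E] [MeasureSpace V] [MeasureSpace Vr]
  (G : ReversiblePDMP E V Vr)

/-- The dynamics forward in time. -/
def fwd : Dynamics E V where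
  flow := G.flow
  jump := G.jump
  markDensity := G.density

/-- The dynamics backward in time (times are counted positively, away from the origin). -/
def bwd : Dynamics E Vr where
  flow := fun t => G.flow (-t)
  jump := G.rjump
  markDensity := G.rdensity

/-- The reversal `R_T` of forward paths on `[0,T]`. -/
def R (T : ℝ) (w : Path E V) : Path E Vr := G.fwd.reverse G.mark T w

/-- The inverse reversal, from backward to forward paths on `[0,T]`. -/
def Rinv (T : ℝ) (w : Path E Vr) : Path E V := G.bwd.reverse G.rmark T w

/-- `ψ T` is the volume change of `R_T`: the image of the canonical measure of forward paths by
`R_T` has the positive density `ψ T` with respect to the canonical measure of backward paths. -/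
structure IsVolumeChange (ψ : ℝ → Path E Vr → ℝ) : Prop where
  pos : ∀ T w, 0 < ψ T w
  measurable : ∀ T, Measurable (ψ T)
  map_R : ∀ T, 0 < T → (pathMeasure E V T).map (G.R T) =
    (pathMeasure E Vr T).withDensity fun w => ENNReal.ofReal (ψ T w)

/-- The volume change of the inverse reversal, as a function on forward paths on `[0,T]`. -/
def invVolumeChange (ψ : ℝ → Path E Vr → ℝ) (T : ℝ) (w : Path E V) : ℝ≥0∞ :=
  ENNReal.ofReal (1 / ψ T (G.R T w))

/-- For each path, the reversed path `R_t` and its volume change depend continuously on the horizon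
`t`, as long as `[0,t]` contains all the events. -/
structure ContinuousReversal [TopologicalSpace E] [TopologicalSpace Vr]
    (ψ : ℝ → Path E Vr → ℝ) : Prop where
  continuousOn_R : ∀ w : Path E V, Increasing w.2 → (∀ e ∈ w.2, 0 < e.1) →
    ContinuousOn (fun t => G.R t w) (Ici (lastTime w.2))
  continuousOn_volumeChange : ∀ w : Path E Vr, Increasing w.2 → (∀ e ∈ w.2, 0 < e.1) →
    ContinuousOn (fun t => ψ t w) (Ici (lastTime w.2))

/-- The restriction of a segment to `[a,b]`, seen from its left end. -/
def restrict (x : Segment E V) (a b : ℝ) : Segment E V :=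
  ((G.fwd.stateAt a (x.1.1, x.1.2.filter fun e => e.1 < a),
    shift (-a) (x.1.2.filter fun e => a ≤ e.1 ∧ e.1 ≤ b)), b - a)

/-- A consistent stopping criterion, which depends only on the points where events occur: whether a
segment is valid depends on its event points (up to a translation of time) and on which ends of the
segment are event times. -/
structure StoppingCriterion where
  valid : Set (Segment E V)
  measurableSet_valid : MeasurableSet valid
  consistent : ∀ x : Segment E V, x.WellFormed → ∀ a b : ℝ, 0 ≤ a → a ≤ b → b ≤ x.2 →
    x ∈ valid → G.restrict x a b ∈ valid
  eventsOnly : ∀ (x y : Segment E V) (c : ℝ), x.WellFormed → y.WellFormed →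
    G.fwd.eventPoints y.1 = (G.fwd.eventPoints x.1).map (fun p => (p.1 + c, p.2)) →
    (x.HasEventAt 0 ↔ y.HasEventAt 0) → (x.HasEventAt x.2 ↔ y.HasEventAt y.2) →
    (x ∈ valid ↔ y ∈ valid)

end ReversiblePDMP

/-! ### The algorithm -/

/-- The randomness of the algorithm: the initial state (after the velocity refreshment), the events
forward in time, the events backward in time, and `α ∈ [0,1]`. -/
abbrev Run (E V Vr : Type*) :=
  (E × ((ℕ → Option (ℝ × V)) × (ℕ → Option (ℝ × Vr)))) × unitInterval

section Algorithm

variable {E V Vr : Type*} [MeasureSpace E] [MeasureSpace V] [MeasureSpace Vr]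

/-- Law of the randomness of the algorithm: the initial state has density `π`; given the initial
state, the forward and the backward processes are independent with laws `Kf` and `Kb`; `α` is uniform
and independent of the trajectory. -/
def runLaw (π : E → ℝ≥0∞) (Kf : Kernel E (ℕ → Option (ℝ × V)))
    (Kb : Kernel E (ℕ → Option (ℝ × Vr))) : Measure (Run E V Vr) :=
  (((volume : Measure E).withDensity π) ⊗ₘ (Kf ×ₖ Kb)).prod (volume : Measure unitInterval)

instance instIsProbabilityMeasureRunLaw (π : E → ℝ≥0∞)
    [IsProbabilityMeasure ((volume : Measure E).withDensity π)]
    (Kf : Kernel E (ℕ → Option (ℝ × V))) [IsMarkovKernel Kf]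
    (Kb : Kernel E (ℕ → Option (ℝ × Vr))) [IsMarkovKernel Kb] :
    IsProbabilityMeasure (runLaw π Kf Kb) := by
  unfold runLaw
  infer_instance

namespace ReversiblePDMP

variable (G : ReversiblePDMP E V Vr)

/-- The restriction of the two-sided trajectory to `[-a,b]`, seen from its left end. -/
def window (ω : Run E V Vr) (a b : ℝ) : Segment E V :=
  (((G.Rinv a (ω.1.1, eventsUpTo ω.1.2.2 a)).1,
    (G.Rinv a (ω.1.1, eventsUpTo ω.1.2.2 a)).2 ++ shift a (eventsUpTo ω.1.2.1 b)), a + b)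

variable {G} (C : G.StoppingCriterion)

/-- The times `t ≥ 0` for which the criterion is valid on `[-αt, (1-α)t]`. -/
def validTimes (ω : Run E V Vr) : Set ℝ :=
  {t | 0 ≤ t ∧ G.window ω ((ω.2 : ℝ) * t) ((1 - (ω.2 : ℝ)) * t) ∈ C.valid}

/-- The length `T` at which the trajectory is stopped. -/
def stopTime (ω : Run E V Vr) : ℝ := sSup (validTimes C ω)

/-- The output path `X`, the trajectory on `[-αT, (1-α)T]` seen from its left end. -/
def outX (ω : Run E V Vr) : Segment E V :=
  G.window ω ((ω.2 : ℝ) * stopTime C ω) ((1 - (ω.2 : ℝ)) * stopTime C ω)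

/-- The position `l = αT` of the starting point in the output path. -/
def outL (ω : Run E V Vr) : ℝ := (ω.2 : ℝ) * stopTime C ω

variable (G)

/-- The path `X` on `[0,l]`. -/
def leftPart (x : Segment E V) (l : ℝ) : Path E V :=
  (x.1.1, x.1.2.filter fun e => e.1 ≤ l)

/-- The state `X_l`. -/
def stateIn (x : Segment E V) (l : ℝ) : E := G.fwd.stateAt l (leftPart x l)

/-- The events of `(X_{t+l})` for `t ∈ ]0,T-l]`. -/
def rightEvents (x : Segment E V) (l : ℝ) : List (ℝ × V) :=
  shift (-l) (x.1.2.filter fun e => l < e.1)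

/-- `π(X_l)`, times the density of the backward approximate path on `[-l,0]` given `X_l`, times the
density of the forward approximate path on `[0,T-l]` given `X_l`, times `Ψ_l(X_{[0,l]})`. -/
def pathWeight (π : E → ℝ≥0∞) (ψ : ℝ → Path E Vr → ℝ) (Lf : Rate E V) (Lb : Rate E Vr)
    (x : Segment E V) (l : ℝ) : ℝ≥0∞ :=
  π (G.stateIn x l) *
    pathDensity G.bwd Lb l (G.stateIn x l) (G.R l (leftPart x l)).2 *
    pathDensity G.fwd Lf (x.2 - l) (G.stateIn x l) (rightEvents x l) *
    G.invVolumeChange ψ l (leftPart x l)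

end ReversiblePDMP

/-- `ν` is the probability measure on `[0,T]` whose density is proportional to `f` (the normalising
constant is positive and finite). -/
def HasDensityProportionalTo (ν : Measure ℝ) (T : ℝ) (f : ℝ → ℝ≥0∞) : Prop :=
  0 < ∫⁻ l in Icc 0 T, f l ∧ ∫⁻ l in Icc 0 T, f l < ∞ ∧
    ν = (∫⁻ l in Icc 0 T, f l)⁻¹ • ((volume : Measure ℝ).restrict (Icc 0 T)).withDensity f

end Algorithm

end NutsPDMP

end

namespace NutsPDMP

/-! ### Measurability of functions on lists -/

section ListMeasurability

variable {α β γ σ : Type*} [MeasurableSpace α] [MeasurableSpace β] [MeasurableSpace γ]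
  [MeasurableSpace σ]

/-! The joint law of $(X,l)$ is computed explicitly, separately on the two events "stopped forward"
and "stopped backward", and is then disintegrated.

Suppose that the run is stopped by a forward event at time $b$. Then $T=b/(1-\alpha)$ and the origin
sits at $a=\alpha T=\frac{\alpha}{1-\alpha}b$. Given $Z_0=z$, the forward events up to $b$ have the
product density `eventDensity`; it equals $q_{[0,b]}$, since no time is left after the last event.
The backward events up to $a$ have density $q^r_{[0,a]}$. The substitution $\alpha=a/(a+b)$
contributes $b/(a+b)^2=(T-a)/T^2$ (`lintegral_unitInterval_ratio`, `lintegral_stopsAfter_ratio`).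
For fixed $a$, the inverse reversal turns ($z$, backward events) into a forward path on $[0,a]$ at
the cost $1/\psi_a=\Psi_a$, and gluing the forward events behind it, shifted by $a$, gives $X$.
Lebesgue measure is translation invariant and the canonical measure on event lists factorises at any
time $a$, so in the coordinates $(X,a)$ the density is the claimed weight (`lintegral_twoSided_fwd`,
`lintegral_forward_weight`), times the indicator that $X$ is stopped by its last event.

This indicator depends on $X$ alone, hence cancels in the normalisation. Indeed, consistency makes
the set of valid times an interval, and validity can change only at an event because it depends only
on event points. So stopping means: $X$ without its last event is valid, and $X$ prolonged a little
beyond it is not (`StopsRight`, `StopsLeft`, `forwardStop_spec`). The position of the origin plays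
no role. Almost surely $\alpha$ does not let a forward and a backward event reach the two ends
simultaneously, so exactly one end carries an event.

If the run is stopped backward, the last backward event lies exactly at the horizon $a$. Such paths
are negligible for the canonical measure on $[0,a]$, so the volume change of $R_a$ says nothing
about them directly. The substitute is `lintegral_boundary`. Integrate the reversal formula over the
horizon $T$ and let $s$ be the flow time after the last backward event, which is the flow time
before the first forward event. The density of the paths ending with an event, with respect to the
canonical measure, then equals $\psi_{\tau+s}(w)/J_s$ for almost every $s$, where $\tau$ is the last
event time and $J_s$ the volume change of the flow. It does not depend on $s$, and continuity allows
$s\to0$. Since $J_0=1$ almost everywhere, by the cocycle identity of the flow, the density is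
$\psi_\tau(w)$. The rest runs as in the forward case, with $a/T^2$ in place of $(T-a)/T^2$
(`lintegral_twoSided_bwd`, `lintegral_backward_weight`).

Two technical points recur. The function $\psi_T$ is only assumed measurable for each fixed $T$, so
a jointly measurable version `volumeChange` is built from its continuity in $T$. And one reference
measure without horizon, `orderedListMeasure`, replaces the measures on $[0,T]$, so that $T$ can be
integrated over and the origin moved. -/

theorem measurableSet_list_iff {s : Set (List α)} :
    MeasurableSet s ↔ ∀ k : ℕ, MeasurableSet ((fun f : Fin k → α => List.ofFn f) ⁻¹' s) := by
  exact MeasurableSpace.measurableSet_iInf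

theorem measurable_ofFn (k : ℕ) : Measurable fun f : Fin k → α => List.ofFn f :=
  fun _ hs => measurableSet_list_iff.1 hs k

/-- The image of a set of tuples lies in a single length class, so its preimage in every other class
is empty. -/
theorem measurableEmbedding_ofFn (k : ℕ) :
    MeasurableEmbedding fun f : Fin k → α => List.ofFn f where
  injective := List.ofFn_injective
  measurable := measurable_ofFn k
  measurableSet_image' := by
    intro s hs
    refine measurableSet_list_iff.2 fun j => ?_
    by_cases h : j = k
    · subst h
      rwa [preimage_image_eq _ List.ofFn_injective]
    · convert MeasurableSet.empty
      ext f
      simp only [mem_preimage, mem_image, mem_empty_iff_false, iff_false, not_exists, not_and]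
      intro g _ hg
      have := congrArg List.length hg
      simp at this
      exact h this.symm

theorem measurable_list {f : List α → β}
    (h : ∀ k : ℕ, Measurable fun v : Fin k → α => f (List.ofFn v)) : Measurable f :=
  fun _ hs => measurableSet_list_iff.2 fun k => h k hs

/-- A product with a disjoint union is not by definition a disjoint union of products. It is one
here because countably many measurable embeddings `id × ofFn` cover the space. Recursions over lists
with parameters thereby become inductions on the length. -/
theorem measurable_prod_list {f : β × List α → γ}
    (h : ∀ k : ℕ, Measurable fun p : β × (Fin k → α) => f (p.1, List.ofFn p.2)) :
    Measurable f := by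
  intro s hs
  have : f ⁻¹' s = ⋃ k : ℕ, (Prod.map id fun v : Fin k → α => List.ofFn v) ''
      ((fun p : β × (Fin k → α) => f (p.1, List.ofFn p.2)) ⁻¹' s) := by
    ext ⟨b, l⟩
    simp only [mem_preimage, mem_iUnion, mem_image, Prod.exists, Prod.map, Prod.mk.injEq, id]
    constructor
    · intro hb
      exact ⟨l.length, b, fun i => l.get i, by simpa using hb, rfl, by simp⟩
    · rintro ⟨k, b', v, hv, rfl, rfl⟩
      exact hv
  rw [this]
  exact MeasurableSet.iUnion fun k =>
    (MeasurableEmbedding.prodMap MeasurableEmbedding.id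
      (measurableEmbedding_ofFn k)).measurableSet_image' (h k hs)

/-- Appending, mapping, filtering and quantifying over entries are all right folds, so this single
induction serves for all of them. -/
theorem measurable_foldr {s : β → α → σ → σ} {i : β → σ}
    (hs : Measurable fun p : β × α × σ => s p.1 p.2.1 p.2.2) (hi : Measurable i) :
    Measurable fun p : β × List α => p.2.foldr (s p.1) (i p.1) := by
  refine measurable_prod_list fun k => ?_
  induction k with
  | zero =>
    simp only [List.ofFn_zero, List.foldr_nil]
    exact hi.comp measurable_fst
  | succ k ih =>
    simp only [List.ofFn_succ, List.foldr_cons]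
    have h1 : Measurable fun p : β × (Fin (k + 1) → α) => (p.1, fun i : Fin k => p.2 i.succ) :=
      measurable_fst.prodMk (measurable_pi_lambda _ fun i =>
        (measurable_pi_apply _).comp measurable_snd)
    exact hs.comp (measurable_fst.prodMk
      (((measurable_pi_apply 0).comp measurable_snd).prodMk (ih.comp h1)))

theorem measurable_foldl {s : σ → α → σ} (hs : Measurable fun p : σ × α => s p.1 p.2) :
    Measurable fun p : σ × List α => p.2.foldl s p.1 := by
  refine measurable_prod_list fun k => ?_
  induction k with
  | zero => simpa using measurable_fst
  | succ k ih =>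
    simp only [List.ofFn_succ, List.foldl_cons]
    have h1 : Measurable fun p : σ × (Fin (k + 1) → α) =>
        (s p.1 (p.2 0), fun i : Fin k => p.2 i.succ) :=
      (hs.comp (measurable_fst.prodMk ((measurable_pi_apply 0).comp measurable_snd))).prodMk
        (measurable_pi_lambda _ fun i => (measurable_pi_apply _).comp measurable_snd)
    exact ih.comp h1

theorem measurable_cons : Measurable fun p : α × List α => p.1 :: p.2 := by
  refine measurable_prod_list fun k => ?_
  have h1 : Measurable fun p : α × (Fin k → α) => (Fin.cons p.1 p.2 : Fin (k + 1) → α) := by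
    refine measurable_pi_lambda _ fun i => ?_
    refine Fin.cases ?_ (fun j => ?_) i
    · simpa using measurable_fst
    · simp only [Fin.cons_succ]
      exact (measurable_pi_apply j).comp measurable_snd
  convert (measurable_ofFn (k + 1)).comp h1 using 1
  ext1 p
  simp [List.ofFn_succ]

theorem _root_.Measurable.listCons {f : β → α} {g : β → List α} (hf : Measurable f)
    (hg : Measurable g) : Measurable fun b => f b :: g b :=
  measurable_cons.comp (hf.prodMk hg)

theorem _root_.Measurable.listFoldr {f : β → List α} {s : β → α → σ → σ} {i : β → σ}
    (hf : Measurable f) (hs : Measurable fun p : β × α × σ => s p.1 p.2.1 p.2.2)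
    (hi : Measurable i) : Measurable fun b => (f b).foldr (s b) (i b) :=
  (measurable_foldr hs hi).comp (measurable_id.prodMk hf)

theorem _root_.Measurable.listAppend {f g : β → List α} (hf : Measurable f)
    (hg : Measurable g) : Measurable fun b => f b ++ g b := by
  have h := hf.listFoldr (s := fun _ a l => a :: l) (i := g)
    (measurable_snd.fst.listCons measurable_snd.snd) hg
  convert h using 2 with b
  induction f b with
  | nil => rfl
  | cons a l ih => rw [List.cons_append, List.foldr_cons, ih]

theorem _root_.Measurable.listMap {f : β → List α} {g : β → α → γ} (hf : Measurable f)
    (hg : Measurable fun p : β × α => g p.1 p.2) : Measurable fun b => (f b).map (g b) := by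
  have h := hf.listFoldr (s := fun b a l => g b a :: l) (i := fun _ => ([] : List γ))
    ((hg.comp (measurable_fst.prodMk measurable_snd.fst)).listCons measurable_snd.snd)
    measurable_const
  convert h using 2 with b
  induction f b with
  | nil => rfl
  | cons a l ih => rw [List.map_cons, List.foldr_cons, ih]

theorem _root_.Measurable.listFilter {f : β → List α} {q : β → α → Bool} (hf : Measurable f)
    (hq : MeasurableSet {p : β × α | q p.1 p.2 = true}) :
    Measurable fun b => (f b).filter (q b) := by
  have h := hf.listFoldr (s := fun b a l => if q b a = true then a :: l else l)
    (i := fun _ => ([] : List α))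
    (Measurable.ite (p := fun p : β × α × List α => q p.1 p.2.1 = true)
      (hq.preimage (measurable_fst.prodMk measurable_snd.fst))
      (measurable_snd.fst.listCons measurable_snd.snd) measurable_snd.snd)
    measurable_const
  convert h using 2 with b
  induction f b with
  | nil => rfl
  | cons a l ih => rw [List.filter_cons, List.foldr_cons, ih]

theorem measurableSet_forall_mem {f : β → List α} {P : β → α → Prop} (hf : Measurable f)
    (hP : MeasurableSet {p : β × α | P p.1 p.2}) :
    MeasurableSet {b | ∀ x ∈ f b, P b x} := by
  have h := hf.listFoldr (s := fun b a (l : Prop) => P b a ∧ l) (i := fun _ => True)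
    (Measurable.and (measurableSet_setOfPred.1 (hP.preimage (measurable_fst.prodMk measurable_snd.fst)))
      measurable_snd.snd)
    measurable_const
  rw [measurableSet_setOfPred]
  convert h using 2 with b
  induction f b with
  | nil => simp
  | cons a l ih => simp [ih]

theorem measurableSet_exists_mem {f : β → List α} {P : β → α → Prop} (hf : Measurable f)
    (hP : MeasurableSet {p : β × α | P p.1 p.2}) :
    MeasurableSet {b | ∃ x ∈ f b, P b x} := by
  have h := (measurableSet_forall_mem (P := fun b x => ¬ P b x) hf hP.compl).compl
  convert h using 1
  ext b
  simp

theorem measurable_length : Measurable (List.length : List α → ℕ) :=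
  measurable_list fun k => by simp

theorem measurableSet_pairwise {r : α → α → Prop} (hr : MeasurableSet {p : α × α | r p.1 p.2}) :
    MeasurableSet {l : List α | l.Pairwise r} := by
  refine measurableSet_list_iff.2 fun k => ?_
  have : (fun f : Fin k → α => List.ofFn f) ⁻¹' {l | l.Pairwise r} =
      ⋂ i : Fin k, ⋂ j : Fin k, ⋂ _ : i < j, {f : Fin k → α | r (f i) (f j)} := by
    ext f
    simp [List.pairwise_ofFn]
  rw [this]
  exact MeasurableSet.iInter fun i => MeasurableSet.iInter fun j => MeasurableSet.iInter fun _ =>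
    measurableSet_preimage (f := fun f : Fin k → α => (f i, f j))
      ((measurable_pi_apply i).prodMk (measurable_pi_apply j)) hr

theorem measurableSet_eq_nil : MeasurableSet {l : List α | l = []} := by
  convert measurable_length (α := α) (measurableSet_singleton 0) using 1
  ext l
  simp

theorem _root_.Measurable.listTail {f : β → List α} (hf : Measurable f) :
    Measurable fun b => (f b).tail := by
  refine Measurable.comp (g := List.tail) (measurable_list fun k => ?_) hf
  cases k with
  | zero => simp
  | succ k =>
    simp only [List.ofFn_succ, List.tail_cons]
    exact (measurable_ofFn k).comp (measurable_pi_lambda _ fun i => measurable_pi_apply _)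

theorem _root_.Measurable.listDropLast {f : β → List α} (hf : Measurable f) :
    Measurable fun b => (f b).dropLast := by
  refine Measurable.comp (g := List.dropLast) (measurable_list fun k => ?_) hf
  cases k with
  | zero => simp
  | succ k =>
    simp only [List.ofFn_succ', List.concat_eq_append, List.dropLast_concat]
    exact (measurable_ofFn k).comp (measurable_pi_lambda _ fun i => measurable_pi_apply _)

end ListMeasurability

/-! ### Measurability for optional values -/

section OptionMeasurability

variable {α β : Type*} [MeasurableSpace α] [MeasurableSpace β]

theorem measurableSet_option_iff {s : Set (Option α)} :
    MeasurableSet s ↔ MeasurableSet ((some : α → Option α) ⁻¹' s) := Iff.rfl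

theorem measurable_option {f : Option α → β} (h : Measurable fun a => f (some a)) :
    Measurable f := fun _ hs => measurableSet_option_iff.2 (h hs)

theorem measurable_toList : Measurable (Option.toList : Option α → List α) :=
  measurable_option (by simpa using measurable_id.listCons measurable_const)

end OptionMeasurability

/-! ### Initial pieces of a sequence of events -/

section FirstEvents

variable {M : Type*}

theorem firstEvents_succ (N : ℕ → Option (ℝ × M)) (n : ℕ) :
    firstEvents N (n + 1) = firstEvents N n ++ (N n).toList := by
  unfold firstEvents
  rw [List.range_succ, List.filterMap_append]
  cases h : N n <;> simp [h]

theorem measurable_firstEvents [MeasurableSpace M] (n : ℕ) :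
    Measurable fun N : ℕ → Option (ℝ × M) => firstEvents N n := by
  induction n with
  | zero => simp [firstEvents]
  | succ n ih =>
    simp only [firstEvents_succ]
    exact ih.listAppend (measurable_toList.comp (measurable_pi_apply n))

theorem length_firstEvents_le (N : ℕ → Option (ℝ × M)) (n : ℕ) :
    (firstEvents N n).length ≤ n := by
  simpa [firstEvents] using List.length_filterMap_le N (List.range n)

/-- Since `filterMap` skips `none`, having length `n` is the way to express that the first `n`
entries are all genuine events. -/
theorem length_firstEvents_succ_iff {N : ℕ → Option (ℝ × M)} {n : ℕ} :
    (firstEvents N (n + 1)).length = n + 1 ↔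
      (firstEvents N n).length = n ∧ ∃ e, N n = some e := by
  have h := length_firstEvents_le N n
  rw [firstEvents_succ]
  cases hN : N n with
  | none => simp; omega
  | some e => simp

theorem mem_firstEvents {N : ℕ → Option (ℝ × M)} {n : ℕ} {e : ℝ × M} :
    e ∈ firstEvents N n ↔ ∃ m < n, N m = some e := by
  simp [firstEvents]

end FirstEvents

/-! ### Indicators -/

open Classical in
/-- `1` if `p` holds and `0` otherwise. -/
noncomputable def ind (p : Prop) : ℝ≥0∞ := if p then 1 else 0

theorem ind_pos {p : Prop} (h : p) : ind p = 1 := if_pos h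

theorem ind_neg {p : Prop} (h : ¬ p) : ind p = 0 := if_neg h

/-- Regions of integration are written as factors `ind` of the integrand. By this multiplicativity
they can be merged and moved by `ring`, also when they depend on several integration variables. -/
theorem ind_and (p q : Prop) : ind (p ∧ q) = ind p * ind q := by
  by_cases hp : p <;> by_cases hq : q <;> simp [ind, hp, hq]

theorem ind_ne_top (p : Prop) : ind p ≠ ∞ := by
  by_cases hp : p <;> simp [ind, hp]

theorem ind_le_one (p : Prop) : ind p ≤ 1 := by
  by_cases hp : p <;> simp [ind, hp]

theorem measurable_ind {β : Type*} [MeasurableSpace β] {p : β → Prop}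
    (h : MeasurableSet {b | p b}) : Measurable fun b => ind (p b) := by
  classical
  unfold ind
  exact Measurable.ite h measurable_const measurable_const

theorem lintegral_ind_mul {β : Type*} [MeasurableSpace β] {μ : Measure β} {p : β → Prop}
    (h : MeasurableSet {b | p b}) (f : β → ℝ≥0∞) :
    ∫⁻ b, ind (p b) * f b ∂μ = ∫⁻ b in {b | p b}, f b ∂μ := by
  rw [← lintegral_indicator h]
  congr 1
  ext b
  by_cases hb : p b <;> simp [ind, hb]

theorem setLIntegral_eq_ind {β : Type*} [MeasurableSpace β] {μ : Measure β} {s : Set β}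
    (h : MeasurableSet s) (f : β → ℝ≥0∞) :
    ∫⁻ b in s, f b ∂μ = ∫⁻ b, ind (b ∈ s) * f b ∂μ :=
  (lintegral_ind_mul (p := fun b => b ∈ s) h f).symm

theorem lintegral_ind {β : Type*} [MeasurableSpace β] {μ : Measure β} {p : β → Prop}
    (h : MeasurableSet {b | p b}) : ∫⁻ b, ind (p b) ∂μ = μ {b | p b} := by
  simpa using lintegral_ind_mul (μ := μ) h fun _ => 1

theorem ind_mul_congr {p q : Prop} {a b : ℝ≥0∞} (hpq : p ↔ q) (h : p → a = b) :
    ind p * a = ind q * b := by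
  by_cases hp : p
  · rw [ind_pos hp, ind_pos (hpq.1 hp), h hp]
  · rw [ind_neg hp, ind_neg (fun hq => hp (hpq.2 hq)), zero_mul, zero_mul]

end NutsPDMP

namespace NutsPDMP

/-! ### Lists of events -/

section Events

variable {M : Type*}

theorem increasing_ofFn {n : ℕ} {f : Fin n → ℝ × M} :
    Increasing (List.ofFn f) ↔ StrictMono fun i => (f i).1 := by
  unfold Increasing
  rw [List.pairwise_ofFn]
  rfl

theorem measurableSet_increasing [MeasurableSpace M] : MeasurableSet {l : List (ℝ × M) | Increasing l} :=
  measurableSet_pairwise (measurableSet_lt measurable_fst.fst measurable_snd.fst)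

theorem shift_cons (c : ℝ) (e : ℝ × M) (l : List (ℝ × M)) :
    shift c (e :: l) = (e.1 + c, e.2) :: shift c l := rfl

theorem shift_shift (c d : ℝ) (l : List (ℝ × M)) : shift c (shift d l) = shift (d + c) l := by
  simp [shift, add_assoc]

theorem shift_zero (l : List (ℝ × M)) : shift 0 l = l := by
  simp [shift]

theorem measurable_shift [MeasurableSpace M] : Measurable fun p : ℝ × List (ℝ × M) => shift p.1 p.2 :=
  measurable_snd.listMap ((measurable_snd.fst.add measurable_fst.fst).prodMk measurable_snd.snd)

end Events

/-! ### The measure on lists of events with increasing times -/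

section OrderedMeasure

set_option linter.unusedSectionVars false

variable {M : Type*} [MeasureSpace M]

/-- The canonical measure on lists of `n` events with increasing (real) times. -/
noncomputable def orderedMeasure (M : Type*) [MeasureSpace M] (n : ℕ) : Measure (List (ℝ × M)) :=
  ((Measure.pi fun _ : Fin n => (volume : Measure ℝ).prod (volume : Measure M)).restrict
    {f | StrictMono fun i => (f i).1}).map fun f => List.ofFn f

/-- The canonical measure on lists of events with increasing (real) times. -/
noncomputable def orderedListMeasure (M : Type*) [MeasureSpace M] : Measure (List (ℝ × M)) :=
  Measure.sum (orderedMeasure M)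

theorem measurableSet_strictMono (n : ℕ) :
    MeasurableSet {f : Fin n → ℝ × M | StrictMono fun i => (f i).1} := by
  have := measurable_ofFn (α := ℝ × M) n measurableSet_increasing
  simpa only [preimage_ofPred_eq, increasing_ofFn] using this

variable [SigmaFinite (volume : Measure M)]

instance (n : ℕ) : SFinite (orderedMeasure M n) := by
  unfold orderedMeasure
  infer_instance

instance : SFinite (orderedListMeasure M) := by
  unfold orderedListMeasure
  infer_instance

theorem lintegral_orderedMeasure (n : ℕ) {F : List (ℝ × M) → ℝ≥0∞} (hF : Measurable F) :
    ∫⁻ l, F l ∂orderedMeasure M n =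
      ∫⁻ f, ind (Increasing (List.ofFn f)) * F (List.ofFn f)
        ∂Measure.pi fun _ : Fin n => (volume : Measure ℝ).prod (volume : Measure M) := by
  unfold orderedMeasure
  rw [lintegral_map hF (measurable_ofFn n)]
  simp only [increasing_ofFn]
  rw [lintegral_ind_mul (measurableSet_strictMono n)]

theorem lintegral_orderedListMeasure (F : List (ℝ × M) → ℝ≥0∞) :
    ∫⁻ l, F l ∂orderedListMeasure M = ∑' n, ∫⁻ l, F l ∂orderedMeasure M n := by
  unfold orderedListMeasure
  rw [lintegral_sum_measure]

theorem lintegral_orderedMeasure_zero {F : List (ℝ × M) → ℝ≥0∞} (hF : Measurable F) :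
    ∫⁻ l, F l ∂orderedMeasure M 0 = F [] := by
  rw [lintegral_orderedMeasure 0 hF, Measure.pi_of_empty]
  simp [ind, Increasing]

/-- Decomposition according to the first event. -/
theorem lintegral_orderedMeasure_succ (n : ℕ) {F : List (ℝ × M) → ℝ≥0∞} (hF : Measurable F) :
    ∫⁻ l, F l ∂orderedMeasure M (n + 1) =
      ∫⁻ e, ∫⁻ l, ind (∀ x ∈ l, e.1 < x.1) * F (e :: l) ∂orderedMeasure M n
        ∂(volume : Measure ℝ).prod (volume : Measure M) := by
  have hG : Measurable fun l : List (ℝ × M) => ind (Increasing l) * F l :=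
    (measurable_ind measurableSet_increasing).mul hF
  have hc : ∀ e : ℝ × M, Measurable fun l : List (ℝ × M) =>
      ind (∀ x ∈ l, e.1 < x.1) * F (e :: l) := fun e =>
    (measurable_ind (measurableSet_forall_mem measurable_id
      (measurableSet_lt measurable_const measurable_snd.fst))).mul
      (hF.comp (measurable_const.listCons measurable_id))
  have mp := measurePreserving_piFinSuccAbove
    (fun _ : Fin (n + 1) => (volume : Measure ℝ).prod (volume : Measure M)) 0
  rw [lintegral_orderedMeasure (n + 1) hF,
    ← mp.symm.lintegral_comp_emb (MeasurableEquiv.measurableEmbedding _),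
    lintegral_prod _ (Measurable.aemeasurable ?_)]
  swap
  · exact (hG.comp (measurable_ofFn (α := ℝ × M) (n + 1))).comp (MeasurableEquiv.measurable _)
  refine lintegral_congr fun e => ?_
  rw [lintegral_orderedMeasure n (hc e)]
  refine lintegral_congr fun g => ?_
  have : List.ofFn ((MeasurableEquiv.piFinSuccAbove (fun _ => ℝ × M) 0).symm (e, g)) =
      e :: List.ofFn g := by
    rw [List.ofFn_succ]
    simp [MeasurableEquiv.piFinSuccAbove, Fin.insertNthEquiv]
  rw [this, ← mul_assoc, ← ind_and]
  congr 2
  simp only [Increasing, List.pairwise_cons]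
  rw [and_comm]

/-- Decomposition according to the first event, if there is one. -/
theorem lintegral_orderedListMeasure_cons {F : List (ℝ × M) → ℝ≥0∞} (hF : Measurable F) :
    ∫⁻ l, F l ∂orderedListMeasure M =
      F [] + ∫⁻ e, ∫⁻ l, ind (∀ x ∈ l, e.1 < x.1) * F (e :: l) ∂orderedListMeasure M
        ∂(volume : Measure ℝ).prod (volume : Measure M) := by
  have hc : Measurable fun p : (ℝ × M) × List (ℝ × M) =>
      ind (∀ x ∈ p.2, p.1.1 < x.1) * F (p.1 :: p.2) :=
    (measurable_ind (measurableSet_forall_mem measurable_snd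
      (measurableSet_lt measurable_fst.fst.fst measurable_snd.fst))).mul
      (hF.comp (measurable_fst.listCons measurable_snd))
  simp only [lintegral_orderedListMeasure]
  rw [tsum_eq_zero_add' ENNReal.summable, lintegral_orderedMeasure_zero hF]
  congr 1
  rw [lintegral_tsum fun n => hc.lintegral_prod_right'.aemeasurable]
  exact tsum_congr fun n => lintegral_orderedMeasure_succ n hF

/-- Decomposition according to the last event. -/
theorem lintegral_orderedMeasure_snoc (n : ℕ) {F : List (ℝ × M) → ℝ≥0∞} (hF : Measurable F) :
    ∫⁻ l, F l ∂orderedMeasure M (n + 1) =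
      ∫⁻ l, ∫⁻ e, ind (∀ x ∈ l, x.1 < e.1) * F (l ++ [e])
        ∂(volume : Measure ℝ).prod (volume : Measure M) ∂orderedMeasure M n := by
  have hm : ∀ {F : List (ℝ × M) → ℝ≥0∞}, Measurable F →
      Measurable fun p : List (ℝ × M) × (ℝ × M) =>
      ind (∀ x ∈ p.1, x.1 < p.2.1) * F (p.1 ++ [p.2]) := fun hF =>
    (measurable_ind (measurableSet_forall_mem measurable_fst
      (measurableSet_lt measurable_snd.fst measurable_fst.snd.fst))).mul
      (hF.comp (measurable_fst.listAppend (measurable_snd.listCons measurable_const)))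
  induction n generalizing F with
  | zero =>
    rw [lintegral_orderedMeasure_succ 0 hF,
      lintegral_orderedMeasure_zero (hm hF).lintegral_prod_right']
    refine lintegral_congr fun e => ?_
    rw [lintegral_orderedMeasure_zero]
    · simp [ind]
    · exact (measurable_ind (measurableSet_forall_mem measurable_id
        (measurableSet_lt measurable_const measurable_snd.fst))).mul
        (hF.comp (measurable_const.listCons measurable_id))
  | succ n ih =>
    rw [lintegral_orderedMeasure_succ (n + 1) hF,
      lintegral_orderedMeasure_succ n (hm hF).lintegral_prod_right']
    refine lintegral_congr fun e => ?_
    have hs : MeasurableSet {l : List (ℝ × M) | ∀ x ∈ l, e.1 < x.1} :=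
      measurableSet_forall_mem measurable_id (measurableSet_lt measurable_const measurable_snd.fst)
    have hFe : Measurable fun l => ind (∀ x ∈ l, e.1 < x.1) * F (e :: l) :=
      (measurable_ind hs).mul (hF.comp (measurable_const.listCons measurable_id))
    rw [ih hFe]
    refine lintegral_congr fun l => ?_
    rw [← lintegral_const_mul']
    · refine lintegral_congr fun e' => ?_
      rw [← mul_assoc, ← mul_assoc, ← ind_and, ← ind_and]
      refine ind_mul_congr ?_ fun _ => rfl
      simp only [List.mem_append, List.mem_cons, List.not_mem_nil, or_false]
      constructor
      · rintro ⟨h1, h2⟩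
        exact ⟨fun x hx => h2 x (Or.inl hx), fun x hx => hx.elim
          (fun h => h ▸ h2 e' (Or.inr rfl)) (h1 x)⟩
      · rintro ⟨h1, h2⟩
        exact ⟨fun x hx => h2 x (Or.inr hx), fun x hx => hx.elim (h1 x)
          (fun h => h ▸ h2 e (Or.inl rfl))⟩
    · exact ind_ne_top _

theorem ae_length_orderedMeasure (n : ℕ) : ∀ᵐ l ∂orderedMeasure M n, l.length = n := by
  unfold orderedMeasure
  have h : MeasurableSet {l : List (ℝ × M) | l.length = n} :=
    measurable_length (measurableSet_singleton n)
  rw [ae_map_iff (measurable_ofFn n).aemeasurable h]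
  simp

theorem ae_increasing_orderedMeasure (n : ℕ) : ∀ᵐ l ∂orderedMeasure M n, Increasing l := by
  unfold orderedMeasure
  rw [ae_map_iff (measurable_ofFn n).aemeasurable measurableSet_increasing]
  filter_upwards [ae_restrict_mem (measurableSet_strictMono n)] with f hf
  exact increasing_ofFn.2 hf

theorem ae_increasing_orderedListMeasure : ∀ᵐ l ∂orderedListMeasure M, Increasing l :=
  Measure.ae_sum_iff.2 ae_increasing_orderedMeasure

theorem measurePreserving_add_fst (c : ℝ) :
    MeasurePreserving (fun e : ℝ × M => (e.1 + c, e.2))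
      ((volume : Measure ℝ).prod (volume : Measure M))
      ((volume : Measure ℝ).prod (volume : Measure M)) :=
  (measurePreserving_add_right volume c).prod (MeasurePreserving.id _)

/-- Induction on the first event: its time is Lebesgue distributed, hence translation invariant, and
the order relations between times are preserved by a common shift. -/
theorem lintegral_orderedMeasure_shift (n : ℕ) (c : ℝ) {F : List (ℝ × M) → ℝ≥0∞}
    (hF : Measurable F) :
    ∫⁻ l, F (shift c l) ∂orderedMeasure M n = ∫⁻ l, F l ∂orderedMeasure M n := by
  have hsh : Measurable (shift (M := M) c) := measurable_shift.comp measurable_prodMk_left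
  have hm : Measurable fun p : (ℝ × M) × List (ℝ × M) => ind (∀ x ∈ p.2, p.1.1 < x.1) :=
    (measurable_ind (measurableSet_forall_mem measurable_snd
      (measurableSet_lt measurable_fst.fst.fst measurable_snd.fst)))
  induction n generalizing F with
  | zero =>
    rw [lintegral_orderedMeasure_zero hF]
    exact lintegral_orderedMeasure_zero (hF.comp hsh)
  | succ n ih =>
    have hm2 : Measurable fun p : (ℝ × M) × List (ℝ × M) =>
        ind (∀ x ∈ p.2, p.1.1 < x.1) * F (p.1 :: p.2) :=
      hm.mul (hF.comp (measurable_fst.listCons measurable_snd))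
    have hFs : Measurable fun l => F (shift c l) := hF.comp hsh
    rw [lintegral_orderedMeasure_succ n hF, lintegral_orderedMeasure_succ n hFs,
      ← (measurePreserving_add_fst c).lintegral_comp hm2.lintegral_prod_right']
    refine lintegral_congr fun e => ?_
    have h3 := ih (hm2.comp (measurable_prodMk_left (x := (e.1 + c, e.2))))
    simp only [Function.comp] at h3
    rw [← h3]
    refine lintegral_congr fun l => ?_
    refine ind_mul_congr ?_ fun _ => by rw [shift_cons]
    simp only [shift, List.forall_mem_map, add_lt_add_iff_right]

theorem lintegral_orderedListMeasure_shift (c : ℝ) {F : List (ℝ × M) → ℝ≥0∞}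
    (hF : Measurable F) :
    ∫⁻ l, F (shift c l) ∂orderedListMeasure M = ∫⁻ l, F l ∂orderedListMeasure M := by
  simp only [lintegral_orderedListMeasure, lintegral_orderedMeasure_shift _ c hF]

theorem ae_fst_ne (a : ℝ) :
    ∀ᵐ e ∂(volume : Measure ℝ).prod (volume : Measure M), e.1 ≠ a :=
  Measure.quasiMeasurePreserving_fst.ae (Measure.ae_ne volume a)

/-- Induction on the first event. If it comes after `a`, so does every other one and the left part
is empty; if it comes before `a`, it is prepended to the left part of a splitting of the rest. An
event exactly at `a` has measure zero. -/
theorem lintegral_orderedMeasure_split (a : ℝ) (n : ℕ) {F : List (ℝ × M) → ℝ≥0∞}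
    (hF : Measurable F) :
    ∫⁻ l, F l ∂orderedMeasure M n = ∑ p ∈ Finset.HasAntidiagonal.antidiagonal n,
      ∫⁻ l, ∫⁻ l', ind (∀ x ∈ l, x.1 < a) * (ind (∀ x ∈ l', a < x.1) * F (l ++ l'))
        ∂orderedMeasure M p.2 ∂orderedMeasure M p.1 := by
  have hlt : Measurable fun l : List (ℝ × M) => ind (∀ x ∈ l, x.1 < a) :=
    measurable_ind (measurableSet_forall_mem measurable_id
      (measurableSet_lt measurable_snd.fst measurable_const))
  have hgt : Measurable fun l : List (ℝ × M) => ind (∀ x ∈ l, a < x.1) :=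
    measurable_ind (measurableSet_forall_mem measurable_id
      (measurableSet_lt measurable_const measurable_snd.fst))
  have hm : Measurable fun p : (ℝ × M) × List (ℝ × M) => ind (∀ x ∈ p.2, p.1.1 < x.1) :=
    (measurable_ind (measurableSet_forall_mem measurable_snd
      (measurableSet_lt measurable_fst.fst.fst measurable_snd.fst)))
  have hH : ∀ {F : List (ℝ × M) → ℝ≥0∞}, Measurable F → ∀ j, Measurable fun l =>
      ∫⁻ l', ind (∀ x ∈ l, x.1 < a) * (ind (∀ x ∈ l', a < x.1) * F (l ++ l'))
        ∂orderedMeasure M j := fun hF j =>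
    Measurable.lintegral_prod_right' (f := fun p : List (ℝ × M) × List (ℝ × M) =>
      ind (∀ x ∈ p.1, x.1 < a) * (ind (∀ x ∈ p.2, a < x.1) * _))
      ((hlt.comp measurable_fst).mul ((hgt.comp measurable_snd).mul
        (hF.comp (measurable_fst.listAppend measurable_snd))))
  induction n generalizing F with
  | zero =>
    simp only [Finset.Nat.antidiagonal_zero, Finset.sum_singleton]
    rw [lintegral_orderedMeasure_zero hF, lintegral_orderedMeasure_zero (hH hF 0),
      lintegral_orderedMeasure_zero]
    · simp [ind]
    · exact measurable_const.mul (hgt.mul (hF.comp (measurable_const.listAppend measurable_id)))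
  | succ n ih =>
    have hFe : ∀ e : ℝ × M, Measurable fun l => ind (∀ x ∈ l, e.1 < x.1) * F (e :: l) := fun e =>
      (hm.comp measurable_prodMk_left).mul (hF.comp (measurable_const.listCons measurable_id))
    have hmF : Measurable fun p : (ℝ × M) × List (ℝ × M) =>
        ind (∀ x ∈ p.2, p.1.1 < x.1) * F (p.1 :: p.2) :=
      hm.mul (hF.comp (measurable_fst.listCons measurable_snd))
    -- The term split off has an empty left part; in the other terms the left part contains the
    -- first event.
    rw [Finset.Nat.sum_antidiagonal_succ]
    have h0 : ∫⁻ l, ∫⁻ l', ind (∀ x ∈ l, x.1 < a) * (ind (∀ x ∈ l', a < x.1) * F (l ++ l'))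
        ∂orderedMeasure M (n + 1) ∂orderedMeasure M 0 =
        ∫⁻ e, ind (a < e.1) * ∫⁻ l, ind (∀ x ∈ l, e.1 < x.1) * F (e :: l) ∂orderedMeasure M n
        ∂(volume : Measure ℝ).prod (volume : Measure M) := by
      rw [lintegral_orderedMeasure_zero (hH hF _), lintegral_orderedMeasure_succ]
      · refine lintegral_congr fun e => ?_
        rw [← lintegral_const_mul' _ _ (ind_ne_top _)]
        refine lintegral_congr fun l => ?_
        simp only [← mul_assoc, ← ind_and]
        refine ind_mul_congr ?_ fun _ => rfl
        simp only [List.mem_cons, forall_eq_or_imp, List.not_mem_nil, false_imp_iff, forall_true_iff,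
          true_and]
        constructor
        · rintro ⟨h2, h3, h4⟩
          exact ⟨h3, h2⟩
        · rintro ⟨h1, h2⟩
          exact ⟨h2, h1, fun x hx => h1.trans (h2 x hx)⟩
      · exact measurable_const.mul (hgt.mul (hF.comp (measurable_const.listAppend measurable_id)))
    have h1 : ∀ p ∈ Finset.HasAntidiagonal.antidiagonal n,
        ∫⁻ l, ∫⁻ l', ind (∀ x ∈ l, x.1 < a) * (ind (∀ x ∈ l', a < x.1) * F (l ++ l'))
          ∂orderedMeasure M p.2 ∂orderedMeasure M (p.1 + 1) =
        ∫⁻ e, ind (e.1 < a) * ∫⁻ l, ∫⁻ l', ind (∀ x ∈ l, x.1 < a) * (ind (∀ x ∈ l', a < x.1) *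
          (ind (∀ x ∈ l ++ l', e.1 < x.1) * F (e :: (l ++ l'))))
          ∂orderedMeasure M p.2 ∂orderedMeasure M p.1
          ∂(volume : Measure ℝ).prod (volume : Measure M) := by
      intro p _
      rw [lintegral_orderedMeasure_succ p.1 (hH hF _)]
      refine lintegral_congr fun e => ?_
      rw [← lintegral_const_mul' _ _ (ind_ne_top _)]
      refine lintegral_congr fun l => ?_
      rw [← lintegral_const_mul' _ _ (ind_ne_top _), ← lintegral_const_mul' _ _ (ind_ne_top _)]
      refine lintegral_congr fun l' => ?_
      simp only [← mul_assoc, ← ind_and]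
      refine ind_mul_congr ?_ fun _ => rfl
      simp only [List.mem_cons, forall_eq_or_imp, List.mem_append]
      constructor
      · rintro ⟨h1, ⟨h2, h3⟩, h4⟩
        exact ⟨h2, h3, h4, fun x hx => hx.elim (h1 x) fun h => h2.trans (h4 x h)⟩
      · rintro ⟨h2, h3, h4, h5⟩
        exact ⟨fun x hx => h5 x (Or.inl hx), ⟨h2, h3⟩, h4⟩
    have hmeas : ∀ p : ℕ × ℕ, Measurable fun e : ℝ × M => ind (e.1 < a) * ∫⁻ l, ∫⁻ l',
        ind (∀ x ∈ l, x.1 < a) * (ind (∀ x ∈ l', a < x.1) *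
          (ind (∀ x ∈ l ++ l', e.1 < x.1) * F (e :: (l ++ l'))))
          ∂orderedMeasure M p.2 ∂orderedMeasure M p.1 := by
      intro p
      refine (measurable_ind (measurableSet_lt measurable_fst measurable_const)).mul ?_
      refine Measurable.lintegral_prod_right (f := fun e => fun l => _) ?_
      refine Measurable.lintegral_prod_right (f := fun q : (ℝ × M) × List (ℝ × M) => fun l' => _) ?_
      have ha : Measurable fun q : ((ℝ × M) × List (ℝ × M)) × List (ℝ × M) =>
          (q.1.1, q.1.2 ++ q.2) :=
        measurable_fst.fst.prodMk (measurable_fst.snd.listAppend measurable_snd)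
      exact (hlt.comp measurable_fst.snd).mul ((hgt.comp measurable_snd).mul (hmF.comp ha))
    rw [Finset.sum_congr rfl h1, h0, ← lintegral_finsetSum _ fun p _ => hmeas p,
      lintegral_orderedMeasure_succ n hF, ← lintegral_add_left]
    · refine lintegral_congr_ae ?_
      filter_upwards [ae_fst_ne a] with e he
      rcases lt_or_gt_of_ne he with h | h
      · rw [ind_neg (not_lt.2 h.le), zero_mul, zero_add, ih (hFe e)]
        refine Finset.sum_congr rfl fun p _ => ?_
        rw [ind_pos h, one_mul]
      · rw [ind_pos h, one_mul, Finset.sum_eq_zero, add_zero]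
        intro p _
        rw [ind_neg (not_lt.2 h.le), zero_mul]
    · exact (measurable_ind (measurableSet_lt measurable_const measurable_fst)).mul
        hmF.lintegral_prod_right'

/-- Splitting of the events into those before and those after time `a`. -/
theorem lintegral_orderedListMeasure_split (a : ℝ) {F : List (ℝ × M) → ℝ≥0∞}
    (hF : Measurable F) :
    ∫⁻ l, F l ∂orderedListMeasure M =
      ∫⁻ l, ∫⁻ l', ind (∀ x ∈ l, x.1 < a) * (ind (∀ x ∈ l', a < x.1) * F (l ++ l'))
        ∂orderedListMeasure M ∂orderedListMeasure M := by
  have hH : Measurable fun p : List (ℝ × M) × List (ℝ × M) =>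
      ind (∀ x ∈ p.1, x.1 < a) * (ind (∀ x ∈ p.2, a < x.1) * F (p.1 ++ p.2)) := by
    refine (measurable_ind ?_).mul ((measurable_ind ?_).mul
      (hF.comp (measurable_fst.listAppend measurable_snd)))
    · exact measurableSet_forall_mem measurable_fst
        (measurableSet_lt measurable_snd.fst measurable_const)
    · exact measurableSet_forall_mem measurable_snd
        (measurableSet_lt measurable_const measurable_snd.fst)
  simp only [lintegral_orderedListMeasure, lintegral_orderedMeasure_split a _ hF]
  set g : ℕ × ℕ → ℝ≥0∞ := fun p => ∫⁻ l, ∫⁻ l', ind (∀ x ∈ l, x.1 < a) *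
    (ind (∀ x ∈ l', a < x.1) * F (l ++ l')) ∂orderedMeasure M p.2 ∂orderedMeasure M p.1 with hg
  have h1 : ∀ n, ∫⁻ l, ∑' m, ∫⁻ l', ind (∀ x ∈ l, x.1 < a) * (ind (∀ x ∈ l', a < x.1) *
      F (l ++ l')) ∂orderedMeasure M m ∂orderedMeasure M n = ∑' m, g (n, m) := fun n =>
    lintegral_tsum fun m => hH.lintegral_prod_right'.aemeasurable
  simp only [h1]
  rw [← ENNReal.tsum_prod (f := fun n m => g (n, m)),
    ← Finset.HasAntidiagonal.sigmaAntidiagonalEquivProd.tsum_eq, ENNReal.tsum_sigma']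
  refine tsum_congr fun n => ?_
  rw [tsum_fintype, Finset.univ_eq_attach, ← Finset.sum_attach]
  rfl

/-- A countable sum of σ-finite measures need not be σ-finite, but these summands live on disjoint
length classes. The instance is needed for the Radon–Nikodym argument in `lintegral_boundary` and
the uniqueness of densities there. -/
instance : SigmaFinite (orderedListMeasure M) := by
  refine Measure.sigmaFinite_of_countable (S := Set.range fun p : ℕ × ℕ =>
    (fun f : Fin p.1 → ℝ × M => List.ofFn f) '' spanningSets (Measure.pi fun _ : Fin p.1 =>
      (volume : Measure ℝ).prod (volume : Measure M)) p.2) (countable_range _) ?_ ?_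
  · rintro _ ⟨⟨k, m⟩, rfl⟩
    have hs := (measurableEmbedding_ofFn (α := ℝ × M) k).measurableSet_image'
      (measurableSet_spanningSets (Measure.pi fun _ : Fin k =>
        (volume : Measure ℝ).prod (volume : Measure M)) m)
    unfold orderedListMeasure
    rw [Measure.sum_apply _ hs, tsum_eq_single k]
    · unfold orderedMeasure
      rw [Measure.map_apply (measurable_ofFn k) hs, preimage_image_eq _ List.ofFn_injective]
      exact (Measure.restrict_apply_le _ _).trans_lt (measure_spanningSets_lt_top _ m)
    · intro n hn
      refine measure_mono_null ?_ (ae_iff.1 (ae_length_orderedMeasure (M := M) n))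
      rintro _ ⟨f, -, rfl⟩
      simpa using hn.symm
  · refine eq_univ_of_forall fun l => ?_
    have h := iUnion_spanningSets (Measure.pi fun _ : Fin l.length =>
      (volume : Measure ℝ).prod (volume : Measure M))
    obtain ⟨m, hm⟩ := mem_iUnion.1 (h ▸ mem_univ fun i => l.get i)
    exact ⟨_, ⟨(l.length, m), rfl⟩, ⟨_, hm, by simp⟩⟩

theorem measurableSet_forall_Ioo (T : ℝ) :
    MeasurableSet {l : List (ℝ × M) | ∀ x ∈ l, x.1 ∈ Ioo 0 T} :=
  measurableSet_forall_mem measurable_id (measurable_snd.fst measurableSet_Ioo)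

/-- The horizon becomes a mere condition on the event times, so that a single measure serves for all
`T`. -/
theorem eventMeasure_eq (T : ℝ) :
    eventMeasure M T = (orderedListMeasure M).restrict {l | ∀ x ∈ l, x.1 ∈ Ioo 0 T} := by
  unfold eventMeasure orderedListMeasure
  rw [Measure.restrict_sum _ (measurableSet_forall_Ioo T)]
  congr 1
  ext1 k
  unfold orderedMeasure
  rw [Measure.restrict_map (measurable_ofFn k) (measurableSet_forall_Ioo T)]
  congr 1
  have h1 : ((volume : Measure ℝ).restrict (Ioo 0 T)).prod (volume : Measure M) =
      ((volume : Measure ℝ).prod (volume : Measure M)).restrict (Ioo 0 T ×ˢ univ) := by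
    rw [← Measure.prod_restrict, Measure.restrict_univ]
  rw [h1, ← Measure.restrict_pi_pi, Measure.restrict_restrict (measurableSet_strictMono k),
    Measure.restrict_restrict ((measurable_ofFn k) (measurableSet_forall_Ioo T)), inter_comm]
  congr 2
  ext f
  simp only [mem_univ_pi, mem_prod, mem_univ, and_true, preimage_ofPred_eq, mem_ofPred_eq,
    List.forall_mem_ofFn_iff]

end OrderedMeasure

end NutsPDMP

namespace NutsPDMP

/-! ### Last event times -/

section LastTime

variable {M : Type*}

theorem lastTime_append_singleton (l : List (ℝ × M)) (e : ℝ × M) :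
    lastTime (l ++ [e]) = e.1 := by
  simp [lastTime]

theorem increasing_append_singleton {l : List (ℝ × M)} {e : ℝ × M} :
    Increasing (l ++ [e]) ↔ Increasing l ∧ ∀ x ∈ l, x.1 < e.1 := by
  simp [Increasing, List.pairwise_append]

theorem le_lastTime {l : List (ℝ × M)} (h : Increasing l) {x : ℝ × M} (hx : x ∈ l) :
    x.1 ≤ lastTime l := by
  rcases List.eq_nil_or_concat l with rfl | ⟨l', e, rfl⟩
  · simp at hx
  · rw [List.concat_eq_append] at *
    rw [lastTime_append_singleton]
    rcases List.mem_append.1 hx with hx | hx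
    · exact ((increasing_append_singleton.1 h).2 x hx).le
    · rw [List.mem_singleton.1 hx]

theorem exists_mem_eq_lastTime {l : List (ℝ × M)} (h : l ≠ []) :
    ∃ e ∈ l, e.1 = lastTime l := by
  rcases List.eq_nil_or_concat l with rfl | ⟨l', e, rfl⟩
  · exact absurd rfl h
  · rw [List.concat_eq_append]
    exact ⟨e, by simp, (lastTime_append_singleton l' e).symm⟩

/-- Positivity of `t` accounts for the empty list, whose `lastTime` is 0 by convention. -/
theorem lastTime_lt_iff {l : List (ℝ × M)} (h : Increasing l) {t : ℝ} (ht : 0 < t) :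
    lastTime l < t ↔ ∀ x ∈ l, x.1 < t := by
  constructor
  · exact fun hl x hx => (le_lastTime h hx).trans_lt hl
  · intro hl
    rcases eq_or_ne l [] with rfl | hne
    · exact ht
    · obtain ⟨e, he, h'⟩ := exists_mem_eq_lastTime hne
      exact h' ▸ hl e he

theorem lastTime_nonneg {l : List (ℝ × M)} (h : ∀ x ∈ l, 0 < x.1) : 0 ≤ lastTime l := by
  rcases eq_or_ne l [] with rfl | hne
  · exact le_rfl
  · obtain ⟨e, he, h'⟩ := exists_mem_eq_lastTime hne
    exact h' ▸ (h e he).le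

theorem lastTime_pos {l : List (ℝ × M)} (h : ∀ x ∈ l, 0 < x.1) (hne : l ≠ []) :
    0 < lastTime l := by
  obtain ⟨e, he, h'⟩ := exists_mem_eq_lastTime hne
  exact h' ▸ h e he

theorem measurable_lastTime [MeasurableSpace M] :
    Measurable (lastTime : List (ℝ × M) → ℝ) :=
  (measurable_foldl (s := fun _ (e : ℝ × M) => e.1) measurable_snd.fst).comp
    measurable_prodMk_left

theorem lastTime_shift {l : List (ℝ × M)} (hne : l ≠ []) (c : ℝ) :
    lastTime (shift c l) = lastTime l + c := by
  rcases List.eq_nil_or_concat l with rfl | ⟨l', e, rfl⟩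
  · exact absurd rfl hne
  · rw [List.concat_eq_append]
    simp only [shift, List.map_append, List.map_cons, List.map_nil, lastTime_append_singleton]

theorem lastTime_append {l l' : List (ℝ × M)} (hne : l' ≠ []) :
    lastTime (l ++ l') = lastTime l' := by
  rcases List.eq_nil_or_concat l' with rfl | ⟨l'', e, rfl⟩
  · exact absurd rfl hne
  · rw [List.concat_eq_append, ← List.append_assoc, lastTime_append_singleton,
      lastTime_append_singleton]

theorem increasing_shift {c : ℝ} {l : List (ℝ × M)} : Increasing (shift c l) ↔ Increasing l := by
  simp [Increasing, shift, List.pairwise_map]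

end LastTime

/-! ### Invariance of paths under the flow -/

namespace Dynamics

variable {E M M' : Type*} {D : Dynamics E M} {D' : Dynamics E M'} {rev : E → M → M'}

/-- The flow is a group action of `ℝ`. -/
structure IsFlow (D : Dynamics E M) : Prop where
  zero : ∀ x, D.flow 0 x = x
  add : ∀ s t x, D.flow (s + t) x = D.flow s (D.flow t x)

theorem IsFlow.flow_flow (h : D.IsFlow) {s t u : ℝ} (x : E) (hu : s + t = u) :
    D.flow s (D.flow t x) = D.flow u x := by
  rw [← h.add, hu]

/-- `q` is reached from `p` by the flow. -/
def Connected (D : Dynamics E M) (p q : E × ℝ) : Prop := q.1 = D.flow (q.2 - p.2) p.1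

theorem Connected.step_eq (hD : D.IsFlow) {p q : E × ℝ} (h : D.Connected p q) (e : ℝ × M) :
    D.flow (e.1 - q.2) q.1 = D.flow (e.1 - p.2) p.1 := by
  rw [show q.1 = _ from h, hD.flow_flow _ (sub_add_sub_cancel _ _ _)]

/-- The recursion uses its starting state only after flowing to the next event, so any other state
on the same flow line gives the same event points. This is why the left end of a segment can be
moved freely between events. -/
theorem Connected.eventPointsAux_eq (hD : D.IsFlow) {p q : E × ℝ} (h : D.Connected p q)
    (l : List (ℝ × M)) : D.eventPointsAux q l = D.eventPointsAux p l := by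
  cases l with
  | nil => rfl
  | cons e l => simp only [eventPointsAux, step, h.step_eq hD e]

theorem Connected.reverseAux_eq (hD : D.IsFlow) {p q : E × ℝ} (h : D.Connected p q) (T : ℝ)
    (acc : List (ℝ × M')) (l : List (ℝ × M)) :
    D.reverseAux rev T q acc l = D.reverseAux rev T p acc l := by
  cases l with
  | nil =>
    simp only [reverseAux]
    rw [show q.1 = _ from h, hD.flow_flow _ (sub_add_sub_cancel _ _ _)]
  | cons e l => simp only [reverseAux, step, h.step_eq hD e]

theorem foldl_step_snd (p : E × ℝ) (l : List (ℝ × M)) :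
    (l.foldl D.step p).2 = l.foldl (fun _ e => e.1) p.2 := by
  induction l generalizing p with
  | nil => rfl
  | cons e l ih => simp only [List.foldl_cons, ih, step]

theorem walk_snd (w : Path E M) : (D.walk w).2 = lastTime w.2 := foldl_step_snd _ _

theorem reverseAux_fst (T : ℝ) (p : E × ℝ) (acc : List (ℝ × M')) (l : List (ℝ × M)) :
    (D.reverseAux rev T p acc l).1 =
      D.flow (T - (l.foldl D.step p).2) (l.foldl D.step p).1 := by
  induction l generalizing p acc with
  | nil => rfl
  | cons e l ih => simp only [reverseAux, ih, List.foldl_cons]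

theorem reverse_fst (T : ℝ) (w : Path E M) : (D.reverse rev T w).1 = D.stateAt T w :=
  reverseAux_fst _ _ _ _

theorem reverseAux_snd (T : ℝ) (p : E × ℝ) (acc : List (ℝ × M')) (l : List (ℝ × M)) :
    (D.reverseAux rev T p acc l).2 = (D.reverseAux rev T p [] l).2 ++ acc := by
  induction l generalizing p acc with
  | nil => rfl
  | cons e l ih =>
    simp only [reverseAux]
    rw [ih, ih (acc := [_]), List.append_assoc]
    rfl

theorem reverseAux_times (T : ℝ) (p : E × ℝ) (l : List (ℝ × M)) :
    (D.reverseAux rev T p [] l).2.map Prod.fst = (l.map fun e => T - e.1).reverse := by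
  induction l generalizing p with
  | nil => rfl
  | cons e l ih =>
    simp only [reverseAux]
    rw [reverseAux_snd, List.map_append, ih]
    simp

theorem reverse_times (T : ℝ) (w : Path E M) :
    (D.reverse rev T w).2.map Prod.fst = (w.2.map fun e => T - e.1).reverse :=
  reverseAux_times _ _ _

theorem forall_mem_reverse {T : ℝ} {w : Path E M} {P : ℝ → Prop} :
    (∀ x ∈ (D.reverse rev T w).2, P x.1) ↔ ∀ x ∈ w.2, P (T - x.1) := by
  have h : (∀ t ∈ (D.reverse rev T w).2.map Prod.fst, P t) ↔
      ∀ t ∈ (w.2.map fun e => T - e.1).reverse, P t := by rw [reverse_times]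
  simpa only [List.mem_reverse, List.forall_mem_map] using h

theorem exists_mem_reverse {T : ℝ} {w : Path E M} {P : ℝ → Prop} :
    (∃ x ∈ (D.reverse rev T w).2, P x.1) ↔ ∃ x ∈ w.2, P (T - x.1) := by
  have h := not_congr (forall_mem_reverse (D := D) (rev := rev) (T := T) (w := w)
    (P := fun t => ¬ P t))
  push Not at h
  exact h

theorem increasing_reverse {T : ℝ} {w : Path E M} :
    Increasing (D.reverse rev T w).2 ↔ Increasing w.2 := by
  have h : ((D.reverse rev T w).2.map Prod.fst).Pairwise (· < ·) ↔
      ((w.2.map fun e => T - e.1).reverse).Pairwise (· < ·) := by rw [reverse_times]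
  rw [List.pairwise_map, List.pairwise_reverse, List.pairwise_map] at h
  simpa [Increasing] using h

theorem reverse_eq_nil {T : ℝ} {w : Path E M} :
    (D.reverse rev T w).2 = [] ↔ w.2 = [] := by
  have h := congrArg List.length (reverse_times (D := D) (rev := rev) T w)
  simp only [List.length_map, List.length_reverse] at h
  rw [← List.length_eq_zero_iff, h, List.length_eq_zero_iff]

theorem lastTime_reverse_cons (T : ℝ) (x : E) (e : ℝ × M) (l : List (ℝ × M)) :
    lastTime (D.reverse rev T (x, e :: l)).2 = T - e.1 := by
  simp only [reverse, reverseAux]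
  rw [reverseAux_snd, lastTime_append_singleton]

theorem reverseAux_shift (T c : ℝ) (x : E) (t : ℝ) (acc : List (ℝ × M')) (l : List (ℝ × M)) :
    D.reverseAux rev (T + c) (x, t + c) acc (shift c l) = D.reverseAux rev T (x, t) acc l := by
  induction l generalizing x t acc with
  | nil => simp [shift, reverseAux]
  | cons e l ih =>
    rw [shift_cons]
    simp only [reverseAux, step, add_sub_add_right_eq_sub]
    exact ih _ _ _

/-- Reversal starts from the terminal state, so an initial stretch of pure flow leaves no trace in
it. -/
theorem reverse_shift (hD : D.IsFlow) (T c : ℝ) (x : E) (l : List (ℝ × M)) :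
    D.reverse rev (T + c) (x, shift c l) = D.reverse rev T (D.flow c x, l) := by
  unfold reverse
  have h : D.Connected (x, 0) (D.flow c x, 0 + c) := by simp [Connected]
  rw [← h.reverseAux_eq hD]
  exact reverseAux_shift T c _ 0 [] l

theorem eventPointsAux_shift (c : ℝ) (x : E) (t : ℝ) (l : List (ℝ × M)) :
    D.eventPointsAux (x, t + c) (shift c l) =
      (D.eventPointsAux (x, t) l).map fun p => (p.1 + c, p.2) := by
  induction l generalizing x t with
  | nil => rfl
  | cons e l ih =>
    rw [shift_cons]
    simp only [eventPointsAux, step, add_sub_add_right_eq_sub, List.map_cons, ih]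

theorem eventPointsAux_append (p : E × ℝ) (l l' : List (ℝ × M)) :
    D.eventPointsAux p (l ++ l') =
      D.eventPointsAux p l ++ D.eventPointsAux (l.foldl D.step p) l' := by
  induction l generalizing p with
  | nil => rfl
  | cons e l ih => simp only [eventPointsAux, List.cons_append, List.foldl_cons, ih]

/-- The events of `D'`, with the marks `rev`, undo those of `D`. -/
structure Undoes (D : Dynamics E M) (D' : Dynamics E M') (rev : E → M → M') : Prop where
  isFlow : D.IsFlow
  flow_neg : ∀ t x, D'.flow t x = D.flow (-t) x
  jump_rev : ∀ x v, D'.jump (D.jump x v) (rev x v) = x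

theorem Undoes.isFlow' (h : Undoes D D' rev) : D'.IsFlow where
  zero x := by rw [h.flow_neg, neg_zero, h.isFlow.zero]
  add s t x := by rw [h.flow_neg, h.flow_neg, h.flow_neg, neg_add, h.isFlow.add]

/-- The invariant behind the recursion: the reversed path, after undoing the events still to be
read, is in the state `x` at time `T - t`, and continues from there with the events in `acc`. -/
theorem Undoes.eventPointsAux_reverseAux (h : Undoes D D' rev) (T : ℝ) (x : E) (t : ℝ)
    (acc : List (ℝ × M')) (l : List (ℝ × M)) :
    D'.eventPoints (D.reverseAux rev T (x, t) acc l) =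
      ((D.eventPointsAux (x, t) l).map fun p => (T - p.1, p.2.2, p.2.1)).reverse ++
        D'.eventPointsAux (x, T - t) acc := by
  induction l generalizing x t acc with
  | nil =>
    simp only [reverseAux, eventPoints, eventPointsAux, List.map_nil, List.reverse_nil,
      List.nil_append]
    refine Connected.eventPointsAux_eq h.isFlow' ?_ acc |>.symm
    simp only [Connected, h.flow_neg]
    rw [h.isFlow.flow_flow x (u := 0) (by ring), h.isFlow.zero]
  | cons e l ih =>
    simp only [reverseAux, step]
    rw [ih]
    simp only [eventPointsAux, step, List.map_cons, List.reverse_cons, List.append_assoc,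
      sub_self, h.isFlow'.zero, h.jump_rev]
    congr 1
    simp only [List.cons_append, List.nil_append]
    congr 1
    refine Connected.eventPointsAux_eq h.isFlow' ?_ acc
    simp only [Connected, h.flow_neg]
    congr 1
    ring

theorem Undoes.eventPoints_reverse (h : Undoes D D' rev) (T : ℝ) (w : Path E M) :
    D'.eventPoints (D.reverse rev T w) =
      ((D.eventPoints w).map fun p => (T - p.1, p.2.2, p.2.1)).reverse := by
  unfold reverse
  rw [h.eventPointsAux_reverseAux]
  simp [eventPoints, eventPointsAux]

/-- The recursion moves events from the list `l` to the accumulator `acc`. Reversing again moves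
them back, so an interrupted reversal equals an interrupted second reversal with `l` and `acc`
exchanged. -/
theorem Undoes.reverse_reverseAux (h : Undoes D D' rev) {rev' : E → M' → M}
    (h' : ∀ x v, rev' (D.jump x v) (rev x v) = v) (T : ℝ) (x : E) (t : ℝ) (acc : List (ℝ × M'))
    (l : List (ℝ × M)) :
    D'.reverse rev' T (D.reverseAux rev T (x, t) acc l) =
      D'.reverseAux rev' T (x, T - t) l acc := by
  induction l generalizing x t acc with
  | nil =>
    simp only [reverseAux, reverse]
    refine Connected.reverseAux_eq h.isFlow' ?_ T [] acc |>.symm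
    simp only [Connected, h.flow_neg]
    rw [h.isFlow.flow_flow x (u := 0) (by ring), h.isFlow.zero]
  | cons e l ih =>
    simp only [reverseAux, step]
    rw [ih]
    simp only [reverseAux, step, sub_self, h.isFlow'.zero, h.jump_rev, h', sub_sub_cancel]
    refine Connected.reverseAux_eq h.isFlow' ?_ T _ acc
    simp only [Connected, h.flow_neg]
    congr 1
    ring

theorem Undoes.reverse_reverse (h : Undoes D D' rev) {rev' : E → M' → M}
    (h' : ∀ x v, rev' (D.jump x v) (rev x v) = v) (T : ℝ) (w : Path E M) :
    D'.reverse rev' T (D.reverse rev T w) = w := by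
  rw [show D.reverse rev T w = D.reverseAux rev T (w.1, 0) [] w.2 from rfl,
    h.reverse_reverseAux h']
  simp [reverseAux, h.isFlow'.zero]

/-! ### Measurability -/

/-- The data of the dynamics are jointly measurable. -/
structure IsMeasurable [MeasurableSpace E] [MeasurableSpace M] (D : Dynamics E M) : Prop where
  flow : Measurable fun p : ℝ × E => D.flow p.1 p.2
  jump : Measurable fun p : E × M => D.jump p.1 p.2
  markDensity : Measurable fun p : E × M => D.markDensity p.1 p.2

section Measurability

variable [MeasurableSpace E] [MeasurableSpace M] [MeasurableSpace M']

theorem IsMeasurable.preJump (h : D.IsMeasurable) :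
    Measurable fun p : (E × ℝ) × (ℝ × M) => D.flow (p.2.1 - p.1.2) p.1.1 :=
  h.flow.comp ((measurable_snd.fst.sub measurable_fst.snd).prodMk measurable_fst.fst)

theorem IsMeasurable.step (h : D.IsMeasurable) :
    Measurable fun p : (E × ℝ) × (ℝ × M) => D.step p.1 p.2 :=
  (h.jump.comp (h.preJump.prodMk measurable_snd.snd)).prodMk measurable_snd.fst

theorem IsMeasurable.walk (h : D.IsMeasurable) : Measurable (D.walk : Path E M → E × ℝ) :=
  (measurable_foldl h.step).comp
    ((measurable_fst.prodMk measurable_const).prodMk measurable_snd)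

theorem IsMeasurable.stateAt (h : D.IsMeasurable) :
    Measurable fun p : ℝ × Path E M => D.stateAt p.1 p.2 :=
  have hw : Measurable fun p : ℝ × Path E M => D.walk p.2 := h.walk.comp measurable_snd
  h.flow.comp ((measurable_fst.sub hw.snd).prodMk hw.fst)

theorem IsMeasurable.reverse (h : D.IsMeasurable)
    (hrev : Measurable fun p : E × M => rev p.1 p.2) :
    Measurable fun p : ℝ × Path E M => D.reverse rev p.1 p.2 := by
  have key : Measurable fun p : (ℝ × (E × ℝ) × List (ℝ × M')) × List (ℝ × M) =>
      D.reverseAux rev p.1.1 p.1.2.1 p.1.2.2 p.2 := by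
    refine measurable_prod_list fun k => ?_
    induction k with
    | zero =>
      simp only [List.ofFn_zero, reverseAux]
      exact (h.flow.comp ((measurable_fst.fst.sub measurable_fst.snd.fst.snd).prodMk
        measurable_fst.snd.fst.fst)).prodMk measurable_fst.snd.snd
    | succ k ih =>
      simp only [List.ofFn_succ, reverseAux]
      have h0 : Measurable fun p : (ℝ × (E × ℝ) × List (ℝ × M')) × (Fin (k + 1) → ℝ × M) =>
          p.2 0 := (measurable_pi_apply 0).comp measurable_snd
      have hs : Measurable fun p : (ℝ × (E × ℝ) × List (ℝ × M')) × (Fin (k + 1) → ℝ × M) =>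
          fun i : Fin k => p.2 i.succ :=
        measurable_pi_lambda _ fun i => (measurable_pi_apply i.succ).comp measurable_snd
      have hp : Measurable fun p : (ℝ × (E × ℝ) × List (ℝ × M')) × (Fin (k + 1) → ℝ × M) =>
          (p.1.2.1, p.2 0) := measurable_fst.snd.fst.prodMk h0
      exact ih.comp ((measurable_fst.fst.prodMk ((h.step.comp hp).prodMk
        (((measurable_fst.fst.sub h0.fst).prodMk
          (hrev.comp ((h.preJump.comp hp).prodMk h0.snd))).listCons
          measurable_fst.snd.snd))).prodMk hs)
  exact key.comp ((measurable_fst.prodMk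
    ((measurable_snd.fst.prodMk measurable_const).prodMk measurable_const)).prodMk
    measurable_snd.snd)

end Measurability

end Dynamics

/-! ### Densities -/

section Density

variable {E M : Type*} [MeasurableSpace E] [MeasurableSpace M] {D : Dynamics E M} {L : Rate E M}

/-- The interval of integration depends on the parameter. Writing the integral over an interval as
that of an indicator on the whole line reduces the claim to the measurability of parametric
integrals. -/
theorem measurable_survival (L : Rate E M) :
    Measurable fun p : Path E M × ℝ => L.survival p.1 p.2 := by
  have h : Measurable fun p : (Path E M × ℝ) × ℝ => (L.rate p.1.1 p.2 : ℝ) :=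
    measurable_coe_nnreal_real.comp
      (L.measurable_rate.comp (measurable_fst.fst.prodMk measurable_snd))
  have key : ∀ f g : Path E M × ℝ → ℝ, Measurable f → Measurable g →
      Measurable fun p : Path E M × ℝ => ∫ u in Ioc (f p) (g p), (L.rate p.1 u : ℝ) := by
    intro f g hf hg
    have hs : MeasurableSet {q : (Path E M × ℝ) × ℝ | q.2 ∈ Ioc (f q.1) (g q.1)} :=
      (measurableSet_lt (hf.comp measurable_fst) measurable_snd).inter
        (measurableSet_le measurable_snd (hg.comp measurable_fst))
    have h2 := (h.indicator hs).stronglyMeasurable.integral_prod_right' (ν := volume)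
    convert h2.measurable using 2 with p
    rw [← integral_indicator measurableSet_Ioc]
    rfl
  unfold Rate.survival intervalIntegral
  exact ENNReal.measurable_ofReal.comp (Real.measurable_exp.comp
    ((key _ _ measurable_const measurable_snd).sub
      (key _ _ measurable_snd measurable_const)).neg)

attribute [local irreducible] Rate.survival in
theorem _root_.Measurable.survival {β : Type*} [MeasurableSpace β] (L : Rate E M)
    {f : β → Path E M} {g : β → ℝ} (hf : Measurable f) (hg : Measurable g) :
    Measurable fun b => L.survival (f b) (g b) :=
  (measurable_survival L).comp (hf.prodMk hg)

theorem survival_zero (L : Rate E M) (w : Path E M) : L.survival w 0 = 1 := by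
  simp [Rate.survival]

end Density

section Density

variable {E M : Type*} [MeasurableSpace E] [MeasureSpace M] {D : Dynamics E M} {L : Rate E M}

theorem measurable_nextDensity (hD : D.IsMeasurable) (L : Rate E M) :
    Measurable fun p : Path E M × (ℝ × M) => nextDensity D L p.1 p.2 := by
  have hw : Measurable fun p : Path E M × (ℝ × M) => D.walk p.1 := hD.walk.comp measurable_fst
  have ht : Measurable fun p : Path E M × (ℝ × M) => (p.1, p.2.1 - (D.walk p.1).2) :=
    measurable_fst.prodMk (measurable_snd.fst.sub hw.snd)
  have h1 : Measurable fun p : Path E M × (ℝ × M) =>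
      D.flow (p.2.1 - (D.walk p.1).2) (D.walk p.1).1 := hD.flow.comp (ht.snd.prodMk hw.fst)
  exact ((measurable_coe_nnreal_ennreal.comp (L.measurable_rate.comp ht)).mul
    (ht.fst.survival L ht.snd)).mul (hD.markDensity.comp (h1.prodMk measurable_snd.snd))

/-- Product of the densities of the events `ev` that follow the events `past`. -/
noncomputable def eventDensityAux (D : Dynamics E M) (L : Rate E M) (z : E) :
    List (ℝ × M) → List (ℝ × M) → ℝ≥0∞
  | _, [] => 1
  | past, e :: ev => nextDensity D L (z, past) e * eventDensityAux D L z (past ++ [e]) ev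

/-- Product of the densities of the events of a path that starts from `z`. -/
noncomputable def eventDensity (D : Dynamics E M) (L : Rate E M) (z : E) (ev : List (ℝ × M)) :
    ℝ≥0∞ := eventDensityAux D L z [] ev

theorem eventDensity_append_singleton (z : E) (ev : List (ℝ × M)) (e : ℝ × M) :
    eventDensity D L z (ev ++ [e]) = eventDensity D L z ev * nextDensity D L (z, ev) e := by
  have key : ∀ past : List (ℝ × M), eventDensityAux D L z past (ev ++ [e]) =
      eventDensityAux D L z past ev * nextDensity D L (z, past ++ ev) e := by
    induction ev with
    | nil => intro past; simp [eventDensityAux]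
    | cons f ev ih =>
      intro past
      simp only [List.cons_append, eventDensityAux, ih, List.append_assoc, List.nil_append,
        mul_assoc]
  exact key []

/-- The law of the process is built by adding events at the end of the list, while `pathDensity`
also carries a final survival factor that such an addition would change. Separating this factor
leaves a quantity that is multiplicative under appending. -/
theorem pathDensity_eq (T : ℝ) (z : E) (ev : List (ℝ × M)) :
    pathDensity D L T z ev = eventDensity D L z ev * L.survival (z, ev) (T - lastTime ev) := by
  have key : ∀ past : List (ℝ × M), pathDensityAux D L T z past ev =
      eventDensityAux D L z past ev *
        L.survival (z, past ++ ev) (T - (D.walk (z, past ++ ev)).2) := by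
    induction ev with
    | nil => intro past; simp [eventDensityAux, pathDensityAux]
    | cons f ev ih =>
      intro past
      simp only [eventDensityAux, pathDensityAux, ih, List.append_assoc, List.cons_append,
        List.nil_append, mul_assoc]
  have h := key []
  rw [List.nil_append, Dynamics.walk_snd] at h
  exact h

/-- A path that ends with an event has no survival factor. This is how the random horizon in the
direction of stopping still leads to the density for a fixed horizon. -/
theorem pathDensity_lastTime (z : E) (ev : List (ℝ × M)) :
    pathDensity D L (lastTime ev) z ev = eventDensity D L z ev := by
  rw [pathDensity_eq, sub_self, survival_zero, mul_one]

theorem measurable_eventDensity (hD : D.IsMeasurable) (L : Rate E M) :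
    Measurable fun p : Path E M => eventDensity D L p.1 p.2 := by
  have key : Measurable fun p : Path E M × List (ℝ × M) =>
      eventDensityAux D L p.1.1 p.1.2 p.2 := by
    refine measurable_prod_list fun k => ?_
    induction k with
    | zero => simp only [List.ofFn_zero, eventDensityAux]; exact measurable_const
    | succ k ih =>
      simp only [List.ofFn_succ, eventDensityAux]
      have h0 : Measurable fun p : Path E M × (Fin (k + 1) → ℝ × M) => p.2 0 :=
        (measurable_pi_apply 0).comp measurable_snd
      have hs : Measurable fun p : Path E M × (Fin (k + 1) → ℝ × M) =>
          fun i : Fin k => p.2 i.succ :=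
        measurable_pi_lambda _ fun i => (measurable_pi_apply i.succ).comp measurable_snd
      exact ((measurable_nextDensity hD L).comp (measurable_fst.prodMk h0)).mul
        (ih.comp ((measurable_fst.fst.prodMk (measurable_fst.snd.listAppend
          (h0.listCons measurable_const))).prodMk hs))
  exact key.comp ((measurable_fst.prodMk measurable_const).prodMk measurable_snd)

attribute [local irreducible] eventDensity in
theorem _root_.Measurable.eventDensity {β : Type*} [MeasurableSpace β] (hD : D.IsMeasurable)
    (L : Rate E M) {f : β → E} {g : β → List (ℝ × M)} (hf : Measurable f) (hg : Measurable g) :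
    Measurable fun b => eventDensity D L (f b) (g b) :=
  (measurable_eventDensity hD L).comp (hf.prodMk hg)

theorem _root_.Measurable.pathDensity {β : Type*} [MeasurableSpace β] (hD : D.IsMeasurable)
    (L : Rate E M) {t : β → ℝ} {f : β → E} {g : β → List (ℝ × M)} (ht : Measurable t)
    (hf : Measurable f) (hg : Measurable g) :
    Measurable fun b => pathDensity D L (t b) (f b) (g b) := by
  simp only [pathDensity_eq]
  exact (Measurable.eventDensity hD L hf hg).mul
    ((hf.prodMk hg).survival L (ht.sub (measurable_lastTime.comp hg)))

end Density

/-! ### Forward and backward dynamics -/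

namespace ReversiblePDMP

variable {E V Vr : Type*} [MeasureSpace E] [MeasureSpace V] [MeasureSpace Vr]
  (G : ReversiblePDMP E V Vr)

theorem isFlow_fwd : G.fwd.IsFlow := ⟨G.flow_zero, G.flow_add⟩

theorem isFlow_bwd : G.bwd.IsFlow where
  zero x := by simp [bwd, G.flow_zero]
  add s t x := by simp only [bwd, neg_add, G.flow_add]

theorem undoes_fwd : G.fwd.Undoes G.bwd G.mark := ⟨G.isFlow_fwd, fun _ _ => rfl, G.rjump_mark⟩

theorem undoes_bwd : G.bwd.Undoes G.fwd G.rmark :=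
  ⟨G.isFlow_bwd, fun t x => by simp [bwd, fwd], G.jump_rmark⟩

/-- The assumptions only say that states are restored; injectivity of the jump map in its mark
upgrades this to marks. -/
theorem rmark_mark (x : E) (v : V) : G.rmark (G.jump x v) (G.mark x v) = v := by
  have h := G.jump_rmark (G.jump x v) (G.mark x v)
  rw [G.rjump_mark] at h
  exact G.jump_injective x h

theorem mark_rmark (y : E) (u : Vr) : G.mark (G.rjump y u) (G.rmark y u) = u := by
  have h := G.rjump_mark (G.rjump y u) (G.rmark y u)
  rw [G.jump_rmark] at h
  exact G.rjump_injective y h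

theorem Rinv_R (T : ℝ) (w : Path E V) : G.Rinv T (G.R T w) = w :=
  G.undoes_fwd.reverse_reverse G.rmark_mark T w

theorem R_Rinv (T : ℝ) (w : Path E Vr) : G.R T (G.Rinv T w) = w :=
  G.undoes_bwd.reverse_reverse G.mark_rmark T w

theorem isMeasurable_fwd : G.fwd.IsMeasurable :=
  ⟨G.measurable_flow, G.measurable_jump, G.measurable_density⟩

theorem isMeasurable_bwd : G.bwd.IsMeasurable :=
  ⟨G.measurable_flow.comp (measurable_fst.neg.prodMk measurable_snd), G.measurable_rjump,
    G.measurable_rdensity⟩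

theorem measurable_R : Measurable fun p : ℝ × Path E V => G.R p.1 p.2 :=
  G.isMeasurable_fwd.reverse G.measurable_mark

theorem measurable_Rinv : Measurable fun p : ℝ × Path E Vr => G.Rinv p.1 p.2 :=
  G.isMeasurable_bwd.reverse G.measurable_rmark

end ReversiblePDMP

end NutsPDMP

namespace NutsPDMP

/-! ### The law of the events -/

section Survival

variable {E M : Type*} [MeasurableSpace E] [MeasurableSpace M]

/-- On nonnegative arguments $x\mapsto e^{-x}$ is 1-Lipschitz, and composition with a Lipschitz map
preserves absolute continuity. -/
theorem absolutelyContinuous_exp_neg {g : ℝ → ℝ} {r : ℝ} (hr : 0 ≤ r)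
    (hg : AbsolutelyContinuousOnInterval g 0 r) (h0 : ∀ u ∈ Icc 0 r, 0 ≤ g u) :
    AbsolutelyContinuousOnInterval (fun u => Real.exp (-g u)) 0 r := by
  rw [absolutelyContinuousOnInterval_iff] at hg ⊢
  intro ε hε
  obtain ⟨δ, hδ, h⟩ := hg ε hε
  refine ⟨δ, hδ, fun I hI hlt => (Finset.sum_le_sum fun i hi => ?_).trans_lt (h I hI hlt)⟩
  have hlip : ∀ a b : ℝ, 0 ≤ a → a ≤ b → dist (Real.exp (-a)) (Real.exp (-b)) ≤ dist a b := by
    intro a b ha hab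
    rw [Real.dist_eq, Real.dist_eq, abs_of_nonneg (by
      rw [sub_nonneg, Real.exp_le_exp]; linarith), abs_sub_comm a b, abs_of_nonneg (by linarith)]
    have h1 : Real.exp (-b) = Real.exp (-a) * Real.exp (a - b) := by
      rw [← Real.exp_add]; ring_nf
    have h2 : a - b + 1 ≤ Real.exp (a - b) := Real.add_one_le_exp _
    have h3 : Real.exp (-a) ≤ 1 := Real.exp_le_one_iff.2 (by linarith)
    have h4 : 0 < Real.exp (-a) := Real.exp_pos _
    rw [h1]
    nlinarith
  have hm := hI.1 i hi
  rw [uIcc_of_le hr] at hm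
  rcases le_total (g (I.2 i).1) (g (I.2 i).2) with hle | hle
  · exact hlip _ _ (h0 _ hm.1) hle
  · rw [dist_comm, dist_comm (g (I.2 i).1)]
    exact hlip _ _ (h0 _ hm.2) hle

/-- The integrand is minus the derivative of the survival probability. The rate is only locally
integrable, so this holds almost everywhere and the fundamental theorem for absolutely continuous
functions is used. -/
theorem lintegral_rate_mul_survival (L : Rate E M) (w : Path E M) {r : ℝ} (hr : 0 ≤ r) :
    (∫⁻ u in Ioc 0 r, (L.rate w u : ℝ≥0∞) * L.survival w u) + L.survival w r = 1 := by
  have hint := L.integrable_rate w r hr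
  set g : ℝ → ℝ := fun u => ∫ v in (0 : ℝ)..u, (L.rate w v : ℝ) with hgdef
  have hg0 : ∀ u ∈ Icc 0 r, 0 ≤ g u := fun u hu =>
    intervalIntegral.integral_nonneg hu.1 fun _ _ => NNReal.coe_nonneg _
  have hac : AbsolutelyContinuousOnInterval (fun u => Real.exp (-g u)) 0 r :=
    absolutelyContinuous_exp_neg hr
    (hint.absolutelyContinuousOnInterval_intervalIntegral left_mem_uIcc) hg0
  have hderiv : ∀ᵐ u, u ∈ uIoc 0 r →
      deriv (fun u => Real.exp (-g u)) u = -((L.rate w u : ℝ) * Real.exp (-g u)) := by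
    filter_upwards [hint.ae_hasDerivAt_integral] with u hu hm
    have h : HasDerivAt (fun u => Real.exp (-g u)) _ u :=
      (hu (uIoc_subset_uIcc hm) 0 left_mem_uIcc).neg.exp
    rw [h.deriv, mul_comm, neg_mul]
    rfl
  have hI1 : IntervalIntegrable (fun u => (L.rate w u : ℝ) * Real.exp (-g u)) volume 0 r := by
    have := hac.intervalIntegrable_deriv.neg.congr_ae
      (g := fun u => (L.rate w u : ℝ) * Real.exp (-g u)) ?_
    · exact this
    · rw [Filter.EventuallyEq, ae_restrict_iff' measurableSet_uIoc]
      filter_upwards [hderiv] with u hu hm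
      simp only [Pi.neg_apply]
      rw [hu hm, neg_neg]
  have h1 : ∫ u in (0 : ℝ)..r, (L.rate w u : ℝ) * Real.exp (-g u) = 1 - Real.exp (-g r) := by
    have h2 := hac.integral_deriv_eq_sub
    rw [intervalIntegral.integral_congr_ae hderiv, intervalIntegral.integral_neg] at h2
    have h3 : g 0 = 0 := intervalIntegral.integral_same
    rw [h3, neg_zero, Real.exp_zero] at h2
    linarith
  have h2 : ∫⁻ u in Ioc 0 r, (L.rate w u : ℝ≥0∞) * L.survival w u =
      ENNReal.ofReal (1 - Real.exp (-g r)) := by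
    rw [← h1, intervalIntegral.integral_of_le hr,
      ofReal_integral_eq_lintegral_ofReal ((intervalIntegrable_iff_integrableOn_Ioc_of_le hr).1 hI1)
        (Filter.Eventually.of_forall fun u => mul_nonneg (NNReal.coe_nonneg _) (Real.exp_pos _).le)]
    refine lintegral_congr fun u => ?_
    rw [ENNReal.ofReal_mul (NNReal.coe_nonneg _), ENNReal.ofReal_coe_nnreal]
    rfl
  rw [h2]
  unfold Rate.survival
  rw [← ENNReal.ofReal_add _ (Real.exp_pos _).le]
  · simp [hgdef]
  · rw [sub_nonneg, Real.exp_le_one_iff, neg_nonpos]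
    exact hg0 r ⟨hr, le_rfl⟩

end Survival

section Law

variable {E M : Type*} [MeasurableSpace E] [MeasureSpace M] [SigmaFinite (volume : Measure M)]
  {D : Dynamics E M} {L : Rate E M} {K : Kernel E (ℕ → Option (ℝ × M))}

set_option linter.unusedSectionVars false

theorem lintegral_nextEvent (hD : D.IsMeasurable) (w : Path E M) {F : ℝ × M → ℝ≥0∞}
    (hF : Measurable F) :
    ∫⁻ e, F e ∂nextEvent D L w = ∫⁻ e, ind (lastTime w.2 < e.1) * (nextDensity D L w e * F e)
      ∂(volume : Measure ℝ).prod (volume : Measure M) := by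
  have hn : Measurable (nextDensity D L w) :=
    (measurable_nextDensity hD L).comp measurable_prodMk_left
  have h1 : ((volume : Measure ℝ).restrict (Ioi (D.walk w).2)).prod (volume : Measure M) =
      ((volume : Measure ℝ).prod (volume : Measure M)).restrict {e | lastTime w.2 < e.1} := by
    rw [← Measure.restrict_univ (μ := (volume : Measure M)), Measure.prod_restrict,
      Measure.restrict_univ, Dynamics.walk_snd]
    congr 1
    ext e
    simp
  have hs : MeasurableSet {e : ℝ × M | lastTime w.2 < e.1} :=
    measurableSet_lt measurable_const measurable_fst
  unfold nextEvent
  rw [lintegral_withDensity_eq_lintegral_mul _ hn hF, h1, lintegral_ind_mul hs]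
  rfl

/-- The mark densities integrate to one, so only the waiting time remains, and it is covered by
`lintegral_rate_mul_survival`. -/
theorem nextEvent_le_add_survival (hD : D.IsMeasurable) (h1 : ∀ x, ∫⁻ v, D.markDensity x v = 1)
    (w : Path E M) {a : ℝ} (ha : lastTime w.2 ≤ a) :
    nextEvent D L w {e | e.1 ≤ a} + L.survival w (a - lastTime w.2) = 1 := by
  have hs : MeasurableSet {e : ℝ × M | e.1 ≤ a} := measurableSet_le measurable_fst measurable_const
  have hr : Measurable fun t : ℝ => (L.rate w t : ℝ≥0∞) * L.survival w t :=
    (measurable_coe_nnreal_ennreal.comp (L.measurable_rate.comp measurable_prodMk_left)).mul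
      (measurable_const.survival L measurable_id)
  rw [← lintegral_rate_mul_survival L w (sub_nonneg.2 ha)]
  congr 1
  have hi : Measurable fun e : ℝ × M => ind (e.1 ≤ a) := measurable_ind hs
  have h2 : nextEvent D L w {e | e.1 ≤ a} = ∫⁻ e, ind (e.1 ≤ a) ∂nextEvent D L w :=
    (lintegral_ind hs).symm
  rw [h2, lintegral_nextEvent hD w hi, lintegral_prod]
  swap
  · exact ((measurable_ind (measurableSet_lt measurable_const measurable_fst)).mul
      (((measurable_nextDensity hD L).comp measurable_prodMk_left).mul hi)).aemeasurable
  have h3 : ∀ t : ℝ, ∫⁻ v, ind (lastTime w.2 < t) * (nextDensity D L w (t, v) * ind (t ≤ a)) =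
      (Ioc (lastTime w.2) a).indicator (fun t => (L.rate w (t - lastTime w.2) : ℝ≥0∞) *
        L.survival w (t - lastTime w.2)) t := by
    intro t
    have hm : Measurable fun v => D.markDensity (D.flow (t - (D.walk w).2) (D.walk w).1) v :=
      hD.markDensity.comp measurable_prodMk_left
    have h4 : ∀ v, ind (lastTime w.2 < t) * (nextDensity D L w (t, v) * ind (t ≤ a)) =
        (ind (lastTime w.2 < t) * ind (t ≤ a) * ((L.rate w (t - lastTime w.2) : ℝ≥0∞) *
        L.survival w (t - lastTime w.2))) *
        D.markDensity (D.flow (t - (D.walk w).2) (D.walk w).1) v := by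
      intro v
      unfold nextDensity
      simp only [Dynamics.walk_snd]
      ring
    simp only [h4]
    rw [lintegral_const_mul _ hm, h1, mul_one, ← ind_and]
    by_cases ht : t ∈ Ioc (lastTime w.2) a
    · rw [indicator_of_mem ht, ind_pos (p := _ ∧ _) ht, one_mul]
    · rw [indicator_of_notMem ht, ind_neg (p := _ ∧ _) ht, zero_mul]
  simp only [h3]
  rw [lintegral_indicator measurableSet_Ioc]
  have h5 := (measurePreserving_sub_right (volume : Measure ℝ) (lastTime w.2)).setLIntegral_comp_preimage
    (measurableSet_Ioc (a := 0) (b := a - lastTime w.2)) hr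
  rw [← h5]
  congr 2
  ext t
  simp

theorem measurableSet_length (n : ℕ) :
    MeasurableSet {N : ℕ → Option (ℝ × M) | (firstEvents N n).length = n} :=
  (measurable_length.comp (measurable_firstEvents n)) (measurableSet_singleton n)

theorem measurableSet_ne_none : MeasurableSet {o : Option (ℝ × M) | o ≠ none} := by
  refine measurableSet_option_iff.2 ?_
  convert MeasurableSet.univ
  ext e
  simp

theorem measurable_some : Measurable (some : ℝ × M → Option (ℝ × M)) :=
  fun _ hs => measurableSet_option_iff.1 hs

/-- Joint law of the first `n` events and of the next one. -/
theorem IsEventLaw.lintegral_next [IsFiniteKernel K] (hK : IsEventLaw D L K)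
    (hD : D.IsMeasurable) (z : E) (n : ℕ) {H : List (ℝ × M) × Option (ℝ × M) → ℝ≥0∞}
    (hH : Measurable H) :
    ∫⁻ N, ind ((firstEvents N n).length = n ∧ N n ≠ none) * H (firstEvents N n, N n) ∂K z =
      ∫⁻ N, ind ((firstEvents N n).length = n) *
        ∫⁻ e, ind (lastTime (firstEvents N n) < e.1) *
          (nextDensity D L (z, firstEvents N n) e * H (firstEvents N n, some e))
          ∂(volume : Measure ℝ).prod (volume : Measure M) ∂K z := by
  have hfe := measurable_firstEvents (M := M) n
  have hpair : Measurable fun N : ℕ → Option (ℝ × M) => (firstEvents N n, N n) :=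
    hfe.prodMk (measurable_pi_apply n)
  have hS : MeasurableSet {N : ℕ → Option (ℝ × M) | (firstEvents N n).length = n ∧ N n ≠ none} :=
    (measurableSet_length n).inter
      (measurableSet_preimage (f := fun N : ℕ → Option (ℝ × M) => N n) (measurable_pi_apply n)
        measurableSet_ne_none)
  set ρ : Measure (List (ℝ × M)) := ((K z).restrict
    {N | (firstEvents N n).length = n}).map fun N => firstEvents N n with hρ
  set g : List (ℝ × M) × (ℝ × M) → ℝ≥0∞ := fun p =>
    ind (lastTime p.1 < p.2.1) * nextDensity D L (z, p.1) p.2 with hg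
  have hgm : Measurable g :=
    (measurable_ind (measurableSet_lt (measurable_lastTime.comp measurable_fst)
      measurable_snd.fst)).mul ((measurable_nextDensity hD L).comp
        ((measurable_const.prodMk measurable_fst).prodMk measurable_snd))
  set μ := ((K z).restrict {N | (firstEvents N n).length = n ∧ N n ≠ none}).map
    fun N => (firstEvents N n, N n) with hμ
  set ν := ((ρ.prod ((volume : Measure ℝ).prod (volume : Measure M))).withDensity g).map
    fun p => (p.1, some p.2) with hν
  have hsm : Measurable fun p : List (ℝ × M) × (ℝ × M) => (p.1, some p.2) :=
    measurable_fst.prodMk (measurable_some.comp measurable_snd)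
  have key : μ = ν := by
    -- The defining property `next` of the law concerns rectangles only; they determine the joint
    -- law of past and next event.
    refine Measure.ext_prod fun {s t} hs ht => ?_
    have ht' : MeasurableSet ((some : ℝ × M → Option (ℝ × M)) ⁻¹' t) := measurable_some ht
    rw [hμ, hν, Measure.map_apply hpair (hs.prod ht), Measure.map_apply hsm (hs.prod ht),
      Measure.restrict_apply (hpair (hs.prod ht))]
    have h1 : (fun N : ℕ → Option (ℝ × M) => (firstEvents N n, N n)) ⁻¹' s ×ˢ t ∩
        {N | (firstEvents N n).length = n ∧ N n ≠ none} =
        {N | (firstEvents N n).length = n ∧ firstEvents N n ∈ s ∧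
          ∃ e ∈ (some : ℝ × M → Option (ℝ × M)) ⁻¹' t, N n = some e} := by
      ext N
      simp only [mem_inter_iff, mem_preimage, mem_prod, mem_ofPred_eq, Option.ne_none_iff_exists']
      constructor
      · rintro ⟨⟨h1, h2⟩, h3, e, he⟩
        exact ⟨h3, h1, e, he ▸ h2, he⟩
      · rintro ⟨h1, h2, e, he, h3⟩
        exact ⟨⟨h2, h3 ▸ he⟩, h1, e, h3⟩
    have h2 : (fun p : List (ℝ × M) × (ℝ × M) => (p.1, some p.2)) ⁻¹' s ×ˢ t =
        s ×ˢ ((some : ℝ × M → Option (ℝ × M)) ⁻¹' t) := rfl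
    rw [h1, hK.next z n s _ hs ht', h2, withDensity_apply _ (hs.prod ht'), ← Measure.prod_restrict,
      lintegral_prod _ hgm.aemeasurable]
    have h3 : ∀ l : List (ℝ × M),
        ∫⁻ e in (some : ℝ × M → Option (ℝ × M)) ⁻¹' t, g (l, e)
          ∂(volume : Measure ℝ).prod (volume : Measure M) =
        nextEvent D L (z, l) ((some : ℝ × M → Option (ℝ × M)) ⁻¹' t) := by
      intro l
      have h4 := lintegral_nextEvent (L := L) hD (z, l) (measurable_ind ht')
      rw [lintegral_ind ht'] at h4
      refine Eq.trans ?_ h4.symm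
      rw [setLIntegral_eq_ind ht']
      refine lintegral_congr fun e => ?_
      simp only [hg, mem_preimage]
      ring
    simp only [h3]
    have hne : Measurable fun l : List (ℝ × M) =>
        nextEvent D L (z, l) ((some : ℝ × M → Option (ℝ × M)) ⁻¹' t) := by
      simp only [← h3]
      exact hgm.lintegral_prod_right'
    rw [hρ, Measure.restrict_map hfe hs, lintegral_map hne hfe,
      Measure.restrict_restrict (hfe hs)]
    congr 2
    ext N
    simp [and_comm]
  have hl : ∫⁻ N, ind ((firstEvents N n).length = n ∧ N n ≠ none) *
      H (firstEvents N n, N n) ∂K z = ∫⁻ p, H p ∂μ := by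
    rw [lintegral_ind_mul hS, hμ, lintegral_map hH hpair]
  have hHs : Measurable fun p : List (ℝ × M) × (ℝ × M) => H (p.1, some p.2) := hH.comp hsm
  rw [hl, key, hν, lintegral_map hH hsm, lintegral_withDensity_eq_lintegral_mul _ hgm hHs,
    lintegral_prod _ (hgm.mul hHs).aemeasurable, hρ,
    lintegral_map (hgm.mul hHs).lintegral_prod_right' hfe, ← lintegral_ind_mul (measurableSet_length n)]
  refine lintegral_congr fun N => ?_
  congr 1
  refine lintegral_congr fun e => ?_
  simp only [Pi.mul_apply, hg, mul_assoc]

theorem measurableSet_forall_pos : MeasurableSet {l : List (ℝ × M) | ∀ x ∈ l, 0 < x.1} :=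
  measurableSet_forall_mem measurable_id (measurableSet_lt measurable_const measurable_snd.fst)

/-- Law of the first `n` events. -/
theorem IsEventLaw.lintegral_firstEvents [IsMarkovKernel K] (hK : IsEventLaw D L K)
    (hD : D.IsMeasurable) (z : E) (n : ℕ) {F : List (ℝ × M) → ℝ≥0∞} (hF : Measurable F) :
    ∫⁻ N, ind ((firstEvents N n).length = n) * F (firstEvents N n) ∂K z =
      ∫⁻ l, ind (∀ x ∈ l, 0 < x.1) * (eventDensity D L z l * F l) ∂orderedMeasure M n := by
  have hR : ∀ {F : List (ℝ × M) → ℝ≥0∞}, Measurable F → Measurable fun l : List (ℝ × M) =>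
      ind (∀ x ∈ l, 0 < x.1) * (eventDensity D L z l * F l) := fun hF =>
    (measurable_ind measurableSet_forall_pos).mul
      ((Measurable.eventDensity hD L measurable_const measurable_id).mul hF)
  induction n generalizing F with
  | zero =>
    rw [lintegral_orderedMeasure_zero (hR hF)]
    simp [firstEvents, ind, eventDensity, eventDensityAux]
  | succ n ih =>
    have hm : Measurable fun p : List (ℝ × M) × (ℝ × M) => ind (lastTime p.1 < p.2.1) *
        (nextDensity D L (z, p.1) p.2 * F (p.1 ++ [p.2])) :=
      (measurable_ind (measurableSet_lt (measurable_lastTime.comp measurable_fst)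
        measurable_snd.fst)).mul (((measurable_nextDensity hD L).comp
          ((measurable_const.prodMk measurable_fst).prodMk measurable_snd)).mul
            (hF.comp (measurable_fst.listAppend (measurable_snd.listCons measurable_const))))
    have h1 := hK.lintegral_next hD z n (H := fun p => F (p.1 ++ p.2.toList))
      (hF.comp (measurable_fst.listAppend (measurable_toList.comp measurable_snd)))
    simp only [← firstEvents_succ, Option.toList_some, Option.ne_none_iff_exists'] at h1
    simp only [length_firstEvents_succ_iff]
    rw [h1, ih hm.lintegral_prod_right', lintegral_orderedMeasure_snoc n (hR hF)]
    refine lintegral_congr_ae ?_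
    filter_upwards [ae_increasing_orderedMeasure n] with l hl
    have hml : Measurable fun e : ℝ × M =>
        ind (lastTime l < e.1) * (nextDensity D L (z, l) e * F (l ++ [e])) :=
      hm.comp measurable_prodMk_left
    rw [← lintegral_const_mul _ hml, ← lintegral_const_mul' _ _ (ind_ne_top _)]
    refine lintegral_congr fun e => ?_
    simp only [eventDensity_append_singleton, List.mem_append, List.mem_singleton]
    by_cases h0 : ∀ x ∈ l, 0 < x.1
    · by_cases he : 0 < e.1
      · rw [ind_pos h0, ind_pos (p := ∀ x, x ∈ l ∨ x = e → 0 < x.1)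
          (fun x hx => hx.elim (h0 x) fun h => h ▸ he), one_mul, one_mul]
        -- The ordered measure asks that the new event be later than all earlier ones, the law of
        -- the process that it be later than the last one.
        rw [show ind (∀ x ∈ l, x.1 < e.1) = ind (lastTime l < e.1) by rw [lastTime_lt_iff hl he]]
        ring
      · rw [ind_neg (p := lastTime l < e.1) fun h => he ((lastTime_nonneg h0).trans_lt h),
          ind_neg (p := ∀ x, x ∈ l ∨ x = e → 0 < x.1) fun h => he (h e (Or.inr rfl))]
        simp
    · rw [ind_neg h0, ind_neg (p := ∀ x, x ∈ l ∨ x = e → 0 < x.1)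
        fun h => h0 fun x hx => h x (Or.inl hx)]
      simp

theorem measurableSet_exists_le (a : ℝ) :
    MeasurableSet {o : Option (ℝ × M) | ∃ e, o = some e ∧ e.1 ≤ a} := by
  refine measurableSet_option_iff.2 ?_
  convert (measurableSet_le measurable_fst measurable_const :
    MeasurableSet {e : ℝ × M | e.1 ≤ a}) using 1
  ext e
  simp only [mem_preimage, mem_ofPred_eq, Option.some.injEq]
  exact ⟨fun ⟨e', h1, h2⟩ => h1 ▸ h2, fun h => ⟨e, rfl, h⟩⟩

theorem measurableSet_forall_lt (a : ℝ) :
    MeasurableSet {o : Option (ℝ × M) | ∀ e ∈ o, a < e.1} := by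
  convert (measurableSet_exists_le (M := M) a).compl using 1
  ext o
  simp [Option.mem_def]

/-- Law of the events up to time `a`, when there are `n` of them. -/
theorem IsEventLaw.lintegral_firstEvents_next [IsMarkovKernel K] (hK : IsEventLaw D L K)
    (hD : D.IsMeasurable) (h1 : ∀ x, ∫⁻ v, D.markDensity x v = 1) (z : E) (n : ℕ) (a : ℝ)
    {F : List (ℝ × M) → ℝ≥0∞} (hF : Measurable F) (hFa : ∀ l, ¬ lastTime l ≤ a → F l = 0) :
    ∫⁻ N, ind ((firstEvents N n).length = n ∧ ∀ e ∈ N n, a < e.1) * F (firstEvents N n) ∂K z =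
      ∫⁻ l, ind (∀ x ∈ l, 0 < x.1) * (pathDensity D L a z l * F l) ∂orderedMeasure M n := by
  have hfe := measurable_firstEvents (M := M) n
  have hla : MeasurableSet {l : List (ℝ × M) | lastTime l ≤ a} :=
    measurableSet_le measurable_lastTime measurable_const
  have hle := measurableSet_exists_le (M := M) a
  have hSB : MeasurableSet {N : ℕ → Option (ℝ × M) |
      (firstEvents N n).length = n ∧ ∀ e ∈ N n, a < e.1} :=
    (measurableSet_length n).inter (measurableSet_preimage
      (f := fun N : ℕ → Option (ℝ × M) => N n) (measurable_pi_apply n)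
      (measurableSet_forall_lt a))
  have hpd : Measurable fun l : List (ℝ × M) => pathDensity D L a z l :=
    Measurable.pathDensity hD L measurable_const measurable_const measurable_id
  have hsurv : Measurable fun l : List (ℝ × M) => L.survival (z, l) (a - lastTime l) :=
    (measurable_const.prodMk measurable_id).survival L (measurable_const.sub measurable_lastTime)
  have hone : ∀ l : List (ℝ × M), lastTime l ≤ a → (∫⁻ e, ind (lastTime l < e.1) *
      (nextDensity D L (z, l) e * ind (e.1 ≤ a)) ∂(volume : Measure ℝ).prod (volume : Measure M)) +
      L.survival (z, l) (a - lastTime l) = 1 := by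
    intro l hl
    rw [← nextEvent_le_add_survival (D := D) (L := L) hD h1 (z, l) hl]
    congr 1
    have hs : MeasurableSet {e : ℝ × M | e.1 ≤ a} := measurableSet_le measurable_fst measurable_const
    rw [← lintegral_nextEvent (L := L) hD (z, l) (measurable_ind hs)]
    exact lintegral_ind hs
  -- The event "no further event up to `a`" includes the case `none`, which `lintegral_next` does
  -- not see. Hence its probability is computed as a complement: all runs with at least `n` events,
  -- minus those whose next event occurs by time `a`.
  have key : ∀ A : Set (List (ℝ × M)), MeasurableSet A →
      ∫⁻ N, ind ((firstEvents N n).length = n ∧ ∀ e ∈ N n, a < e.1) *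
        ind (firstEvents N n ∈ A ∧ lastTime (firstEvents N n) ≤ a) ∂K z =
      ∫⁻ l, ind (∀ x ∈ l, 0 < x.1) * (pathDensity D L a z l * ind (l ∈ A ∧ lastTime l ≤ a))
        ∂orderedMeasure M n := by
    intro A hA
    have hFA : Measurable fun l : List (ℝ × M) => ind (l ∈ A ∧ lastTime l ≤ a) :=
      measurable_ind (hA.inter hla)
    have e1 := hK.lintegral_firstEvents hD z n hFA
    have e2 := hK.lintegral_firstEvents hD z n (hFA.mul hsurv)
    have e3 := hK.lintegral_next hD z n
      (H := fun p => ind (p.1 ∈ A ∧ lastTime p.1 ≤ a) * ind (∃ e, p.2 = some e ∧ e.1 ≤ a))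
      ((hFA.comp measurable_fst).mul (measurable_ind (measurable_snd hle)))
    have e4 : ∀ l : List (ℝ × M), ∫⁻ e, ind (lastTime l < e.1) * (nextDensity D L (z, l) e *
        (ind (l ∈ A ∧ lastTime l ≤ a) * ind (∃ e', some e = some e' ∧ e'.1 ≤ a)))
        ∂(volume : Measure ℝ).prod (volume : Measure M) = ind (l ∈ A ∧ lastTime l ≤ a) *
        ∫⁻ e, ind (lastTime l < e.1) * (nextDensity D L (z, l) e * ind (e.1 ≤ a))
          ∂(volume : Measure ℝ).prod (volume : Measure M) := by
      intro l
      rw [← lintegral_const_mul' _ _ (ind_ne_top _)]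
      refine lintegral_congr fun e => ?_
      have : (∃ e', some e = some e' ∧ e'.1 ≤ a) ↔ e.1 ≤ a := by simp
      rw [this]
      ring
    simp only [e4] at e3
    -- The term to be subtracted must be finite in order to be cancelled.
    have hX : ∫⁻ N, ind ((firstEvents N n).length = n ∧ N n ≠ none) *
        (ind (firstEvents N n ∈ A ∧ lastTime (firstEvents N n) ≤ a) *
          ind (∃ e, N n = some e ∧ e.1 ≤ a)) ∂K z ≠ ∞ := by
      refine ne_top_of_le_ne_top ENNReal.one_ne_top
        ((lintegral_mono fun N => ?_).trans_eq (lintegral_one.trans measure_univ))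
      exact mul_le_one' (ind_le_one _) (mul_le_one' (ind_le_one _) (ind_le_one _))
    simp only [pathDensity_eq, mul_assoc]
    simp only [Pi.mul_apply, mul_comm (L.survival _ _)] at e2 ⊢
    rw [← e2, ← ENNReal.add_left_inj hX]
    conv_rhs => rw [e3]
    rw [← lintegral_add_left, ← lintegral_add_left]
    · refine (lintegral_congr fun N => ?_ : _ = ∫⁻ N, ind ((firstEvents N n).length = n) *
        ind (firstEvents N n ∈ A ∧ lastTime (firstEvents N n) ≤ a) ∂K z).trans
        (lintegral_congr fun N => ?_)
      · by_cases hS : (firstEvents N n).length = n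
        · cases hN : N n with
          | none => simp [ind, hS]
          | some e =>
            by_cases he : e.1 ≤ a
            · simp [ind, hS, he, not_lt.2 he]
            · simp [ind, hS, he, not_le.1 he]
        · simp [ind, hS]
      · rw [← mul_add, ← mul_add]
        by_cases hl : firstEvents N n ∈ A ∧ lastTime (firstEvents N n) ≤ a
        · rw [add_comm (L.survival _ _), hone _ hl.2, mul_one]
        · rw [ind_neg hl, zero_mul]
    · exact (measurable_ind (measurableSet_length n)).mul ((hFA.mul hsurv).comp hfe)
    · exact (measurable_ind hSB).mul (hFA.comp hfe)
  -- The identity for sets passes to functions as an equality of measures, restricted to lists that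
  -- end by time `a`; the functions considered vanish elsewhere.
  have hmeas : (((K z).restrict {N | (firstEvents N n).length = n ∧ ∀ e ∈ N n, a < e.1}).map
      fun N => firstEvents N n).restrict {l | lastTime l ≤ a} =
      (((orderedMeasure M n).restrict {l | ∀ x ∈ l, 0 < x.1}).withDensity
        fun l => pathDensity D L a z l).restrict {l | lastTime l ≤ a} := by
    ext A hA
    have hAl := hA.inter hla
    rw [Measure.restrict_apply hA, Measure.restrict_apply hA, Measure.map_apply hfe hAl,
      withDensity_apply _ hAl, setLIntegral_eq_ind hAl,
      ← lintegral_ind_mul measurableSet_forall_pos,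
      Measure.restrict_apply (hfe hAl)]
    simp only [mul_comm (ind (_ ∈ A ∩ _))]
    refine Eq.trans ?_ (key A hA)
    rw [ ← lintegral_indicator_one ((hfe hAl).inter hSB)]
    refine lintegral_congr fun N => ?_
    rw [← ind_and]
    by_cases h : ((firstEvents N n).length = n ∧ ∀ e ∈ N n, a < e.1) ∧
      firstEvents N n ∈ A ∧ lastTime (firstEvents N n) ≤ a
    · rw [ind_pos h, indicator_of_mem (by exact ⟨h.2, h.1⟩)]
      rfl
    · rw [ind_neg h, indicator_of_notMem fun h' => h ⟨h'.2, h'.1⟩]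
  have hF' : ∀ l, F l = ind (lastTime l ≤ a) * F l := fun l => by
    by_cases hl : lastTime l ≤ a
    · rw [ind_pos hl, one_mul]
    · rw [hFa l hl, mul_zero]
  have h2 : ∫⁻ l, F l ∂_ = ∫⁻ l, F l ∂_ := congrArg (fun μ => ∫⁻ l, F l ∂μ) hmeas
  rw [← lintegral_ind_mul hla, ← lintegral_ind_mul hla] at h2
  simp only [← hF'] at h2
  rw [lintegral_map hF hfe, lintegral_withDensity_eq_lintegral_mul _ hpd hF,
    ← lintegral_ind_mul hSB, ← lintegral_ind_mul measurableSet_forall_pos] at h2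
  exact h2

end Law

end NutsPDMP

namespace NutsPDMP

/-! ### Predicates on lists of events -/

section Predicates

set_option linter.unusedSectionVars false
variable {M β : Type*} [MeasurableSpace M] [MeasurableSpace β]

/-- All events happen before time `t`. -/
def Before (t : ℝ) (l : List (ℝ × M)) : Prop := ∀ x ∈ l, x.1 < t

/-- All events happen after time `t`. -/
def After (t : ℝ) (l : List (ℝ × M)) : Prop := ∀ x ∈ l, t < x.1

attribute [fun_prop] Measurable.listCons Measurable.listAppend Measurable.listTail
  Measurable.listDropLast Measurable.survival Measurable.pathDensity Measurable.eventDensity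

@[fun_prop]
theorem _root_.Measurable.ind {p : β → Prop} (hp : Measurable p) :
    Measurable fun b => ind (p b) :=
  measurable_ind (measurableSet_setOfPred.2 hp)

@[fun_prop]
theorem _root_.Measurable.before {t : β → ℝ} {l : β → List (ℝ × M)} (ht : Measurable t)
    (hl : Measurable l) : Measurable fun b => Before (t b) (l b) :=
  measurableSet_setOfPred.1 (measurableSet_forall_mem hl
    (measurableSet_lt measurable_snd.fst (ht.comp measurable_fst)))

@[fun_prop]
theorem _root_.Measurable.after {t : β → ℝ} {l : β → List (ℝ × M)} (ht : Measurable t)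
    (hl : Measurable l) : Measurable fun b => After (t b) (l b) :=
  measurableSet_setOfPred.1 (measurableSet_forall_mem hl
    (measurableSet_lt (ht.comp measurable_fst) measurable_snd.fst))

@[fun_prop]
theorem _root_.Measurable.realLT {f g : β → ℝ} (hf : Measurable f) (hg : Measurable g) :
    Measurable fun b => f b < g b :=
  measurableSet_setOfPred.1 (measurableSet_lt hf hg)

@[fun_prop]
theorem _root_.Measurable.listEqNil {l : β → List (ℝ × M)} (hl : Measurable l) :
    Measurable fun b => l b = [] :=
  measurableSet_setOfPred.1 (hl measurableSet_eq_nil)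

@[fun_prop]
theorem _root_.Measurable.propAnd {p q : β → Prop} (hp : Measurable p) (hq : Measurable q) :
    Measurable fun b => p b ∧ q b := hp.and hq

@[fun_prop]
theorem _root_.Measurable.propNot {p : β → Prop} (hp : Measurable p) :
    Measurable fun b => ¬ p b := hp.not

@[fun_prop]
theorem _root_.Measurable.lastTime {l : β → List (ℝ × M)} (hl : Measurable l) :
    Measurable fun b => lastTime (l b) := measurable_lastTime.comp hl

@[fun_prop]
theorem _root_.Measurable.shift {c : β → ℝ} {l : β → List (ℝ × M)} (hc : Measurable c)
    (hl : Measurable l) : Measurable fun b => shift (c b) (l b) :=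
  measurable_shift.comp (hc.prodMk hl)

theorem after_shift {t c : ℝ} {l : List (ℝ × M)} : After t (shift c l) ↔ After (t - c) l := by
  simp only [After, NutsPDMP.shift, List.forall_mem_map, sub_lt_iff_lt_add]

theorem before_shift {t c : ℝ} {l : List (ℝ × M)} : Before t (shift c l) ↔ Before (t - c) l := by
  simp only [Before, NutsPDMP.shift, List.forall_mem_map, lt_sub_iff_add_lt]

theorem after_cons {t : ℝ} {e : ℝ × M} {l : List (ℝ × M)} :
    After t (e :: l) ↔ t < e.1 ∧ After t l := by
  simp [After]

theorem before_cons {t : ℝ} {e : ℝ × M} {l : List (ℝ × M)} :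
    Before t (e :: l) ↔ e.1 < t ∧ Before t l := by
  simp [Before]

theorem After.mono {s t : ℝ} {l : List (ℝ × M)} (h : After t l) (hst : s ≤ t) : After s l :=
  fun x hx => hst.trans_lt (h x hx)

end Predicates

/-! ### The volume change of the reversal -/

namespace ReversiblePDMP

variable {E V Vr β : Type*} [MeasureSpace E] [MeasureSpace V] [MeasureSpace Vr]
  [MeasurableSpace β] {G : ReversiblePDMP E V Vr}

@[fun_prop]
theorem _root_.Measurable.reversal {t : β → ℝ} {w : β → Path E V} (ht : Measurable t)
    (hw : Measurable w) : Measurable fun b => G.R (t b) (w b) :=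
  G.measurable_R.comp (ht.prodMk hw)

@[fun_prop]
theorem _root_.Measurable.reversalInv {t : β → ℝ} {w : β → Path E Vr} (ht : Measurable t)
    (hw : Measurable w) : Measurable fun b => G.Rinv (t b) (w b) :=
  G.measurable_Rinv.comp (ht.prodMk hw)

@[fun_prop]
theorem _root_.Measurable.reversibleFlow {t : β → ℝ} {x : β → E} (ht : Measurable t)
    (hx : Measurable x) : Measurable fun b => G.flow (t b) (x b) :=
  G.measurable_flow.comp (ht.prodMk hx)

/-- A jointly measurable version of the volume change: its limit from the right in `T`. -/
noncomputable def volumeChange (ψ : ℝ → Path E Vr → ℝ) (T : ℝ) (w : Path E Vr) : ℝ≥0∞ :=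
  Filter.limsup (fun n : ℕ => ENNReal.ofReal (ψ (((⌊T * (n + 1)⌋ : ℤ) + 1) / (n + 1)) w))
    Filter.atTop

variable {ψ : ℝ → Path E Vr → ℝ}

/-- At each stage of the limit the horizon is rounded to a grid and takes countably many values, so
measurability of `ψ T` for fixed `T` suffices. -/
theorem measurable_volumeChange (hψ : G.IsVolumeChange ψ) :
    Measurable fun p : ℝ × Path E Vr => volumeChange ψ p.1 p.2 := by
  refine Measurable.limsup fun n => ENNReal.measurable_ofReal.comp ?_
  have h1 : Measurable fun p : ℤ × Path E Vr => ψ (((p.1 : ℝ) + 1) / (n + 1)) p.2 :=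
    measurable_from_prod_countable_right (f := fun p : ℤ × Path E Vr =>
      ψ (((p.1 : ℝ) + 1) / (n + 1)) p.2) fun k => hψ.measurable (((k : ℝ) + 1) / (n + 1))
  have h2 : Measurable fun p : ℝ × Path E Vr => (⌊p.1 * (n + 1)⌋, p.2) :=
    (Int.measurable_floor.comp (measurable_fst.mul_const _)).prodMk measurable_snd
  exact h1.comp h2

attribute [local irreducible] volumeChange in
theorem _root_.Measurable.volumeChange (hψ : G.IsVolumeChange ψ) {t : β → ℝ}
    {w : β → Path E Vr} (ht : Measurable t) (hw : Measurable w) :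
    Measurable fun b => volumeChange ψ (t b) (w b) :=
  (measurable_volumeChange hψ).comp (ht.prodMk hw)

/-- The grid points approximate `T` from the right, hence stay in the half-line on which `ψ` is
continuous. Equality `lastTime w.2 = T` is allowed, as the boundary case requires. -/
theorem volumeChange_eq [TopologicalSpace E] [TopologicalSpace Vr] (hcont : G.ContinuousReversal ψ)
    {T : ℝ} {w : Path E Vr} (hw : Increasing w.2) (h0 : After 0 w.2) (hT : lastTime w.2 ≤ T) :
    volumeChange ψ T w = ENNReal.ofReal (ψ T w) := by
  have hc := (hcont.continuousOn_volumeChange w hw h0) T hT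
  refine Filter.Tendsto.limsup_eq ?_
  refine (ENNReal.continuous_ofReal.tendsto _).comp (hc.tendsto.comp ?_)
  have hle : ∀ n : ℕ, T ≤ ((⌊T * (n + 1)⌋ : ℤ) + 1) / (n + 1 : ℝ) := fun n => by
    rw [le_div_iff₀ (by positivity)]
    exact (Int.lt_floor_add_one _).le
  refine tendsto_nhdsWithin_iff.2 ⟨?_, Filter.Eventually.of_forall fun n => hT.trans (hle n)⟩
  have hge : ∀ n : ℕ, ((⌊T * (n + 1)⌋ : ℤ) + 1) / (n + 1 : ℝ) ≤ T + 1 / (n + 1 : ℝ) := fun n => by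
    rw [div_le_iff₀ (by positivity), add_mul, div_mul_cancel₀ _ (by positivity)]
    linarith [Int.floor_le (T * ((n : ℝ) + 1))]
  refine tendsto_of_tendsto_of_tendsto_of_le_of_le tendsto_const_nhds ?_ hle hge
  simpa using tendsto_one_div_add_atTop_nhds_zero_nat.const_add T

variable [SigmaFinite (volume : Measure E)] [SigmaFinite (volume : Measure V)]
  [SigmaFinite (volume : Measure Vr)] [TopologicalSpace E] [TopologicalSpace Vr]

/-- The measure on paths without horizon. -/
noncomputable abbrev allPaths (E M : Type*) [MeasureSpace E] [MeasureSpace M] :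
    Measure (Path E M) := (volume : Measure E).prod (orderedListMeasure M)

omit [TopologicalSpace E] [TopologicalSpace Vr] [SigmaFinite (volume : Measure Vr)]
  [SigmaFinite (volume : Measure E)] in
theorem lintegral_pathMeasure (T : ℝ) {F : Path E V → ℝ≥0∞} (hF : Measurable F) :
    ∫⁻ w, F w ∂pathMeasure E V T =
      ∫⁻ w, ind (After 0 w.2 ∧ Before T w.2) * F w ∂allPaths E V := by
  unfold pathMeasure allPaths
  rw [eventMeasure_eq, lintegral_prod _ hF.aemeasurable,
    lintegral_prod _ (by fun_prop)]
  refine lintegral_congr fun z => ?_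
  rw [setLIntegral_eq_ind (measurableSet_forall_Ioo T)]
  refine lintegral_congr fun l => ?_
  congr 2
  simp only [mem_ofPred_eq, mem_Ioo, After, Before, forall_and]

omit [SigmaFinite (volume : Measure E)] [TopologicalSpace E] [TopologicalSpace Vr] in
theorem ae_increasing_allPaths : ∀ᵐ w ∂allPaths E Vr, Increasing w.2 :=
  Measure.quasiMeasurePreserving_snd.ae ae_increasing_orderedListMeasure

/-- This is the assumption on the image measure under $R_T$, transferred to the measure without
horizon. The measurable version may replace `ψ` because almost every list of events is increasing.
-/
theorem lintegral_reversal (hψ : G.IsVolumeChange ψ) (hcont : G.ContinuousReversal ψ) {T : ℝ}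
    (hT : 0 < T) {F : Path E Vr → ℝ≥0∞} (hF : Measurable F) :
    ∫⁻ w, ind (After 0 w.2 ∧ Before T w.2) * F (G.R T w) ∂allPaths E V =
      ∫⁻ w, ind (After 0 w.2 ∧ Before T w.2) * (volumeChange ψ T w * F w) ∂allPaths E Vr := by
  have hR : Measurable (G.R T) := G.measurable_R.comp measurable_prodMk_left
  have hψT : Measurable fun w => ENNReal.ofReal (ψ T w) :=
    ENNReal.measurable_ofReal.comp (hψ.measurable T)
  have h : ∫⁻ w, F w ∂((pathMeasure E V T).map (G.R T)) =
      ∫⁻ w, F w ∂((pathMeasure E Vr T).withDensity fun w => ENNReal.ofReal (ψ T w)) := by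
    rw [hψ.map_R T hT]
  have hFR : Measurable fun w => F (G.R T w) := hF.comp hR
  rw [lintegral_map hF hR, lintegral_withDensity_eq_lintegral_mul _ hψT hF,
    lintegral_pathMeasure T hFR, lintegral_pathMeasure T (hψT.mul hF)] at h
  rw [h]
  refine lintegral_congr_ae ?_
  filter_upwards [ae_increasing_allPaths] with w hw
  refine ind_mul_congr Iff.rfl fun hw' => ?_
  rw [volumeChange_eq hcont hw hw'.1 ((lastTime_lt_iff hw hT).2 hw'.2).le]
  rfl

omit [TopologicalSpace E] [TopologicalSpace Vr] [SigmaFinite (volume : Measure Vr)]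
  [SigmaFinite (volume : Measure E)] in
theorem lintegral_allPaths_nil {F : E → ℝ≥0∞} (hF : Measurable F) :
    ∫⁻ w, ind (w.2 = []) * F w.1 ∂allPaths E V = ∫⁻ x, F x := by
  unfold allPaths
  rw [lintegral_prod _ (by fun_prop)]
  refine lintegral_congr fun x => ?_
  rw [lintegral_orderedListMeasure_cons (by fun_prop)]
  simp [ind]

/-- Volume change of the flow. -/
theorem lintegral_flow (hψ : G.IsVolumeChange ψ) (hcont : G.ContinuousReversal ψ) {T : ℝ}
    (hT : 0 < T) {F : E → ℝ≥0∞} (hF : Measurable F) :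
    ∫⁻ x, F (G.flow T x) = ∫⁻ x, volumeChange ψ T (x, []) * F x := by
  -- On paths without events the reversal is just the flow.
  have h := lintegral_reversal hψ hcont hT (F := fun w => ind (w.2 = []) * F w.1) (by fun_prop)
  have h1 := lintegral_allPaths_nil (V := V) (F := fun x => F (G.flow T x)) (by fun_prop)
  have hv2 : Measurable fun x : E => volumeChange ψ T (x, []) :=
    .volumeChange hψ (by fun_prop) (by fun_prop)
  have h2 := lintegral_allPaths_nil (V := Vr) (F := fun x => volumeChange ψ T (x, []) * F x)
    (hv2.mul hF)
  rw [← h1, ← h2]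
  refine Eq.trans (lintegral_congr fun w => ?_) (h.trans (lintegral_congr fun w => ?_))
  · obtain ⟨x, l⟩ := w
    have hnil : (G.R T (x, l)).2 = [] ↔ l = [] := Dynamics.reverse_eq_nil
    simp only [hnil]
    by_cases hl : l = []
    · subst hl
      simp [ind, After, Before, R, Dynamics.reverse, Dynamics.reverseAux, fwd]
    · simp [ind, hl]
  · obtain ⟨x, l⟩ := w
    by_cases hl : l = []
    · subst hl
      simp [ind, After, Before]
    · simp [ind, hl]

omit [SigmaFinite (volume : Measure E)] [SigmaFinite (volume : Measure V)]
  [SigmaFinite (volume : Measure Vr)] in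
theorem volumeChange_pos (hψ : G.IsVolumeChange ψ) (hcont : G.ContinuousReversal ψ)
    {T : ℝ} {w : Path E Vr} (hw : Increasing w.2) (h0 : After 0 w.2) (hT : lastTime w.2 ≤ T) :
    volumeChange ψ T w ≠ 0 ∧ volumeChange ψ T w ≠ ∞ := by
  rw [volumeChange_eq hcont hw h0 hT]
  exact ⟨(ENNReal.ofReal_pos.2 (hψ.pos T w)).ne', ENNReal.ofReal_ne_top⟩

omit [SigmaFinite (volume : Measure E)] [SigmaFinite (volume : Measure V)]
  [SigmaFinite (volume : Measure Vr)] in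
theorem tendsto_volumeChange (hcont : G.ContinuousReversal ψ)
    {w : Path E Vr} (hw : Increasing w.2) (h0 : After 0 w.2) {T : ℝ} (hT : lastTime w.2 ≤ T) :
    Filter.Tendsto (fun s => volumeChange ψ (T + s) w) (nhdsWithin 0 (Ioi 0))
      (nhds (volumeChange ψ T w)) := by
  have hc := (hcont.continuousOn_volumeChange w hw h0) T hT
  have h1 : Filter.Tendsto (fun s : ℝ => T + s) (nhdsWithin 0 (Ioi 0))
      (nhdsWithin T (Ici (lastTime w.2))) := by
    refine tendsto_nhdsWithin_iff.2 ⟨?_, ?_⟩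
    · have : Filter.Tendsto (fun s : ℝ => T + s) (nhds 0) (nhds (T + 0)) :=
        (continuous_const.add continuous_id).tendsto 0
      rw [add_zero] at this
      exact this.mono_left nhdsWithin_le_nhds
    · filter_upwards [self_mem_nhdsWithin] with s hs
      exact hT.trans (le_add_of_nonneg_right (le_of_lt hs))
  rw [volumeChange_eq hcont hw h0 hT]
  refine ((ENNReal.continuous_ofReal.tendsto _).comp (hc.tendsto.comp h1)).congr' ?_
  filter_upwards [self_mem_nhdsWithin] with s hs
  exact (volumeChange_eq hcont hw h0 (hT.trans (le_add_of_nonneg_right (le_of_lt hs)))).symm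

/-- The volume change of the flow at time zero is one. -/
theorem volumeChange_zero (hψ : G.IsVolumeChange ψ) (hcont : G.ContinuousReversal ψ) :
    ∀ᵐ x ∂(volume : Measure E), volumeChange ψ 0 (x, []) = 1 := by
  have hv2 : ∀ T, Measurable fun x : E => volumeChange ψ T (x, []) := fun T =>
    .volumeChange hψ (by fun_prop) (by fun_prop)
  have hinv : ∀ s x, G.flow (-s) (G.flow s x) = x := fun s x => by
    rw [← G.flow_add, neg_add_cancel, G.flow_zero]
  -- The volume change is assumed for positive horizons only, so its value at 0 is reached as a
  -- limit. The tool is the cocycle identity $J_{1+t}=J_1\cdot J_t\circ\Phi_{-1}$, which follows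
  -- from $\Phi_{1+t}=\Phi_1\circ\Phi_t$ and uniqueness of densities.
  have hcoc : ∀ t, 0 < t → ∀ᵐ x ∂(volume : Measure E), volumeChange ψ (1 + t) (x, []) =
      volumeChange ψ 1 (x, []) * volumeChange ψ t (G.flow (-1) x, []) := by
    intro t ht
    have hm : Measurable fun x : E => volumeChange ψ 1 (x, []) *
        volumeChange ψ t (G.flow (-1) x, []) :=
      (hv2 1).mul (.volumeChange hψ (by fun_prop) (by fun_prop))
    refine (withDensity_eq_iff_of_sigmaFinite (hv2 _).aemeasurable hm.aemeasurable).1 ?_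
    ext A hA
    rw [withDensity_apply _ hA, withDensity_apply _ hA, setLIntegral_eq_ind hA,
      setLIntegral_eq_ind hA]
    have hi : Measurable fun x : E => ind (x ∈ A) := measurable_ind hA
    simp only [mul_comm (ind _)]
    rw [← lintegral_flow hψ hcont (by linarith : 0 < 1 + t) hi]
    have h1 := lintegral_flow hψ hcont one_pos
      (F := fun x => volumeChange ψ t (G.flow (-1) x, []) * ind (x ∈ A))
      ((Measurable.volumeChange hψ (by fun_prop) (by fun_prop)).mul hi)
    simp only [mul_assoc]
    rw [← h1]
    simp only [hinv]
    have h2 := lintegral_flow hψ hcont ht (F := fun x => ind (G.flow 1 x ∈ A))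
      (measurable_ind ((by fun_prop : Measurable fun x => G.flow 1 x) hA))
    rw [← h2]
    simp only [G.flow_add]
  -- Along $t=1/(n+1)$ a single null set suffices. In the limit the factor $J_1$, positive and
  -- finite, cancels.
  have h1 : ∀ᵐ x ∂(volume : Measure E), volumeChange ψ 0 (G.flow (-1) x, []) = 1 := by
    have h2 : ∀ᵐ x ∂(volume : Measure E), ∀ n : ℕ, volumeChange ψ (1 + 1 / (n + 1)) (x, []) =
        volumeChange ψ 1 (x, []) * volumeChange ψ (1 / (n + 1)) (G.flow (-1) x, []) :=
      ae_all_iff.2 fun n => hcoc _ (by positivity)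
    filter_upwards [h2] with x hx
    have hlim : Filter.Tendsto (fun n : ℕ => (1 : ℝ) / (n + 1)) Filter.atTop
        (nhdsWithin 0 (Ioi 0)) := tendsto_nhdsWithin_iff.2
      ⟨tendsto_one_div_add_atTop_nhds_zero_nat, Filter.Eventually.of_forall fun n => by
        simp only [mem_Ioi]; positivity⟩
    have hnil : ∀ x : E, Increasing ((x, []) : Path E Vr).2 ∧ After 0 ((x, []) : Path E Vr).2 :=
      fun x => ⟨List.Pairwise.nil, by simp [After]⟩
    have l1 := (tendsto_volumeChange hcont (hnil x).1 (hnil x).2 (T := 1) zero_le_one).comp hlim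
    have l2 := (tendsto_volumeChange hcont (hnil (G.flow (-1) x)).1 (hnil _).2 (T := 0)
      le_rfl).comp hlim
    obtain ⟨p1, p2⟩ := volumeChange_pos hψ hcont (hnil x).1 (hnil x).2 (T := 1) zero_le_one
    have l3 := ENNReal.Tendsto.const_mul l2 (Or.inr p2)
    have l4 := tendsto_nhds_unique (l1.congr fun n => hx n) (l3.congr fun n => by
      simp only [Function.comp, zero_add])
    have l5 : volumeChange ψ 1 (x, []) * volumeChange ψ 0 (G.flow (-1) x, []) =
        volumeChange ψ 1 (x, []) * 1 := by rw [← l4, mul_one]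
    exact (ENNReal.mul_right_inj p1 p2).1 l5
  have hs : MeasurableSet {x : E | ¬ volumeChange ψ 0 (x, []) = 1} :=
    ((hv2 0) (measurableSet_singleton 1)).compl
  rw [ae_iff, ← lintegral_ind hs]
  -- The exceptional set is known to be null only after composition with $\Phi_{-1}$; the change of
  -- variables by $\Phi_1$ removes this composition.
  have h3 := lintegral_flow hψ hcont one_pos
    (F := fun x => ind (¬ volumeChange ψ 0 (G.flow (-1) x, []) = 1))
    (measurable_ind ((by fun_prop : Measurable fun x => G.flow (-1) x) hs))
  simp only [hinv] at h3
  rw [h3]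
  refine (lintegral_congr_ae ?_).trans lintegral_zero
  filter_upwards [h1] with x hx
  rw [ind_neg (not_not.2 hx), mul_zero]

end ReversiblePDMP

end NutsPDMP

namespace NutsPDMP

/-! ### The boundary of the reversal -/

section

variable {M : Type*} [MeasureSpace M] [SigmaFinite (volume : Measure M)]

/-- The measure on a mark followed by a list of events. -/
noncomputable abbrev markList (M : Type*) [MeasureSpace M] : Measure (M × List (ℝ × M)) :=
  (volume : Measure M).prod (orderedListMeasure M)

theorem lintegral_orderedListMeasure_cons_shift {F : List (ℝ × M) → ℝ≥0∞} (hF : Measurable F) :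
    ∫⁻ l, F l ∂orderedListMeasure M =
      F [] + ∫⁻ s : ℝ, ∫⁻ m, ind (After 0 m.2) * F ((s, m.1) :: shift s m.2) ∂markList M := by
  rw [lintegral_orderedListMeasure_cons hF]
  congr 1
  have h1 : Measurable fun p : (ℝ × M) × List (ℝ × M) =>
      ind (After p.1.1 p.2) * F (p.1 :: p.2) := by fun_prop
  have h2 : Measurable fun e : ℝ × M =>
      ∫⁻ l, ind (After e.1 l) * F (e :: l) ∂orderedListMeasure M := h1.lintegral_prod_right'
  change ∫⁻ e, ∫⁻ l, ind (After e.1 l) * F (e :: l) ∂orderedListMeasure M ∂_ = _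
  rw [lintegral_prod _ h2.aemeasurable]
  refine lintegral_congr fun s => ?_
  rw [lintegral_prod _ (by fun_prop)]
  refine lintegral_congr fun v => ?_
  rw [← lintegral_orderedListMeasure_shift s (by fun_prop)]
  simp only [after_shift, sub_self]

end

namespace ReversiblePDMP

variable {E V Vr β : Type*} [MeasureSpace E] [MeasureSpace V] [MeasureSpace Vr]
  [MeasurableSpace β] {G : ReversiblePDMP E V Vr} {ψ : ℝ → Path E Vr → ℝ}

set_option linter.unusedSectionVars false

variable [SigmaFinite (volume : Measure E)] [SigmaFinite (volume : Measure V)]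
  [SigmaFinite (volume : Measure Vr)] [TopologicalSpace E] [TopologicalSpace Vr]

theorem volumeChange_nil_pos (hψ : G.IsVolumeChange ψ) (hcont : G.ContinuousReversal ψ)
    {T : ℝ} (hT : 0 ≤ T) (x : E) :
    volumeChange ψ T (x, []) ≠ 0 ∧ volumeChange ψ T (x, []) ≠ ∞ :=
  volumeChange_pos hψ hcont List.Pairwise.nil (by simp [After]) (by simpa [lastTime] using hT)

/-- Instance of `reverse_shift`: the flow up to the first event is absorbed into the initial state,
and this event becomes one at time 0. -/
theorem R_cons_shift (T s : ℝ) (x : E) (v : V) (l : List (ℝ × V)) :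
    G.R T (x, (s, v) :: shift s l) = G.R (T - s) (G.flow s x, (0, v) :: l) := by
  have h := Dynamics.reverse_shift (rev := G.mark) G.isFlow_fwd (T - s) s x ((0, v) :: l)
  rw [sub_add_cancel] at h
  simp only [NutsPDMP.shift, List.map_cons, zero_add] at h
  exact h

/-- The backward side of the reversal formula, integrated over the horizon. For each path the
horizon is written as `lastTime + s`, so that `s` is the time of pure flow after the last backward
event. -/
theorem lintegral_boundary_left (hψ : G.IsVolumeChange ψ)
    {H : ℝ × Path E Vr → ℝ≥0∞} (hH : Measurable H) :
    ∫⁻ T : ℝ, ind (0 < T) * ∫⁻ w, ind (After 0 w.2 ∧ Before T w.2) *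
        (volumeChange ψ T w * (ind (w.2 ≠ []) * H (T - lastTime w.2, w))) ∂allPaths E Vr =
      ∫⁻ w, ind (w.2 ≠ [] ∧ After 0 w.2) *
        (∫⁻ s : ℝ, ind (0 < s) * (volumeChange ψ (lastTime w.2 + s) w * H (s, w)))
          ∂allPaths E Vr := by
  have hv : Measurable fun p : ℝ × Path E Vr => volumeChange ψ p.1 p.2 :=
    measurable_volumeChange hψ
  have hm : Measurable fun p : ℝ × Path E Vr => ind (After 0 p.2.2 ∧ Before p.1 p.2.2) *
      (volumeChange ψ p.1 p.2 * (ind (p.2.2 ≠ []) * H (p.1 - lastTime p.2.2, p.2))) := by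
    refine Measurable.mul (by fun_prop) (hv.mul ?_)
    fun_prop
  have h1 : ∀ T : ℝ, ind (0 < T) * ∫⁻ w, ind (After 0 w.2 ∧ Before T w.2) *
        (volumeChange ψ T w * (ind (w.2 ≠ []) * H (T - lastTime w.2, w))) ∂allPaths E Vr =
      ∫⁻ w, ind (0 < T) * (ind (After 0 w.2 ∧ Before T w.2) *
        (volumeChange ψ T w * (ind (w.2 ≠ []) * H (T - lastTime w.2, w)))) ∂allPaths E Vr :=
    fun T => (lintegral_const_mul _ (hm.comp measurable_prodMk_left)).symm
  have hm2 : Measurable fun p : ℝ × Path E Vr => ind (0 < p.1) *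
      (ind (After 0 p.2.2 ∧ Before p.1 p.2.2) *
      (volumeChange ψ p.1 p.2 * (ind (p.2.2 ≠ []) * H (p.1 - lastTime p.2.2, p.2)))) :=
    Measurable.mul (by fun_prop) hm
  simp only [h1]
  rw [lintegral_lintegral_swap hm2.aemeasurable]
  refine lintegral_congr_ae ?_
  filter_upwards [ae_increasing_allPaths] with w hw
  rw [← lintegral_const_mul' _ _ (ind_ne_top _),
    ← lintegral_add_left_eq_self _ (lastTime w.2)]
  refine lintegral_congr fun s => ?_
  simp only [add_sub_cancel_left]
  have key : (0 < lastTime w.2 + s ∧ (After 0 w.2 ∧ Before (lastTime w.2 + s) w.2) ∧ w.2 ≠ []) ↔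
      ((w.2 ≠ [] ∧ After 0 w.2) ∧ 0 < s) := by
    constructor
    · rintro ⟨h1, ⟨h2, h3⟩, h4⟩
      exact ⟨⟨h4, h2⟩, by linarith [(lastTime_lt_iff hw h1).2 h3]⟩
    · rintro ⟨⟨h4, h2⟩, h3⟩
      have h1 : 0 < lastTime w.2 + s := add_pos (lastTime_pos h2 h4) h3
      exact ⟨h1, ⟨h2, (lastTime_lt_iff hw h1).1 (by linarith)⟩, h4⟩
  have e1 : ∀ a b : ℝ≥0∞, ind (0 < lastTime w.2 + s) * (ind (After 0 w.2 ∧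
      Before (lastTime w.2 + s) w.2) * (a * (ind (w.2 ≠ []) * b))) =
      ind (0 < lastTime w.2 + s ∧ (After 0 w.2 ∧ Before (lastTime w.2 + s) w.2) ∧ w.2 ≠ []) *
        (a * b) := fun a b => by
    simp only [ind_and]
    ring
  rw [e1, key, ind_and _ (0 < s), mul_assoc]

/-- A state, followed by a jump at time `0` and by events before time `a`. -/
noncomputable abbrev jumpRange (a : ℝ) (l : List (ℝ × V)) : ℝ≥0∞ :=
  ind (0 < a ∧ After 0 l ∧ Before a l)

/-- The forward side of the same integral. Here `s` is the time of the first event, the flow before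
it contributes its volume change, and what remains is a path of length `a = T - s` that begins with
a jump. -/
theorem lintegral_boundary_right (hψ : G.IsVolumeChange ψ) (hcont : G.ContinuousReversal ψ)
    {H : ℝ × Path E Vr → ℝ≥0∞} (hH : Measurable H) :
    ∫⁻ T : ℝ, ind (0 < T) * ∫⁻ w, ind (After 0 w.2 ∧ Before T w.2) *
        (ind ((G.R T w).2 ≠ []) * H (T - lastTime (G.R T w).2, G.R T w)) ∂allPaths E V =
      ∫⁻ s : ℝ, ind (0 < s) * ∫⁻ x : E, volumeChange ψ s (x, []) *
        ∫⁻ a : ℝ, ∫⁻ m, jumpRange a m.2 * H (s, G.R a (x, (0, m.1) :: m.2)) ∂markList V := by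
  have hk : Measurable fun p : (ℝ × ℝ × E) × (V × List (ℝ × V)) =>
      jumpRange p.1.2.1 p.2.2 * H (p.1.1, G.R p.1.2.1 (p.1.2.2, (0, p.2.1) :: p.2.2)) := by
    fun_prop
  set K : ℝ × ℝ × E → ℝ≥0∞ := fun p => ∫⁻ m : V × List (ℝ × V),
    jumpRange p.2.1 m.2 * H (p.1, G.R p.2.1 (p.2.2, (0, m.1) :: m.2)) ∂markList V with hKdef
  have hK : Measurable K := hk.lintegral_prod_right'
  have h1 : ∀ T : ℝ, ind (0 < T) * ∫⁻ w, ind (After 0 w.2 ∧ Before T w.2) *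
        (ind ((G.R T w).2 ≠ []) * H (T - lastTime (G.R T w).2, G.R T w)) ∂allPaths E V =
      ∫⁻ x : E, ∫⁻ s : ℝ, ind (0 < s) * K (s, T - s, G.flow s x) := by
    intro T
    unfold allPaths
    rw [lintegral_prod _ (by fun_prop), ← lintegral_const_mul' _ _ (ind_ne_top _)]
    refine lintegral_congr fun x => ?_
    rw [lintegral_orderedListMeasure_cons_shift (by fun_prop),
      ind_neg (p := (G.R T (x, [])).2 ≠ []) (by simp [R, Dynamics.reverse_eq_nil]),
      zero_mul, mul_zero, zero_add, ← lintegral_const_mul' _ _ (ind_ne_top _)]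
    refine lintegral_congr fun s => ?_
    rw [hKdef, ← lintegral_const_mul' _ _ (ind_ne_top _),
      ← lintegral_const_mul' _ _ (ind_ne_top _)]
    refine lintegral_congr fun m => ?_
    simp only [R_cons_shift, after_cons, before_cons, after_shift, before_shift]
    rw [ind_pos (p := (G.R (T - s) (G.flow s x, (0, m.1) :: m.2)).2 ≠ [])
      (by simp [R, Dynamics.reverse_eq_nil]), one_mul,
      show lastTime (G.R (T - s) (G.flow s x, (0, m.1) :: m.2)).2 = T - s by
        simp [R, Dynamics.lastTime_reverse_cons], sub_sub_cancel]
    simp only [← mul_assoc, ← ind_and]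
    refine ind_mul_congr ?_ fun _ => rfl
    simp only [and_assoc]
    constructor
    · rintro ⟨h1, h2, h3, h4, h5, h6⟩
      exact ⟨h3, by linarith, h2, h6⟩
    · rintro ⟨h1, h2, h3, h4⟩
      exact ⟨by linarith, h3, h1, h3.mono (by linarith), by linarith, h4⟩
  simp only [h1]
  rw [lintegral_lintegral_swap (by
    refine Measurable.aemeasurable ?_
    have : Measurable fun p : (ℝ × E) × ℝ =>
        ind (0 < p.2) * K (p.2, p.1.1 - p.2, G.flow p.2 p.1.2) := by fun_prop
    exact this.lintegral_prod_right')]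
  have h2 : ∀ x : E, ∫⁻ T : ℝ, ∫⁻ s : ℝ, ind (0 < s) * K (s, T - s, G.flow s x) =
      ∫⁻ s : ℝ, ind (0 < s) * ∫⁻ a : ℝ, K (s, a, G.flow s x) := by
    intro x
    rw [lintegral_lintegral_swap (Measurable.aemeasurable (by fun_prop))]
    refine lintegral_congr fun s => ?_
    rw [lintegral_const_mul' _ _ (ind_ne_top _),
      lintegral_sub_right_eq_self (fun a => K (s, a, G.flow s x)) s]
  simp only [h2]
  have hKa : Measurable fun p : ℝ × E => ∫⁻ a : ℝ, K (p.1, a, p.2) := by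
    have : Measurable fun q : (ℝ × E) × ℝ => K (q.1.1, q.2, q.1.2) := by fun_prop
    exact this.lintegral_prod_right'
  rw [lintegral_lintegral_swap (by
    refine Measurable.aemeasurable (Measurable.mul (by fun_prop) ?_)
    exact hKa.comp (by fun_prop : Measurable fun p : E × ℝ => (p.2, G.flow p.2 p.1)))]
  refine lintegral_congr fun s => ?_
  rw [lintegral_const_mul' _ _ (ind_ne_top _)]
  by_cases hs : 0 < s
  · rw [lintegral_flow hψ hcont hs (F := fun y => ∫⁻ a : ℝ, K (s, a, y))
      (hKa.comp measurable_prodMk_left)]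
  · rw [ind_neg hs, zero_mul, zero_mul]

/-- Paths with an event at the horizon are negligible for each fixed horizon. Integrating over the
horizon brings them in, together with the extra variable `s`, which has to be removed later. -/
theorem lintegral_boundary_prod (hψ : G.IsVolumeChange ψ) (hcont : G.ContinuousReversal ψ)
    {H : ℝ × Path E Vr → ℝ≥0∞} (hH : Measurable H) :
    ∫⁻ w, ind (w.2 ≠ [] ∧ After 0 w.2) *
        (∫⁻ s : ℝ, ind (0 < s) * (volumeChange ψ (lastTime w.2 + s) w * H (s, w)))
          ∂allPaths E Vr =
      ∫⁻ s : ℝ, ind (0 < s) * ∫⁻ x : E, volumeChange ψ s (x, []) *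
        ∫⁻ a : ℝ, ∫⁻ m, jumpRange a m.2 * H (s, G.R a (x, (0, m.1) :: m.2)) ∂markList V := by
  rw [← lintegral_boundary_left hψ hH, ← lintegral_boundary_right hψ hcont hH]
  refine lintegral_congr fun T => ind_mul_congr Iff.rfl fun hT => ?_
  exact (lintegral_reversal hψ hcont hT
    (F := fun w => ind (w.2 ≠ []) * H (T - lastTime w.2, w)) (by fun_prop)).symm

/-- The law of reversed paths that end with an event. -/
noncomputable def boundaryMeasure (G : ReversiblePDMP E V Vr) : Measure (Path E Vr) :=
  ((((volume : Measure E).prod (volume : Measure ℝ)).prod (markList V)).restrict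
    {p | 0 < p.1.2 ∧ After 0 p.2.2 ∧ Before p.1.2 p.2.2}).map
      fun p => G.R p.1.2 (p.1.1, (0, p.2.1) :: p.2.2)

instance : SFinite (boundaryMeasure G) := by
  unfold boundaryMeasure
  infer_instance

theorem lintegral_boundaryMeasure {F : Path E Vr → ℝ≥0∞} (hF : Measurable F) :
    ∫⁻ w, F w ∂boundaryMeasure G =
      ∫⁻ x : E, ∫⁻ a : ℝ, ∫⁻ m, jumpRange a m.2 * F (G.R a (x, (0, m.1) :: m.2))
        ∂markList V := by
  have hm : Measurable fun p : (E × ℝ) × (V × List (ℝ × V)) =>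
      jumpRange p.1.2 p.2.2 * F (G.R p.1.2 (p.1.1, (0, p.2.1) :: p.2.2)) := by fun_prop
  unfold boundaryMeasure
  rw [lintegral_map hF (by fun_prop), ← lintegral_ind_mul
    (measurableSet_setOfPred.2 (by fun_prop)), lintegral_prod _ (by fun_prop),
    lintegral_prod _ (Measurable.aemeasurable ?_)]
  exact hm.lintegral_prod_right'

/-- The starting point of the flow that ends with the last event. -/
noncomputable abbrev lastState (G : ReversiblePDMP E V Vr) (w : Path E Vr) : E :=
  (G.Rinv (lastTime w.2) w).1

/-- The state at which the flow volume is evaluated can be read off from the reversed path, so this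
factor may be divided out under the integral over reversed paths. -/
theorem lastState_R (a : ℝ) (x : E) (v : V) (l : List (ℝ × V)) :
    lastState G (G.R a (x, (0, v) :: l)) = x := by
  unfold lastState
  rw [show lastTime (G.R a (x, (0, v) :: l)).2 = a by
    simp [R, Dynamics.lastTime_reverse_cons], Rinv_R]

/-- After division by the flow volume the right side becomes an integral against a product measure:
Lebesgue measure in `s`, independently of the path. -/
theorem lintegral_boundary_ratio (hψ : G.IsVolumeChange ψ) (hcont : G.ContinuousReversal ψ)
    {H : ℝ × Path E Vr → ℝ≥0∞} (hH : Measurable H) :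
    ∫⁻ w, ind (w.2 ≠ [] ∧ After 0 w.2) *
        (∫⁻ s : ℝ, ind (0 < s) * (volumeChange ψ (lastTime w.2 + s) w *
          (H (s, w) / volumeChange ψ s (lastState G w, [])))) ∂allPaths E Vr =
      ∫⁻ s : ℝ, ind (0 < s) * ∫⁻ w, H (s, w) ∂boundaryMeasure G := by
  have hJ : Measurable fun p : ℝ × Path E Vr => volumeChange ψ p.1 (lastState G p.2, []) :=
    .volumeChange hψ (by fun_prop) (by fun_prop)
  rw [lintegral_boundary_prod hψ hcont
    (H := fun p => H p / volumeChange ψ p.1 (lastState G p.2, [])) (hH.div hJ)]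
  refine lintegral_congr fun s => ind_mul_congr Iff.rfl fun hs => ?_
  have hHs : Measurable fun w => H (s, w) := hH.comp measurable_prodMk_left
  rw [lintegral_boundaryMeasure hHs]
  refine lintegral_congr fun x => ?_
  obtain ⟨h0, ht⟩ := volumeChange_nil_pos hψ hcont hs.le x
  rw [← lintegral_const_mul' _ _ ht]
  refine lintegral_congr fun a => ?_
  rw [← lintegral_const_mul' _ _ ht]
  refine lintegral_congr fun m => ?_
  simp only [lastState_R]
  rw [mul_left_comm, ENNReal.mul_div_cancel h0 ht]

/-- Tested on the indicator of a null set, with no dependence on `s`, the left side of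
`lintegral_boundary_ratio` is 0 while the right side is an infinite length times the boundary mass
of the set. -/
theorem boundaryMeasure_absolutelyContinuous (hψ : G.IsVolumeChange ψ)
    (hcont : G.ContinuousReversal ψ) :
    boundaryMeasure G ≪ (allPaths E Vr).restrict {w | w.2 ≠ [] ∧ After 0 w.2} := by
  have hS : MeasurableSet {w : Path E Vr | w.2 ≠ [] ∧ After 0 w.2} :=
    measurableSet_setOfPred.2 (by fun_prop)
  refine Measure.AbsolutelyContinuous.mk fun A hA h0 => ?_
  have h := lintegral_boundary_ratio hψ hcont (H := fun p => ind (p.2 ∈ A))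
    (measurable_ind (measurable_snd hA))
  have hz : ∀ᵐ w ∂allPaths E Vr, w.2 ≠ [] ∧ After 0 w.2 → w ∉ A := by
    exact (ae_restrict_iff' hS).1 (measure_eq_zero_iff_ae_notMem.1 h0)
  have hl : ∫⁻ w, ind (w.2 ≠ [] ∧ After 0 w.2) *
        (∫⁻ s : ℝ, ind (0 < s) * (volumeChange ψ (lastTime w.2 + s) w *
          (ind (w ∈ A) / volumeChange ψ s (lastState G w, [])))) ∂allPaths E Vr = 0 := by
    refine (lintegral_congr_ae ?_).trans lintegral_zero
    filter_upwards [hz] with w hw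
    by_cases hw' : w.2 ≠ [] ∧ After 0 w.2
    · rw [ind_neg (hw hw')]
      simp
    · rw [ind_neg hw', zero_mul]
  simp only at h
  have hc : ∫⁻ w, ind (w ∈ A) ∂boundaryMeasure G = boundaryMeasure G A := lintegral_ind hA
  have hm : Measurable fun s : ℝ => ind (0 < s) := by fun_prop
  rw [hl, lintegral_mul_const _ hm, hc,
    show ∫⁻ s : ℝ, ind (0 < s) = ∞ from (lintegral_ind measurableSet_Ioi).trans (by
      rw [← Real.volume_Ioi (a := 0)]; rfl)] at h
  exact (mul_eq_zero.1 h.symm).resolve_left ENNReal.top_ne_zero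

/-- The volume change of the reversal at the time of the last event. -/
theorem lintegral_boundary (hψ : G.IsVolumeChange ψ) (hcont : G.ContinuousReversal ψ)
    {F : Path E Vr → ℝ≥0∞} (hF : Measurable F) :
    ∫⁻ w, ind (w.2 ≠ [] ∧ After 0 w.2) * (volumeChange ψ (lastTime w.2) w * F w)
        ∂allPaths E Vr =
      ∫⁻ x : E, ∫⁻ a : ℝ, ∫⁻ m, jumpRange a m.2 * F (G.R a (x, (0, m.1) :: m.2))
        ∂markList V := by
  have hS : MeasurableSet {w : Path E Vr | w.2 ≠ [] ∧ After 0 w.2} :=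
    measurableSet_setOfPred.2 (by fun_prop)
  set Q := (allPaths E Vr).restrict {w | w.2 ≠ [] ∧ After 0 w.2} with hQ
  set ν₀ := (volume : Measure ℝ).restrict (Ioi 0) with hν₀
  set b := (boundaryMeasure G).rnDeriv Q with hb
  have hac := boundaryMeasure_absolutelyContinuous hψ hcont
  have hB : Q.withDensity b = boundaryMeasure G := Measure.withDensity_rnDeriv_eq _ _ hac
  have hbm : Measurable b := Measure.measurable_rnDeriv _ _
  obtain ⟨ρ, hρ⟩ : ∃ ρ : Path E Vr → ℝ → ℝ≥0∞, ∀ w s, ρ w s =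
    volumeChange ψ (lastTime w.2 + s) w / volumeChange ψ s (lastState G w, []) :=
    ⟨_, fun _ _ => rfl⟩
  have hρm : Measurable fun p : Path E Vr × ℝ => ρ p.1 p.2 := by
    simp only [hρ]
    exact (Measurable.volumeChange hψ (by fun_prop) (by fun_prop)).div
      (Measurable.volumeChange hψ (by fun_prop) (by fun_prop))
  have hQint : ∀ f : Path E Vr → ℝ≥0∞, ∫⁻ w, f w ∂Q =
      ∫⁻ w, ind (w.2 ≠ [] ∧ After 0 w.2) * f w ∂allPaths E Vr := fun f =>
    (lintegral_ind_mul hS f).symm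
  have hνint : ∀ f : ℝ → ℝ≥0∞, ∫⁻ s, f s ∂ν₀ = ∫⁻ s, ind (0 < s) * f s := fun f =>
    (lintegral_ind_mul measurableSet_Ioi f).symm
  -- The ratio `ρ w s` and the Radon–Nikodym density `b w` describe the same product measure, so `ρ
  -- w s` does not depend on `s`, up to null sets.
  have heq : (Q.prod ν₀).withDensity (fun p => ρ p.1 p.2) =
      (Q.prod ν₀).withDensity (fun p => b p.1) := by
    rw [← prod_withDensity_left hbm, hB]
    ext A hA
    have hi : Measurable fun p : Path E Vr × ℝ => ind (p ∈ A) := measurable_ind hA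
    have him : Measurable fun p : Path E Vr × ℝ => ind (p ∈ A) * ρ p.1 p.2 := hi.mul hρm
    have hc : (boundaryMeasure G).prod ν₀ A =
      ∫⁻ p, ind (p ∈ A) ∂(boundaryMeasure G).prod ν₀ := (lintegral_ind hA).symm
    rw [withDensity_apply _ hA, setLIntegral_eq_ind hA, hc,
      lintegral_prod _ him.aemeasurable, lintegral_prod _ hi.aemeasurable,
      lintegral_lintegral_swap (μ := boundaryMeasure G) hi.aemeasurable, hQint, hνint]
    rw [← lintegral_boundary_ratio hψ hcont (H := fun p => ind ((p.2, p.1) ∈ A))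
      (hi.comp measurable_swap)]
    refine lintegral_congr fun w => ?_
    rw [hνint]
    refine congrArg _ (lintegral_congr fun s => congrArg _ ?_)
    rw [hρ, mul_div, mul_div, mul_comm]
  have hae : ∀ᵐ w ∂Q, ∀ᵐ s ∂ν₀, ρ w s = b w :=
    Measure.ae_ae_of_ae_prod ((withDensity_eq_iff_of_sigmaFinite hρm.aemeasurable
      (hbm.comp measurable_fst).aemeasurable).1 heq)
  have hQS : ∀ᵐ w ∂Q, (w.2 ≠ [] ∧ After 0 w.2) ∧ Increasing w.2 :=
    (ae_restrict_mem hS).and (ae_restrict_of_ae ae_increasing_allPaths)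
  -- Equality with `b w` holds for almost every `s > 0`, hence for some `s` arbitrarily close to 0,
  -- and `ρ w s` tends to `ρ w 0`.
  have hb0 : ∀ᵐ w ∂Q, b w = ρ w 0 := by
    filter_upwards [hae, hQS] with w hw ⟨⟨hne, ha⟩, hi⟩
    have hfr : ∃ᶠ s in nhdsWithin (0 : ℝ) (Ioi 0), ρ w s = b w := by
      intro hev
      obtain ⟨δ, hδ, hsub⟩ := mem_nhdsGT_iff_exists_Ioo_subset.1 hev
      have h0 : ν₀ (Ioo 0 δ) = 0 := measure_mono_null hsub hw
      rw [hν₀, Measure.restrict_apply measurableSet_Ioo,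
        inter_eq_left.2 Ioo_subset_Ioi_self, Real.volume_Ioo, sub_zero,
        ENNReal.ofReal_eq_zero] at h0
      exact absurd hδ (not_lt.2 h0)
    have hnil : Increasing ((lastState G w, []) : Path E Vr).2 ∧
        After 0 ((lastState G w, []) : Path E Vr).2 := ⟨List.Pairwise.nil, by simp [After]⟩
    have t1 := tendsto_volumeChange hcont hi ha le_rfl
    have t2 := tendsto_volumeChange hcont hnil.1 hnil.2 (T := 0) le_rfl
    obtain ⟨p1, p2⟩ := volumeChange_pos hψ hcont hi ha le_rfl
    obtain ⟨q1, q2⟩ := volumeChange_nil_pos hψ hcont le_rfl (lastState G w)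
    simp only [zero_add] at t2
    have t3 := ENNReal.Tendsto.div t1 (Or.inl p1) t2 (Or.inl q2)
    simp only [hρ] at hfr
    have := tendsto_nhds_unique_of_frequently_eq t3 (tendsto_const_nhds (x := b w)) hfr
    simp only [hρ, add_zero, this]
  have hid : ∀ f : Path E Vr → ℝ≥0∞, Measurable f →
      ∫⁻ w, f w ∂boundaryMeasure G = ∫⁻ w, ρ w 0 * f w ∂Q := fun f hf => by
    rw [← hB, lintegral_withDensity_eq_lintegral_mul _ hbm hf]
    refine lintegral_congr_ae ?_
    filter_upwards [hb0] with w hw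
    rw [Pi.mul_apply, hw]
  have hJ0 : Measurable fun w : Path E Vr => volumeChange ψ 0 (lastState G w, []) :=
    .volumeChange hψ (by fun_prop) (by fun_prop)
  -- Known for almost every state, this holds almost everywhere for the boundary measure, where
  -- `lastState` recovers the coordinate in `E`. It passes to `Q` because the density `ρ w 0` does
  -- not vanish.
  have hJ : ∀ᵐ w ∂Q, volumeChange ψ 0 (lastState G w, []) = 1 := by
    have hi : Measurable fun w : Path E Vr => ind (¬ volumeChange ψ 0 (lastState G w, []) = 1) :=
      measurable_ind (hJ0 (measurableSet_singleton 1)).compl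
    have h1 : ∫⁻ w, ind (¬ volumeChange ψ 0 (lastState G w, []) = 1) ∂boundaryMeasure G = 0 := by
      rw [lintegral_boundaryMeasure hi]
      refine (lintegral_congr_ae ?_).trans lintegral_zero
      filter_upwards [volumeChange_zero hψ hcont] with x hx
      simp [lastState_R, hx, ind]
    have hρ0 : Measurable fun w => ρ w 0 :=
      hρm.comp (g := fun p => ρ p.1 p.2) measurable_prodMk_right
    rw [hid _ hi] at h1
    replace h1 := (lintegral_eq_zero_iff (hρ0.mul hi)).1 h1
    filter_upwards [h1, hQS] with w hw ⟨⟨hne, ha⟩, hin⟩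
    by_contra hcon
    obtain ⟨p1, -⟩ := volumeChange_pos hψ hcont hin ha le_rfl
    obtain ⟨-, q2⟩ := volumeChange_nil_pos hψ hcont le_rfl (lastState G w)
    rw [Pi.mul_apply, ind_pos hcon, mul_one] at hw
    simp [hρ, ENNReal.div_eq_zero_iff, p1, q2] at hw
  rw [← lintegral_boundaryMeasure hF, hid F hF, ← hQint]
  refine lintegral_congr_ae ?_
  filter_upwards [hJ] with w hw
  simp only [hρ, hw, div_one, add_zero]

end ReversiblePDMP

end NutsPDMP

namespace NutsPDMP

/-! ### Event sequences -/

section EventSequences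

set_option linter.unusedSectionVars false

variable {M : Type*} [MeasurableSpace M]

theorem Increasing.nodup {l : List (ℝ × M)} (h : Increasing l) : l.Nodup :=
  h.imp fun hab hne => (hne ▸ hab).false

/-- Strictly increasing times leave neither repetitions nor a choice of order, so identities between
event lists reduce to membership. -/
theorem Increasing.ext {l l' : List (ℝ × M)} (h : Increasing l) (h' : Increasing l')
    (hmem : ∀ e, e ∈ l ↔ e ∈ l') : l = l' :=
  ((List.perm_ext_iff_of_nodup h.nodup h'.nodup).2 hmem).eq_of_pairwise
    (fun _ _ _ _ hab hba => absurd hab hba.not_gt) h h'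

theorem Increasing.filter {l : List (ℝ × M)} (h : Increasing l) (p : ℝ × M → Bool) :
    Increasing (l.filter p) := List.Pairwise.filter p h

theorem Increasing.filter_append_filter {l : List (ℝ × M)} (h : Increasing l) (a : ℝ) :
    l.filter (fun e => e.1 < a) ++ l.filter (fun e => a ≤ e.1) = l := by
  refine Increasing.ext ?_ h fun e => ?_
  · refine List.pairwise_append.2 ⟨h.filter _, h.filter _, fun x hx y hy => ?_⟩
    simp only [List.mem_filter, decide_eq_true_eq] at hx hy
    exact hx.2.trans_le hy.2
  · simp only [List.mem_append, List.mem_filter, decide_eq_true_eq]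
    constructor
    · rintro (h | h) <;> exact h.1
    · exact fun h => (lt_or_ge e.1 a).imp (fun h' => ⟨h, h'⟩) fun h' => ⟨h, h'⟩

/-- An increasing, locally finite sequence of positive event times. -/
structure IsEventSequence (N : ℕ → Option (ℝ × M)) : Prop where
  none_none : ∀ n, N n = none → N (n + 1) = none
  increasing : ∀ n, Increasing (firstEvents N n)
  after : ∀ n, After 0 (firstEvents N n)
  nonExplosive : NonExplosive N

namespace IsEventSequence

variable {N : ℕ → Option (ℝ × M)} (hN : IsEventSequence N)
include hN

theorem none_of_le {m k : ℕ} (hm : N m = none) (hk : m ≤ k) : N k = none := by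
  induction k, hk using Nat.le_induction with
  | base => exact hm
  | succ k _ ih => exact hN.none_none k ih

theorem lt_of_lt {m k : ℕ} {e f : ℝ × M} (hm : N m = some e) (hk : N k = some f) (hmk : m < k) :
    e.1 < f.1 := by
  have h := hN.increasing (k + 1)
  rw [firstEvents_succ, hk] at h
  exact (increasing_append_singleton.1 h).2 e (mem_firstEvents.2 ⟨m, hmk, hm⟩)

theorem pos {n : ℕ} {e : ℝ × M} (h : N n = some e) : 0 < e.1 :=
  hN.after (n + 1) e (mem_firstEvents.2 ⟨n, n.lt_succ_self, h⟩)

theorem mem_firstEvents_iff {n : ℕ} {t : ℝ} (h1 : ∀ e ∈ firstEvents N n, e.1 ≤ t)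
    (h2 : ∀ e ∈ N n, t < e.1) {e : ℝ × M} :
    e ∈ firstEvents N n ↔ (∃ k, N k = some e) ∧ e.1 ≤ t := by
  refine ⟨fun h => ⟨(mem_firstEvents.1 h).imp fun _ h => h.2, h1 e h⟩, ?_⟩
  rintro ⟨⟨k, hk⟩, het⟩
  refine mem_firstEvents.2 ⟨k, ?_, hk⟩
  by_contra hkn
  rcases (not_lt.1 hkn).eq_or_lt with rfl | hlt
  · exact (h2 e hk).not_ge het
  · cases hn : N n with
    | none => rw [hN.none_of_le hn hlt.le] at hk; cases hk
    | some f => exact ((h2 f hn).trans (hN.lt_of_lt hn hk hlt)).not_ge het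

/-- Every index below the infimum carries an event at a time at most `t`, by minimality;
non-explosion makes the infimum attained. -/
theorem eventsUpTo_spec (t : ℝ) : ∃ n, eventsUpTo N t = firstEvents N n ∧
    (firstEvents N n).length = n ∧ (∀ e ∈ firstEvents N n, e.1 ≤ t) ∧ ∀ e ∈ N n, t < e.1 := by
  have hm := Nat.sInf_mem (hN.nonExplosive t)
  have hlt : ∀ k < sInf {n | ∀ e ∈ N n, t < e.1}, ∃ e, N k = some e ∧ e.1 ≤ t := fun k hk => by
    have := Nat.notMem_of_lt_sInf hk
    simp only [mem_ofPred_eq] at this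
    push Not at this
    exact this
  refine ⟨_, rfl, ?_, ?_, hm⟩
  · generalize sInf {n | ∀ e ∈ N n, t < e.1} = m at hlt
    clear hm
    induction m with
    | zero => rfl
    | succ m ih =>
      obtain ⟨e, he, -⟩ := hlt m m.lt_succ_self
      exact length_firstEvents_succ_iff.2
        ⟨ih fun k hk => hlt k (hk.trans m.lt_succ_self), e, he⟩
  · intro e he
    obtain ⟨k, hk, hke⟩ := mem_firstEvents.1 he
    obtain ⟨f, hf, hft⟩ := hlt k hk
    rw [hke] at hf
    cases hf
    exact hft

theorem mem_eventsUpTo {t : ℝ} {e : ℝ × M} :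
    e ∈ eventsUpTo N t ↔ (∃ k, N k = some e) ∧ e.1 ≤ t := by
  obtain ⟨n, h, -, h1, h2⟩ := hN.eventsUpTo_spec t
  rw [h]
  exact hN.mem_firstEvents_iff h1 h2

theorem increasing_eventsUpTo (t : ℝ) : Increasing (eventsUpTo N t) := hN.increasing _

theorem after_eventsUpTo (t : ℝ) : After 0 (eventsUpTo N t) := hN.after _

theorem eventsUpTo_eq_firstEvents {n : ℕ} {t : ℝ} (h1 : ∀ e ∈ firstEvents N n, e.1 ≤ t)
    (h2 : ∀ e ∈ N n, t < e.1) : eventsUpTo N t = firstEvents N n :=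
  (hN.increasing_eventsUpTo t).ext (hN.increasing n) fun e => by
    rw [hN.mem_eventsUpTo, hN.mem_firstEvents_iff h1 h2]

theorem filter_eventsUpTo {s t : ℝ} (hst : s ≤ t) :
    (eventsUpTo N t).filter (fun e => e.1 ≤ s) = eventsUpTo N s :=
  ((hN.increasing_eventsUpTo t).filter _).ext (hN.increasing_eventsUpTo s) fun e => by
    simp only [List.mem_filter, hN.mem_eventsUpTo, decide_eq_true_eq]
    exact ⟨fun h => ⟨h.1.1, h.2⟩, fun h => ⟨⟨h.1, h.2.trans hst⟩, h.2⟩⟩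

theorem eventsUpTo_zero : eventsUpTo N 0 = [] := by
  refine List.eq_nil_iff_forall_not_mem.2 fun e he => ?_
  obtain ⟨⟨k, hk⟩, he0⟩ := hN.mem_eventsUpTo.1 he
  exact (hN.pos hk).not_ge he0

/-- Only finitely many events occur before `t + 1`, and finitely many times other than `t` keep a
positive distance from `t`. -/
theorem exists_isolated (t : ℝ) :
    ∃ δ > 0, ∀ k e, N k = some e → |e.1 - t| < δ → e.1 = t := by
  have hl : ∀ l : List (ℝ × M), ∃ δ > 0, ∀ e ∈ l, |e.1 - t| < δ → e.1 = t := by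
    intro l
    induction l with
    | nil => exact ⟨1, one_pos, by simp⟩
    | cons f l ih =>
      obtain ⟨δ, hδ, h⟩ := ih
      by_cases hf : f.1 = t
      · refine ⟨δ, hδ, fun e he hlt => ?_⟩
        rcases List.mem_cons.1 he with rfl | he
        · exact hf
        · exact h e he hlt
      · refine ⟨min δ |f.1 - t|, lt_min hδ (abs_pos.2 (sub_ne_zero.2 hf)), fun e he hlt => ?_⟩
        rcases List.mem_cons.1 he with rfl | he
        · exact absurd (hlt.trans_le (min_le_right _ _)) (lt_irrefl _)
        · exact h e he (hlt.trans_le (min_le_left _ _))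
  obtain ⟨δ, hδ, h⟩ := hl (eventsUpTo N (t + 1))
  refine ⟨min δ 1, lt_min hδ one_pos, fun k e hk hlt => ?_⟩
  refine h e (hN.mem_eventsUpTo.2 ⟨⟨k, hk⟩, ?_⟩) (hlt.trans_le (min_le_left _ _))
  linarith [(abs_lt.1 (hlt.trans_le (min_le_right _ _))).2]

/-- Around each time, the list of past events changes only at this time. -/
theorem exists_eventsUpTo_eq (t : ℝ) : ∃ δ > 0,
    (∀ s, t ≤ s → s < t + δ → eventsUpTo N s = eventsUpTo N t) ∧
    ∀ s, t - δ < s → s < t → eventsUpTo N s = (eventsUpTo N t).filter (fun e => e.1 < t) ∧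
      ∀ e ∈ eventsUpTo N s, e.1 < s := by
  obtain ⟨δ, hδ, h⟩ := hN.exists_isolated t
  refine ⟨δ, hδ, fun s h1 h2 => ?_, fun s h1 h2 => ⟨?_, fun e he => ?_⟩⟩
  · refine (hN.increasing_eventsUpTo s).ext (hN.increasing_eventsUpTo t) fun e => ?_
    simp only [hN.mem_eventsUpTo]
    refine and_congr_right fun ⟨k, hk⟩ => ⟨fun hes => ?_, fun het => het.trans h1⟩
    by_contra hcon
    exact hcon (h k e hk (abs_lt.2 ⟨by linarith, by linarith⟩)).le
  · refine (hN.increasing_eventsUpTo s).ext ((hN.increasing_eventsUpTo t).filter _) fun e => ?_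
    simp only [List.mem_filter, hN.mem_eventsUpTo, decide_eq_true_eq]
    constructor
    · rintro ⟨hk, hes⟩
      exact ⟨⟨hk, by linarith⟩, by linarith⟩
    · rintro ⟨⟨⟨k, hk⟩, -⟩, het⟩
      refine ⟨⟨k, hk⟩, ?_⟩
      by_contra hcon
      exact het.ne (h k e hk (abs_lt.2 ⟨by linarith, by linarith⟩))
  · obtain ⟨⟨k, hk⟩, hes⟩ := hN.mem_eventsUpTo.1 he
    rcases hes.lt_or_eq with h' | h'
    · exact h'
    · have := h k e hk (abs_lt.2 ⟨by linarith, by linarith⟩)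
      linarith

end IsEventSequence

end EventSequences

end NutsPDMP

namespace NutsPDMP

/-! ### Event points -/

namespace Dynamics

variable {E M : Type*} [MeasurableSpace M] {D : Dynamics E M}

set_option linter.unusedSectionVars false

theorem eventPointsAux_times (p : E × ℝ) (l : List (ℝ × M)) :
    (D.eventPointsAux p l).map Prod.fst = l.map Prod.fst := by
  induction l generalizing p with
  | nil => rfl
  | cons e l ih => simp only [eventPointsAux, List.map_cons, ih]

theorem forall_mem_eventPointsAux {p : E × ℝ} {l : List (ℝ × M)} {P : ℝ → Prop} :
    (∀ x ∈ D.eventPointsAux p l, P x.1) ↔ ∀ e ∈ l, P e.1 := by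
  have h : (∀ t ∈ (D.eventPointsAux p l).map Prod.fst, P t) ↔ ∀ t ∈ l.map Prod.fst, P t := by
    rw [eventPointsAux_times]
  simpa only [List.forall_mem_map] using h

theorem filter_eventPointsAux (p : E × ℝ) {l : List (ℝ × M)} (hl : Increasing l) (b : ℝ) :
    (D.eventPointsAux p l).filter (fun x => x.1 ≤ b) =
      D.eventPointsAux p (l.filter fun e => e.1 ≤ b) := by
  induction l generalizing p with
  | nil => rfl
  | cons e l ih =>
    obtain ⟨he, hl'⟩ := List.pairwise_cons.1 hl
    by_cases h : e.1 ≤ b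
    · simp only [eventPointsAux, List.filter_cons, h, decide_true, if_true, ih _ hl']
    · have h1 : ∀ f ∈ l, ¬ f.1 ≤ b := fun f hf hfb => h ((he f hf).le.trans hfb)
      have h2 : l.filter (fun e => e.1 ≤ b) = [] := by
        simpa [List.filter_eq_nil_iff] using h1
      have h3 : (D.eventPointsAux (D.step p e) l).filter (fun x => x.1 ≤ b) = [] := by
        have := (forall_mem_eventPointsAux (D := D) (p := D.step p e) (P := fun t => ¬ t ≤ b)).2 h1
        simpa only [List.filter_eq_nil_iff, decide_eq_true_eq] using this
      simp only [eventPointsAux, List.filter_cons, h, decide_false, h2, h3]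
      rfl

end Dynamics

theorem Segment.hasEventAt_iff {E V : Type*} [MeasurableSpace V] (D : Dynamics E V)
    {x : Segment E V} {t : ℝ} : x.HasEventAt t ↔ ∃ p ∈ D.eventPoints x.1, p.1 = t := by
  have h := not_congr (Dynamics.forall_mem_eventPointsAux (D := D) (p := (x.1.1, 0))
    (l := x.1.2) (P := fun s => s ≠ t))
  simp only [ne_eq, not_forall, not_not, exists_prop] at h
  exact h.symm

namespace ReversiblePDMP

variable {E V Vr : Type*} [MeasureSpace E] [MeasureSpace V] [MeasureSpace Vr]
  {G : ReversiblePDMP E V Vr}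

theorem StoppingCriterion.valid_iff (C : G.StoppingCriterion) {x y : Segment E V}
    (hx : x.WellFormed) (hy : y.WellFormed)
    (h : G.fwd.eventPoints y.1 = G.fwd.eventPoints x.1) (hl : x.2 = y.2) :
    x ∈ C.valid ↔ y ∈ C.valid := by
  refine C.eventsOnly x y 0 hx hy ?_ ?_ ?_
  · rw [h]
    simp
  · rw [Segment.hasEventAt_iff G.fwd, Segment.hasEventAt_iff G.fwd, h]
  · rw [Segment.hasEventAt_iff G.fwd, Segment.hasEventAt_iff G.fwd, h, hl]

/-- The new initial state lies on the flow line that leaves the last event before `a`, so the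
remaining events keep their pre- and post-jump states. -/
theorem eventPoints_restrict {x : Segment E V} (hx : Increasing x.1.2) (a b : ℝ) :
    G.fwd.eventPoints (G.restrict x a b).1 =
      ((G.fwd.eventPoints x.1).filter fun p => a ≤ p.1 ∧ p.1 ≤ b).map
        fun p => (p.1 + -a, p.2) := by
  obtain ⟨⟨z, l⟩, T⟩ := x
  simp only at hx
  set l₁ := l.filter fun e => e.1 < a with hl₁
  set l₂ := l.filter fun e => a ≤ e.1 with hl₂
  have hl : l₁ ++ l₂ = l := hx.filter_append_filter a
  have hmid : (l.filter fun e => a ≤ e.1 ∧ e.1 ≤ b) = l₂.filter fun e => e.1 ≤ b := by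
    rw [hl₂, List.filter_filter]
    refine List.filter_congr fun e _ => ?_
    simp [Bool.and_comm]
  have h1 : G.fwd.eventPoints (G.restrict ((z, l), T) a b).1 =
      (G.fwd.eventPointsAux (l₁.foldl G.fwd.step (z, 0)) (l₂.filter fun e => e.1 ≤ b)).map
        fun p => (p.1 + -a, p.2) := by
    unfold restrict Dynamics.eventPoints
    simp only [hmid]
    have h := Dynamics.eventPointsAux_shift (D := G.fwd) (-a) (G.fwd.stateAt a (z, l₁)) a
      (l₂.filter fun e => e.1 ≤ b)
    rw [add_neg_cancel] at h
    rw [h]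
    refine congrArg _ (Dynamics.Connected.eventPointsAux_eq G.isFlow_fwd ?_ _)
    rfl
  rw [h1, ← Dynamics.filter_eventPointsAux _ (hx.filter _)]
  congr 1
  have h2 : G.fwd.eventPoints (z, l) = G.fwd.eventPointsAux (z, 0) l₁ ++
      G.fwd.eventPointsAux (l₁.foldl G.fwd.step (z, 0)) l₂ := by
    rw [← Dynamics.eventPointsAux_append, hl]
    rfl
  simp only [h2, List.filter_append]
  have h3 : (G.fwd.eventPointsAux (z, 0) l₁).filter (fun p => a ≤ p.1 ∧ p.1 ≤ b) = [] := by
    have h : ∀ p ∈ G.fwd.eventPointsAux (z, 0) l₁, ¬ a ≤ p.1 := by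
      refine (Dynamics.forall_mem_eventPointsAux (P := fun t => ¬ a ≤ t)).2 fun e he => ?_
      simpa using (List.mem_filter.1 he).2
    refine List.filter_eq_nil_iff.2 fun p hp => ?_
    simp [h p hp]
  rw [h3, List.nil_append]
  have h : ∀ p ∈ G.fwd.eventPointsAux (l₁.foldl G.fwd.step (z, 0)) l₂, a ≤ p.1 := by
    refine (Dynamics.forall_mem_eventPointsAux (P := fun t => a ≤ t)).2 fun e he => ?_
    simpa using (List.mem_filter.1 he).2
  refine List.filter_congr fun p hp => ?_
  simp [h p hp]

/-! ### Segments of a two-sided trajectory -/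

/-- The path on `[-a,b]` with state `z` at time `0`, backward events `lb` and forward events `lf`,
seen from its left end. -/
def twoSided (G : ReversiblePDMP E V Vr) (z : E) (lb : List (ℝ × Vr)) (lf : List (ℝ × V))
    (a b : ℝ) : Segment E V :=
  (((G.Rinv a (z, lb)).1, (G.Rinv a (z, lb)).2 ++ shift a lf), a + b)

/-- The events of a two-sided path, with times counted from its origin. -/
def twoSidedPoints (G : ReversiblePDMP E V Vr) (z : E) (lb : List (ℝ × Vr))
    (lf : List (ℝ × V)) : List (ℝ × E × E) :=
  ((G.bwd.eventPoints (z, lb)).map fun p => (-p.1, p.2.2, p.2.1)).reverse ++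
    G.fwd.eventPoints (z, lf)

/-- The ends `a` and `b` enter only through a translation of time. A criterion based on event points
therefore notices them only when they are event times themselves. -/
theorem eventPoints_twoSided (z : E) (lb : List (ℝ × Vr)) (lf : List (ℝ × V)) (a b : ℝ) :
    G.fwd.eventPoints (G.twoSided z lb lf a b).1 =
      (G.twoSidedPoints z lb lf).map fun p => (p.1 + a, p.2) := by
  unfold twoSided twoSidedPoints Dynamics.eventPoints
  simp only
  rw [Dynamics.eventPointsAux_append, List.map_append]
  congr 1
  · refine (G.undoes_bwd.eventPoints_reverse (rev := G.rmark) a (z, lb)).trans ?_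
    rw [List.map_reverse, List.map_map]
    congr 2
    funext p
    simp [sub_eq_neg_add]
  · have h := Dynamics.eventPointsAux_shift (D := G.fwd) a z 0 lf
    rw [← h]
    symm
    refine Dynamics.Connected.eventPointsAux_eq G.isFlow_fwd ?_ _
    have h1 : (G.R a (G.Rinv a (z, lb))).1 = z := by rw [R_Rinv]
    rw [R, Dynamics.reverse_fst] at h1
    simp only [Dynamics.Connected, zero_add]
    exact h1.symm

variable {z : E} {lb : List (ℝ × Vr)} {lf : List (ℝ × V)} {a b : ℝ}

theorem wellFormed_twoSided (hlb : Increasing lb) (hlf : Increasing lf) (hb : After 0 lb)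
    (hf : After 0 lf) (ha0 : 0 ≤ a) (hb0 : 0 ≤ b) (ha : ∀ e ∈ lb, e.1 ≤ a)
    (hb' : ∀ e ∈ lf, e.1 ≤ b) : (G.twoSided z lb lf a b).WellFormed := by
  have h1 : ∀ x ∈ (G.Rinv a (z, lb)).2, 0 ≤ x.1 ∧ x.1 < a :=
    Dynamics.forall_mem_reverse (P := fun t => 0 ≤ t ∧ t < a).2 fun e he =>
      ⟨sub_nonneg.2 (ha e he), sub_lt_self _ (hb e he)⟩
  refine ⟨add_nonneg ha0 hb0, ?_, ?_⟩
  · refine List.pairwise_append.2 ⟨Dynamics.increasing_reverse.2 hlb, increasing_shift.2 hlf, ?_⟩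
    intro x hx y hy
    have h2 : After a (shift a lf) := after_shift.2 (by rwa [sub_self])
    exact (h1 x hx).2.trans (h2 y hy)
  · intro e he
    rcases List.mem_append.1 he with he | he
    · exact ⟨(h1 e he).1, (h1 e he).2.le.trans (le_add_of_nonneg_right hb0)⟩
    · obtain ⟨f, hf', rfl⟩ := List.mem_map.1 he
      exact ⟨add_nonneg (hf f hf').le ha0, by
        show f.1 + a ≤ a + b
        linarith [hb' f hf']⟩

theorem hasEventAt_zero_twoSided (hf : After 0 lf) (ha0 : 0 ≤ a) :
    (G.twoSided z lb lf a b).HasEventAt 0 ↔ ∃ e ∈ lb, e.1 = a := by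
  have h1 : (∃ x ∈ (G.Rinv a (z, lb)).2, x.1 = 0) ↔ ∃ e ∈ lb, a - e.1 = 0 :=
    Dynamics.exists_mem_reverse (P := fun t => t = 0)
  simp only [sub_eq_zero, eq_comm (a := a)] at h1
  rw [← h1]
  constructor
  · rintro ⟨e, he, he0⟩
    rcases List.mem_append.1 he with he | he
    · exact ⟨e, he, he0⟩
    · have h2 : After a (shift a lf) := after_shift.2 (by rwa [sub_self])
      exact absurd he0 (ha0.trans_lt (h2 e he)).ne'
  · rintro ⟨e, he, he0⟩
    exact ⟨e, List.mem_append_left _ he, he0⟩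

theorem hasEventAt_end_twoSided (hb : After 0 lb) (hb0 : 0 ≤ b) :
    (G.twoSided z lb lf a b).HasEventAt (a + b) ↔ ∃ e ∈ lf, e.1 = b := by
  have h1 : ∀ x ∈ (G.Rinv a (z, lb)).2, x.1 < a :=
    Dynamics.forall_mem_reverse (P := fun t => t < a).2 fun e he => sub_lt_self _ (hb e he)
  constructor
  · rintro ⟨e, he, he0⟩
    rcases List.mem_append.1 he with he | he
    · linarith [h1 e he]
    · obtain ⟨f, hf', rfl⟩ := List.mem_map.1 he
      refine ⟨f, hf', ?_⟩
      simp only at he0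
      linarith
  · rintro ⟨e, he, he0⟩
    exact ⟨_, List.mem_append_right _ (List.mem_map.2 ⟨e, he, rfl⟩), by simp [he0, add_comm]⟩

theorem filter_twoSidedPoints (hlb : Increasing lb) (hlf : Increasing lf) (hb : After 0 lb)
    (hf : After 0 lf) {a b : ℝ} (ha0 : 0 ≤ a) (hb0 : 0 ≤ b) :
    (G.twoSidedPoints z lb lf).filter (fun p => -a ≤ p.1 ∧ p.1 ≤ b) =
      G.twoSidedPoints z (lb.filter fun e => e.1 ≤ a) (lf.filter fun e => e.1 ≤ b) := by
  unfold twoSidedPoints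
  rw [List.filter_append, List.filter_reverse, List.filter_map]
  unfold Dynamics.eventPoints
  simp only
  rw [← Dynamics.filter_eventPointsAux _ hlb, ← Dynamics.filter_eventPointsAux _ hlf]
  have hb' : ∀ x ∈ G.bwd.eventPointsAux (z, 0) lb, 0 < x.1 :=
    (Dynamics.forall_mem_eventPointsAux (P := fun t => 0 < t)).2 hb
  have hf' : ∀ x ∈ G.fwd.eventPointsAux (z, 0) lf, 0 < x.1 :=
    (Dynamics.forall_mem_eventPointsAux (P := fun t => 0 < t)).2 hf
  refine congrArg₂ _ (congrArg _ (congrArg _ ?_)) ?_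
  · refine List.filter_congr fun x hx => ?_
    have h1 : -x.1 ≤ b := by linarith [hb' x hx]
    simp [h1]
  · refine List.filter_congr fun x hx => ?_
    have h1 : -a ≤ x.1 := by linarith [hf' x hx]
    simp [h1]

namespace StoppingCriterion

variable (C : G.StoppingCriterion)

/-- The criterion is monotone along nested segments of a two-sided path. -/
theorem valid_mono (hlb : Increasing lb) (hlf : Increasing lf) (hb : After 0 lb)
    (hf : After 0 lf) (ha : ∀ e ∈ lb, e.1 ≤ a) (hb' : ∀ e ∈ lf, e.1 ≤ b) {a' b' : ℝ}
    (ha0 : 0 ≤ a') (hb0 : 0 ≤ b') (haa : a' ≤ a) (hbb : b' ≤ b)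
    (h : G.twoSided z lb lf a b ∈ C.valid) :
    G.twoSided z (lb.filter fun e => e.1 ≤ a') (lf.filter fun e => e.1 ≤ b') a' b' ∈ C.valid := by
  have hw := wellFormed_twoSided (G := G) (z := z) hlb hlf hb hf (ha0.trans haa) (hb0.trans hbb)
    ha hb'
  have hr := C.consistent _ hw (a - a') (a + b') (sub_nonneg.2 haa) (by linarith)
    (add_le_add_right hbb a) h
  refine (C.valid_iff ?_ ?_ ?_ ?_).1 hr
  · refine ⟨by simp only [restrict]; linarith, ?_, ?_⟩
    · exact increasing_shift.2 (hw.2.1.filter _)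
    · intro e he
      obtain ⟨f, hf', rfl⟩ := List.mem_map.1 he
      obtain ⟨-, h2⟩ := List.mem_filter.1 hf'
      simp only [decide_eq_true_eq] at h2
      simp only [restrict]
      exact ⟨by linarith, by linarith⟩
  · refine wellFormed_twoSided (hlb.filter _) (hlf.filter _)
      (fun e he => hb e (List.mem_filter.1 he).1) (fun e he => hf e (List.mem_filter.1 he).1)
      ha0 hb0 (fun e he => ?_) (fun e he => ?_)
    · simpa using (List.mem_filter.1 he).2
    · simpa using (List.mem_filter.1 he).2
  · rw [eventPoints_twoSided, eventPoints_restrict hw.2.1, eventPoints_twoSided,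
      ← filter_twoSidedPoints hlb hlf hb hf ha0 hb0, List.filter_map, List.map_map]
    refine congrArg₂ _ ?_ (List.filter_congr fun x _ => ?_)
    · funext x
      simp only [Function.comp]
      congr 1
      ring
    · simp only [Function.comp, decide_eq_decide]
      constructor
      · rintro ⟨h1, h2⟩; exact ⟨by linarith, by linarith⟩
      · rintro ⟨h1, h2⟩; exact ⟨by linarith, by linarith⟩
  · simp only [restrict, twoSided]
    ring

/-- As long as there is no event at the ends, validity depends only on the events. -/
theorem valid_twoSided_iff (hlb : Increasing lb) (hlf : Increasing lf) (hb : After 0 lb)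
    (hf : After 0 lf) (ha : Before a lb) (hb' : Before b lf) {a' b' : ℝ} (ha' : Before a' lb)
    (hb'' : Before b' lf) (h0 : 0 ≤ a) (h1 : 0 ≤ b) (h2 : 0 ≤ a') (h3 : 0 ≤ b') :
    G.twoSided z lb lf a b ∈ C.valid ↔ G.twoSided z lb lf a' b' ∈ C.valid := by
  refine C.eventsOnly _ _ (a' - a)
    (wellFormed_twoSided hlb hlf hb hf h0 h1 (fun e he => (ha e he).le) fun e he => (hb' e he).le)
    (wellFormed_twoSided hlb hlf hb hf h2 h3 (fun e he => (ha' e he).le)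
      fun e he => (hb'' e he).le) ?_ ?_ ?_
  · rw [eventPoints_twoSided, eventPoints_twoSided, List.map_map]
    congr 1
    funext x
    simp only [Function.comp]
    congr 1
    ring
  · rw [hasEventAt_zero_twoSided hf h0, hasEventAt_zero_twoSided hf h2]
    exact iff_of_false (fun ⟨e, he, het⟩ => (ha e he).ne het)
      fun ⟨e, he, het⟩ => (ha' e he).ne het
  · refine Iff.trans (hasEventAt_end_twoSided hb h1)
      (Iff.trans ?_ (hasEventAt_end_twoSided hb h3).symm)
    exact iff_of_false (fun ⟨e, he, het⟩ => (hb' e he).ne het)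
      fun ⟨e, he, het⟩ => (hb'' e he).ne het

end StoppingCriterion

end ReversiblePDMP

end NutsPDMP

namespace NutsPDMP

/-! ### Events strictly before a time -/

section

variable {M : Type*} [MeasurableSpace M]

set_option linter.unusedSectionVars false

theorem filter_lt_append_singleton {l : List (ℝ × M)} {e : ℝ × M} (h : Increasing (l ++ [e])) :
    (l ++ [e]).filter (fun x => x.1 < e.1) = l := by
  have h1 := (increasing_append_singleton.1 h).2
  rw [List.filter_append, List.filter_eq_self.2 (by simpa using h1)]
  simp

theorem filter_lt_of_before {l : List (ℝ × M)} {t : ℝ} (h : Before t l) :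
    l.filter (fun x => x.1 < t) = l :=
  List.filter_eq_self.2 (by simpa [Before] using h)

theorem before_filter_lt (l : List (ℝ × M)) (t : ℝ) :
    Before t (l.filter fun x => x.1 < t) := fun e he => by
  simpa using (List.mem_filter.1 he).2

theorem Before.filter {l : List (ℝ × M)} {t : ℝ} (h : Before t l) (p : ℝ × M → Bool) :
    Before t (l.filter p) := fun e he => h e (List.mem_filter.1 he).1

end

/-! ### Moving the ends of a segment -/

namespace Dynamics

variable {E M M' : Type*} {D : Dynamics E M} {rev : E → M → M'}

theorem reverseAux_add (hD : D.IsFlow) (T c : ℝ) (p : E × ℝ) (acc : List (ℝ × M'))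
    (l : List (ℝ × M)) :
    D.reverseAux rev (T + c) p (shift c acc) l =
      (D.flow c (D.reverseAux rev T p acc l).1, shift c (D.reverseAux rev T p acc l).2) := by
  induction l generalizing p acc with
  | nil =>
    simp only [reverseAux]
    rw [hD.flow_flow p.1 (u := T + c - p.2) (by ring)]
  | cons e l ih =>
    simp only [reverseAux]
    rw [← ih]
    congr 1
    simp only [shift, List.map_cons, List.cons.injEq, and_true, Prod.mk.injEq]
    ring

theorem reverse_add (hD : D.IsFlow) (T c : ℝ) (w : Path E M) :
    D.reverse rev (T + c) w =
      (D.flow c (D.reverse rev T w).1, shift c (D.reverse rev T w).2) :=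
  reverseAux_add hD T c (w.1, 0) [] w.2

/-- No time passes between an event at the horizon and the end, so its undoing is the very first
event of the reversed path. -/
theorem reverseAux_append_singleton (hD : D.IsFlow) (T : ℝ) (p : E × ℝ) (acc : List (ℝ × M'))
    (l : List (ℝ × M)) (u : M) :
    D.reverseAux rev T p acc (l ++ [(T, u)]) =
      (D.jump (D.reverseAux rev T p acc l).1 u,
        (0, rev (D.reverseAux rev T p acc l).1 u) :: (D.reverseAux rev T p acc l).2) := by
  induction l generalizing p acc with
  | nil => simp [reverseAux, step, hD.zero]
  | cons e l ih =>
    simp only [List.cons_append, reverseAux]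
    exact ih _ _

end Dynamics

namespace ReversiblePDMP

variable {E V Vr : Type*} [MeasureSpace E] [MeasureSpace V] [MeasureSpace Vr]
  {G : ReversiblePDMP E V Vr}

/-- The segment without its last event. -/
def dropRight (x : Segment E V) : Segment E V := ((x.1.1, x.1.2.dropLast), x.2)

/-- The segment, continued to the right without any event. -/
def extendRight (x : Segment E V) : Segment E V := (x.1, x.2 + 1)

/-- The segment without its event at time `0`. -/
noncomputable def dropLeft (G : ReversiblePDMP E V Vr) (x : Segment E V) : Segment E V :=
  ((G.stateIn x 0, x.1.2.tail), x.2)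

/-- The segment, continued to the left without any event. -/
def extendLeft (G : ReversiblePDMP E V Vr) (x : Segment E V) : Segment E V :=
  ((G.flow (-1) x.1.1, shift 1 x.1.2), x.2 + 1)

/-- The segment becomes invalid by its last event. -/
def StopsRight (C : G.StoppingCriterion) (x : Segment E V) : Prop :=
  dropRight x ∈ C.valid ∧ extendRight x ∉ C.valid

/-- The segment becomes invalid by its event at time `0`. -/
def StopsLeft (C : G.StoppingCriterion) (x : Segment E V) : Prop :=
  G.dropLeft x ∈ C.valid ∧ G.extendLeft x ∉ C.valid

section Ends

variable (z : E) (lb : List (ℝ × Vr)) (lf : List (ℝ × V)) (a b : ℝ)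

theorem extendRight_twoSided :
    extendRight (G.twoSided z lb lf a b) = G.twoSided z lb lf a (b + 1) := by
  simp [extendRight, twoSided, add_assoc]

theorem dropRight_twoSided (e : ℝ × V) :
    dropRight (G.twoSided z lb (lf ++ [e]) a b) = G.twoSided z lb lf a b := by
  simp only [dropRight, twoSided, NutsPDMP.shift, List.map_append, List.map_cons, List.map_nil,
    ← List.append_assoc, List.dropLast_concat]

theorem extendLeft_twoSided :
    G.extendLeft (G.twoSided z lb lf a b) = G.twoSided z lb lf (a + 1) b := by
  have h : G.Rinv (a + 1) (z, lb) =
      (G.flow (-1) (G.Rinv a (z, lb)).1, shift 1 (G.Rinv a (z, lb)).2) :=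
    Dynamics.reverse_add G.isFlow_bwd a 1 (z, lb)
  simp only [extendLeft, twoSided, h]
  simp only [NutsPDMP.shift, List.map_append, List.map_map, Prod.mk.injEq, true_and]
  refine ⟨?_, by ring⟩
  congr 2
  funext e
  simp [add_assoc]

variable {lb lf a}

/-- The jump at time 0 undoes the last backward jump, so the state right after it is the left end of
the segment with this backward event removed. -/
theorem dropLeft_twoSided (hb : Before a lb) (hf : After 0 lf) (ha : 0 ≤ a) (u : Vr) :
    G.dropLeft (G.twoSided z (lb ++ [(a, u)]) lf a b) = G.twoSided z lb lf a b := by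
  have h : G.Rinv a (z, lb ++ [(a, u)]) = (G.rjump (G.Rinv a (z, lb)).1 u,
      (0, G.rmark (G.Rinv a (z, lb)).1 u) :: (G.Rinv a (z, lb)).2) :=
    Dynamics.reverseAux_append_singleton G.isFlow_bwd a (z, 0) [] lb u
  have h1 : ∀ x ∈ (G.Rinv a (z, lb)).2, 0 < x.1 :=
    Dynamics.forall_mem_reverse (P := fun t => 0 < t).2 fun e he => sub_pos.2 (hb e he)
  have h2 : After 0 (shift a lf) := after_shift.2 (hf.mono (by linarith))
  have h3 : ((0, G.rmark (G.Rinv a (z, lb)).1 u) ::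
      ((G.Rinv a (z, lb)).2 ++ shift a lf)).filter (fun e => e.1 ≤ 0) =
      [(0, G.rmark (G.Rinv a (z, lb)).1 u)] := by
    rw [List.filter_cons_of_pos (by simp), List.filter_eq_nil_iff.2]
    intro e he
    rcases List.mem_append.1 he with he | he
    · simpa using h1 e he
    · simpa using h2 e he
  have h4 : G.stateIn (G.twoSided z (lb ++ [(a, u)]) lf a b) 0 = (G.Rinv a (z, lb)).1 := by
    simp only [stateIn, leftPart, twoSided, h, List.cons_append, h3]
    simp [Dynamics.stateAt, Dynamics.walk, Dynamics.step, fwd, G.flow_zero, G.jump_rmark]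
  simp only [dropLeft, h4]
  simp only [twoSided, h, List.cons_append, List.tail_cons]

end Ends

/-! ### Stopping of a run -/

/-- The properties that a run has almost surely. -/
structure IsRegularRun (C : G.StoppingCriterion) (ω : Run E V Vr) : Prop where
  fwd : IsEventSequence ω.1.2.1
  bwd : IsEventSequence ω.1.2.2
  pos : 0 < (ω.2 : ℝ)
  lt_one : (ω.2 : ℝ) < 1
  generic : ∀ j i e f, ω.1.2.1 j = some e → ω.1.2.2 i = some f →
    (ω.2 : ℝ) * e.1 ≠ (1 - (ω.2 : ℝ)) * f.1
  nonempty : (validTimes C ω).Nonempty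
  bddAbove : BddAbove (validTimes C ω)

namespace IsRegularRun

variable {C : G.StoppingCriterion} {ω : Run E V Vr} (h : IsRegularRun C ω)
include h

/-- Both ends of the window move outwards as the time grows, so consistency applies. The valid times
thus form an interval starting at 0, and `stopTime` is the point where validity is lost. -/
theorem mem_validTimes_of_le {s t : ℝ} (ht : t ∈ validTimes C ω) (hs : 0 ≤ s) (hst : s ≤ t) :
    s ∈ validTimes C ω := by
  have h1 : 0 ≤ 1 - (ω.2 : ℝ) := by linarith [h.lt_one]
  have := C.valid_mono (h.bwd.increasing_eventsUpTo _) (h.fwd.increasing_eventsUpTo _)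
    (h.bwd.after_eventsUpTo _) (h.fwd.after_eventsUpTo _)
    (fun e he => (h.bwd.mem_eventsUpTo.1 he).2) (fun e he => (h.fwd.mem_eventsUpTo.1 he).2)
    (mul_nonneg h.pos.le hs) (mul_nonneg h1 hs) (mul_le_mul_of_nonneg_left hst h.pos.le)
    (mul_le_mul_of_nonneg_left hst h1) ht.2
  rw [h.bwd.filter_eventsUpTo (mul_le_mul_of_nonneg_left hst h.pos.le),
    h.fwd.filter_eventsUpTo (mul_le_mul_of_nonneg_left hst h1)] at this
  exact ⟨hs, this⟩

theorem stopTime_nonneg : 0 ≤ stopTime C ω := by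
  obtain ⟨t, ht⟩ := h.nonempty
  exact ht.1.trans (le_csSup h.bddAbove ht)

theorem notMem_of_stopTime_lt {t : ℝ} (ht : stopTime C ω < t) : t ∉ validTimes C ω :=
  fun hm => (le_csSup h.bddAbove hm).not_gt ht

theorem mem_of_lt_stopTime {t : ℝ} (h0 : 0 ≤ t) (ht : t < stopTime C ω) : t ∈ validTimes C ω := by
  obtain ⟨s, hs, hts⟩ := exists_lt_of_lt_csSup h.nonempty ht
  exact h.mem_validTimes_of_le hs h0 hts.le

/-- Events are isolated, so just after `T` the lists are those at `T` and no end is an event. The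
ends `a`, `b` are left free: this allows comparison with a segment prolonged by a fixed length. -/
theorem exists_right {T : ℝ} (hT : 0 ≤ T) : ∃ δ > 0, ∀ t, T < t → t < T + δ →
    ∀ a b, 0 ≤ a → 0 ≤ b → Before a (eventsUpTo ω.1.2.2 (ω.2 * T)) →
      Before b (eventsUpTo ω.1.2.1 ((1 - ω.2) * T)) →
      (t ∈ validTimes C ω ↔ G.twoSided ω.1.1 (eventsUpTo ω.1.2.2 (ω.2 * T))
        (eventsUpTo ω.1.2.1 ((1 - ω.2) * T)) a b ∈ C.valid) := by
  have hp := h.pos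
  have hl := h.lt_one
  obtain ⟨δ₁, hδ₁, h₁, -⟩ := h.bwd.exists_eventsUpTo_eq (ω.2 * T)
  obtain ⟨δ₂, hδ₂, h₂, -⟩ := h.fwd.exists_eventsUpTo_eq ((1 - ω.2) * T)
  refine ⟨min δ₁ δ₂, lt_min hδ₁ hδ₂, fun t hTt htδ a b ha hb hba hbb => ?_⟩
  have e1 : t < T + δ₁ := htδ.trans_le (by gcongr; exact min_le_left _ _)
  have e2 : t < T + δ₂ := htδ.trans_le (by gcongr; exact min_le_right _ _)
  have m1 : (ω.2 : ℝ) * T < ω.2 * t := by nlinarith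
  have m2 : (1 - (ω.2 : ℝ)) * T < (1 - ω.2) * t := by nlinarith
  have g1 := h₁ (ω.2 * t) m1.le (by nlinarith)
  have g2 := h₂ ((1 - ω.2) * t) m2.le (by nlinarith)
  have ht0 : 0 ≤ t := hT.trans hTt.le
  have hv : t ∈ validTimes C ω ↔ G.twoSided ω.1.1 (eventsUpTo ω.1.2.2 (ω.2 * t))
        (eventsUpTo ω.1.2.1 ((1 - ω.2) * t)) (ω.2 * t) ((1 - ω.2) * t) ∈ C.valid :=
    ⟨fun hm => hm.2, fun hm => ⟨ht0, hm⟩⟩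
  rw [hv, g1, g2]
  exact C.valid_twoSided_iff (h.bwd.increasing_eventsUpTo _) (h.fwd.increasing_eventsUpTo _)
    (h.bwd.after_eventsUpTo _) (h.fwd.after_eventsUpTo _)
    (fun e he => (h.bwd.mem_eventsUpTo.1 he).2.trans_lt m1)
    (fun e he => (h.fwd.mem_eventsUpTo.1 he).2.trans_lt m2) hba hbb
    (by nlinarith) (by nlinarith) ha hb

theorem exists_left (T : ℝ) : ∃ δ > 0, ∀ t, 0 ≤ t → T - δ < t → t < T →
    ∀ a b, 0 ≤ a → 0 ≤ b →
      Before a ((eventsUpTo ω.1.2.2 (ω.2 * T)).filter fun e => e.1 < ω.2 * T) →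
      Before b ((eventsUpTo ω.1.2.1 ((1 - ω.2) * T)).filter fun e => e.1 < (1 - ω.2) * T) →
      (t ∈ validTimes C ω ↔ G.twoSided ω.1.1
        ((eventsUpTo ω.1.2.2 (ω.2 * T)).filter fun e => e.1 < ω.2 * T)
        ((eventsUpTo ω.1.2.1 ((1 - ω.2) * T)).filter fun e => e.1 < (1 - ω.2) * T)
          a b ∈ C.valid) := by
  have hp := h.pos
  have hl := h.lt_one
  obtain ⟨δ₁, hδ₁, -, h₁⟩ := h.bwd.exists_eventsUpTo_eq (ω.2 * T)
  obtain ⟨δ₂, hδ₂, -, h₂⟩ := h.fwd.exists_eventsUpTo_eq ((1 - ω.2) * T)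
  refine ⟨min δ₁ δ₂, lt_min hδ₁ hδ₂, fun t ht0 htδ hTt a b ha hb hba hbb => ?_⟩
  have e1 : T - δ₁ < t := lt_of_le_of_lt (by gcongr; exact min_le_left _ _) htδ
  have e2 : T - δ₂ < t := lt_of_le_of_lt (by gcongr; exact min_le_right _ _) htδ
  have m1 : (ω.2 : ℝ) * t < ω.2 * T := by nlinarith
  have m2 : (1 - (ω.2 : ℝ)) * t < (1 - ω.2) * T := by nlinarith
  obtain ⟨g1, b1⟩ := h₁ (ω.2 * t) (by nlinarith) m1
  obtain ⟨g2, b2⟩ := h₂ ((1 - ω.2) * t) (by nlinarith) m2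
  have hv : t ∈ validTimes C ω ↔ G.twoSided ω.1.1 (eventsUpTo ω.1.2.2 (ω.2 * t))
        (eventsUpTo ω.1.2.1 ((1 - ω.2) * t)) (ω.2 * t) ((1 - ω.2) * t) ∈ C.valid :=
    ⟨fun hm => hm.2, fun hm => ⟨ht0, hm⟩⟩
  rw [hv]
  rw [← g1] at hba ⊢
  rw [← g2] at hbb ⊢
  exact C.valid_twoSided_iff (h.bwd.increasing_eventsUpTo _) (h.fwd.increasing_eventsUpTo _)
    (h.bwd.after_eventsUpTo _) (h.fwd.after_eventsUpTo _) b1 b2 hba hbb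
    (by nlinarith) (by nlinarith) ha hb

/-- By consistency the degenerate segment at the origin is valid. It has no events, and neither have
short windows around it, so these are valid too. -/
theorem stopTime_pos : 0 < stopTime C ω := by
  refine lt_of_le_of_ne h.stopTime_nonneg fun h0 => ?_
  obtain ⟨δ, hδ, hr⟩ := h.exists_right le_rfl
  have hn : stopTime C ω < δ / 2 := by rw [← h0]; positivity
  refine h.notMem_of_stopTime_lt hn ((hr (δ / 2) (by positivity) (by linarith) (ω.2 * 0)
    ((1 - ω.2) * 0) (by simp) (by simp) ?_ ?_).2 ?_)
  · simp [h.bwd.eventsUpTo_zero, Before]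
  · simp [h.fwd.eventsUpTo_zero, Before]
  · obtain ⟨t, ht⟩ := h.nonempty
    exact (h.mem_validTimes_of_le ht le_rfl ht.1).2

/-- Validity just before and just after the stopping time. -/
theorem stop_spec {a b a' b' : ℝ} (ha : 0 ≤ a) (hb : 0 ≤ b) (ha' : 0 ≤ a') (hb' : 0 ≤ b')
    (h1 : Before a ((eventsUpTo ω.1.2.2 (ω.2 * stopTime C ω)).filter
      fun e => e.1 < ω.2 * stopTime C ω))
    (h2 : Before b ((eventsUpTo ω.1.2.1 ((1 - ω.2) * stopTime C ω)).filter
      fun e => e.1 < (1 - ω.2) * stopTime C ω))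
    (h3 : Before a' (eventsUpTo ω.1.2.2 (ω.2 * stopTime C ω)))
    (h4 : Before b' (eventsUpTo ω.1.2.1 ((1 - ω.2) * stopTime C ω))) :
    G.twoSided ω.1.1
        ((eventsUpTo ω.1.2.2 (ω.2 * stopTime C ω)).filter fun e => e.1 < ω.2 * stopTime C ω)
        ((eventsUpTo ω.1.2.1 ((1 - ω.2) * stopTime C ω)).filter
          fun e => e.1 < (1 - ω.2) * stopTime C ω) a b ∈ C.valid ∧
      G.twoSided ω.1.1 (eventsUpTo ω.1.2.2 (ω.2 * stopTime C ω))
        (eventsUpTo ω.1.2.1 ((1 - ω.2) * stopTime C ω)) a' b' ∉ C.valid := by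
  have h0 := h.stopTime_pos
  constructor
  · obtain ⟨δ, hδ, hl⟩ := h.exists_left (stopTime C ω)
    have e1 : max 0 (stopTime C ω - δ / 2) < stopTime C ω := max_lt h0 (by linarith)
    exact (hl _ (le_max_left _ _) (lt_of_lt_of_le (by linarith) (le_max_right _ _)) e1 a b ha hb
      h1 h2).1 (h.mem_of_lt_stopTime (le_max_left _ _) e1)
  · obtain ⟨δ, hδ, hr⟩ := h.exists_right h0.le
    rw [← hr (stopTime C ω + δ / 2) (by linarith) (by linarith) a' b' ha' hb' h3 h4]
    exact h.notMem_of_stopTime_lt (by linarith)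

/-- A time is the stopping time if validity changes there. -/
theorem stopTime_eq {T a b a' b' : ℝ} (hT : 0 < T) (ha : 0 ≤ a) (hb : 0 ≤ b) (ha' : 0 ≤ a')
    (hb' : 0 ≤ b')
    (h1 : Before a ((eventsUpTo ω.1.2.2 (ω.2 * T)).filter fun e => e.1 < ω.2 * T))
    (h2 : Before b ((eventsUpTo ω.1.2.1 ((1 - ω.2) * T)).filter fun e => e.1 < (1 - ω.2) * T))
    (h3 : Before a' (eventsUpTo ω.1.2.2 (ω.2 * T)))
    (h4 : Before b' (eventsUpTo ω.1.2.1 ((1 - ω.2) * T)))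
    (hv : G.twoSided ω.1.1 ((eventsUpTo ω.1.2.2 (ω.2 * T)).filter fun e => e.1 < ω.2 * T)
      ((eventsUpTo ω.1.2.1 ((1 - ω.2) * T)).filter fun e => e.1 < (1 - ω.2) * T) a b ∈ C.valid)
    (hn : G.twoSided ω.1.1 (eventsUpTo ω.1.2.2 (ω.2 * T))
      (eventsUpTo ω.1.2.1 ((1 - ω.2) * T)) a' b' ∉ C.valid) : stopTime C ω = T := by
  refine le_antisymm (le_of_forall_pos_lt_add fun ε hε => ?_) (le_of_forall_lt fun c hc => ?_)
  · by_contra hcon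
    obtain ⟨δ, hδ, hr⟩ := h.exists_right hT.le
    have hm : 0 < min ε δ := lt_min hε hδ
    have i1 := min_le_left ε δ
    have i2 := min_le_right ε δ
    refine hn ((hr (T + min ε δ / 2) (by linarith) (by linarith) a' b' ha' hb' h3 h4).1 ?_)
    exact h.mem_of_lt_stopTime (by linarith) (by linarith)
  · obtain ⟨δ, hδ, hl⟩ := h.exists_left T
    have e1 : max (max 0 c) (T - δ / 2) < T := max_lt (max_lt hT hc) (by linarith)
    have e0 : 0 ≤ max (max 0 c) (T - δ / 2) := (le_max_left 0 c).trans (le_max_left _ _)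
    obtain ⟨t, ht1, ht2⟩ := exists_between e1
    have hmem := (hl t (e0.trans ht1.le)
      (lt_of_lt_of_le (by linarith) ((le_max_right _ _).trans ht1.le)) ht2 a b ha hb h1 h2).2 hv
    exact (((le_max_right 0 c).trans (le_max_left _ _)).trans_lt ht1).trans_le
      (le_csSup h.bddAbove hmem)

theorem mem_stoppedBackward_iff : outX C ω ∈ stoppedBackward E V ↔
    ∃ e ∈ eventsUpTo ω.1.2.2 (ω.2 * stopTime C ω), e.1 = ω.2 * stopTime C ω :=
  hasEventAt_zero_twoSided (h.fwd.after_eventsUpTo _) (mul_nonneg h.pos.le h.stopTime_nonneg)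

theorem mem_stoppedForward_iff : outX C ω ∈ stoppedForward E V ↔
    ∃ e ∈ eventsUpTo ω.1.2.1 ((1 - ω.2) * stopTime C ω), e.1 = (1 - ω.2) * stopTime C ω :=
  hasEventAt_end_twoSided (h.bwd.after_eventsUpTo _)
    (mul_nonneg (by linarith [h.lt_one]) h.stopTime_nonneg)

theorem before_of_notMem_stoppedBackward (hb : outX C ω ∉ stoppedBackward E V) :
    Before (ω.2 * stopTime C ω) (eventsUpTo ω.1.2.2 (ω.2 * stopTime C ω)) := fun e he =>
  lt_of_le_of_ne (h.bwd.mem_eventsUpTo.1 he).2 fun h0 =>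
    hb (h.mem_stoppedBackward_iff.2 ⟨e, he, h0⟩)

theorem before_of_notMem_stoppedForward (hf : outX C ω ∉ stoppedForward E V) :
    Before ((1 - ω.2) * stopTime C ω) (eventsUpTo ω.1.2.1 ((1 - ω.2) * stopTime C ω)) :=
  fun e he => lt_of_le_of_ne (h.fwd.mem_eventsUpTo.1 he).2 fun h0 =>
    hf (h.mem_stoppedForward_iff.2 ⟨e, he, h0⟩)

/-- Events at both ends would contradict `generic`. With an event at neither end, the windows just
before and just after the stopping time have the same events, hence the same validity, which
contradicts `stop_spec`. -/
theorem stoppedForward_iff :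
    outX C ω ∈ stoppedForward E V ↔ outX C ω ∉ stoppedBackward E V := by
  constructor
  · intro hf hb
    obtain ⟨e, he, he'⟩ := h.mem_stoppedForward_iff.1 hf
    obtain ⟨f, hf, hf'⟩ := h.mem_stoppedBackward_iff.1 hb
    obtain ⟨⟨j, hj⟩, -⟩ := h.fwd.mem_eventsUpTo.1 he
    obtain ⟨⟨i, hi⟩, -⟩ := h.bwd.mem_eventsUpTo.1 hf
    refine h.generic j i e f hj hi ?_
    rw [he', hf']
    ring
  · intro hb
    by_contra hf
    have b1 := h.before_of_notMem_stoppedBackward hb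
    have b2 := h.before_of_notMem_stoppedForward hf
    have p1 := mul_nonneg h.pos.le h.stopTime_nonneg
    have p2 : 0 ≤ (1 - (ω.2 : ℝ)) * stopTime C ω :=
      mul_nonneg (by linarith [h.lt_one]) h.stopTime_nonneg
    obtain ⟨h1, h2⟩ := h.stop_spec p1 p2 p1 p2 (b1.filter _) (b2.filter _) b1 b2
    rw [filter_lt_of_before b1, filter_lt_of_before b2] at h1
    exact h2 h1

end IsRegularRun

end ReversiblePDMP

end NutsPDMP

/-! ### Runs classified by the event that stops them -/

namespace NutsPDMP

namespace ReversiblePDMP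

variable {E V Vr : Type*} [MeasureSpace E] [MeasureSpace V] [MeasureSpace Vr]
  {G : ReversiblePDMP E V Vr}

/-- The run is stopped by its `j`-th forward event, after `i` backward events. -/
structure ForwardStop (C : G.StoppingCriterion) (i j : ℕ) (ω : Run E V Vr) : Prop where
  length_fwd : (firstEvents ω.1.2.1 j).length = j
  pos : 0 < lastTime (firstEvents ω.1.2.1 j)
  length_bwd : (firstEvents ω.1.2.2 i).length = i
  next : ∀ e ∈ ω.1.2.2 i, ω.2 / (1 - ω.2) * lastTime (firstEvents ω.1.2.1 j) < e.1
  before : Before (ω.2 / (1 - ω.2) * lastTime (firstEvents ω.1.2.1 j)) (firstEvents ω.1.2.2 i)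
  stops : StopsRight C (G.twoSided ω.1.1 (firstEvents ω.1.2.2 i) (firstEvents ω.1.2.1 j)
    (ω.2 / (1 - ω.2) * lastTime (firstEvents ω.1.2.1 j)) (lastTime (firstEvents ω.1.2.1 j)))

/-- The run is stopped by its `i`-th backward event, after `j` forward events. -/
structure BackwardStop (C : G.StoppingCriterion) (i j : ℕ) (ω : Run E V Vr) : Prop where
  length_bwd : (firstEvents ω.1.2.2 i).length = i
  pos : 0 < lastTime (firstEvents ω.1.2.2 i)
  length_fwd : (firstEvents ω.1.2.1 j).length = j
  next : ∀ e ∈ ω.1.2.1 j, (1 - ω.2) / ω.2 * lastTime (firstEvents ω.1.2.2 i) < e.1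
  before : Before ((1 - ω.2) / ω.2 * lastTime (firstEvents ω.1.2.2 i)) (firstEvents ω.1.2.1 j)
  stops : StopsLeft C (G.twoSided ω.1.1 (firstEvents ω.1.2.2 i) (firstEvents ω.1.2.1 j)
    (lastTime (firstEvents ω.1.2.2 i)) ((1 - ω.2) / ω.2 * lastTime (firstEvents ω.1.2.2 i)))

theorem _root_.NutsPDMP.IsEventSequence.eventsUpTo_lastTime {M : Type*} [MeasurableSpace M]
    {N : ℕ → Option (ℝ × M)} (hN : IsEventSequence N) {n : ℕ}
    (hne : firstEvents N n ≠ []) :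
    eventsUpTo N (lastTime (firstEvents N n)) = firstEvents N n := by
  refine hN.eventsUpTo_eq_firstEvents (fun e he => le_lastTime (hN.increasing n) he) ?_
  intro e he
  obtain ⟨f, hf, hf'⟩ := exists_mem_eq_lastTime hne
  obtain ⟨k, hk, hkf⟩ := mem_firstEvents.1 hf
  rw [← hf']
  exact hN.lt_of_lt hkf he hk

theorem ne_nil_of_lastTime_pos {M : Type*} {l : List (ℝ × M)} (h : 0 < lastTime l) : l ≠ [] := by
  rintro rfl
  exact lt_irrefl _ h

theorem lastTime_eq_of_mem {M : Type*} {l : List (ℝ × M)} (hl : Increasing l) {t : ℝ}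
    (hle : ∀ e ∈ l, e.1 ≤ t) (hmem : ∃ e ∈ l, e.1 = t) : lastTime l = t := by
  obtain ⟨e, he, rfl⟩ := hmem
  obtain ⟨f, hf, hf'⟩ := exists_mem_eq_lastTime (List.ne_nil_of_mem he)
  exact le_antisymm (hf' ▸ hle f hf) (le_lastTime hl he)

theorem exists_append_of_ne_nil {M : Type*} {l : List (ℝ × M)} (h : l ≠ []) :
    ∃ l' e, l = l' ++ [e] ∧ lastTime l = e.1 := by
  rcases List.eq_nil_or_concat l with rfl | ⟨l', e, rfl⟩
  · exact absurd rfl h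
  · rw [List.concat_eq_append]
    exact ⟨l', e, rfl, lastTime_append_singleton l' e⟩

namespace IsRegularRun

variable {C : G.StoppingCriterion} {ω : Run E V Vr} (h : IsRegularRun C ω)
include h

theorem exists_forwardStop (hf : outX C ω ∈ stoppedForward E V) : ∃ i j, ForwardStop C i j ω := by
  have h1 : 0 < 1 - (ω.2 : ℝ) := by linarith [h.lt_one]
  obtain ⟨j, hj, hjl, hj1, hj2⟩ := h.fwd.eventsUpTo_spec ((1 - ω.2) * stopTime C ω)
  obtain ⟨i, hi, hil, hi1, hi2⟩ := h.bwd.eventsUpTo_spec (ω.2 * stopTime C ω)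
  have hmem := h.mem_stoppedForward_iff.1 hf
  have hb := h.before_of_notMem_stoppedBackward (h.stoppedForward_iff.1 hf)
  have p1 := mul_nonneg h.pos.le h.stopTime_nonneg
  have p2 := mul_nonneg h1.le h.stopTime_nonneg
  have hs := fun a' b' ha' hb' h3 h4 => h.stop_spec p1 p2 (a' := a') (b' := b') ha' hb'
    (hb.filter _) (before_filter_lt _ _) h3 h4
  rw [filter_lt_of_before hb] at hs
  rw [hj] at hmem hs
  rw [hi] at hb hs
  have hlast := lastTime_eq_of_mem (h.fwd.increasing j) hj1 hmem
  obtain ⟨e, he, -⟩ := hmem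
  have hne : firstEvents ω.1.2.1 j ≠ [] := List.ne_nil_of_mem he
  -- The stopping event sits at $(1-\alpha)T$, so the left end $\alpha T$ is $\alpha/(1-\alpha)$
  -- times its time.
  have ha : (ω.2 : ℝ) / (1 - ω.2) * lastTime (firstEvents ω.1.2.1 j) = ω.2 * stopTime C ω := by
    rw [hlast]
    field_simp
  have hle := h.fwd.increasing j
  obtain ⟨l, e, hl, hle'⟩ := exists_append_of_ne_nil hne
  refine ⟨i, j, hjl, hlast ▸ mul_pos h1 h.stopTime_pos, hil, ?_, ?_, ?_⟩
  · rwa [ha]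
  · rwa [ha]
  · rw [ha, hlast]
    constructor
    · have := (hs (ω.2 * stopTime C ω) ((1 - ω.2) * stopTime C ω + 1) p1 (by linarith) hb
        fun e he => (hj1 e he).trans_lt (by linarith)).1
      rw [hl] at hlast hle this ⊢
      rw [lastTime_append_singleton] at hlast
      rw [dropRight_twoSided]
      rwa [← hlast, filter_lt_append_singleton hle, hlast] at this
    · rw [extendRight_twoSided]
      exact (hs (ω.2 * stopTime C ω) ((1 - ω.2) * stopTime C ω + 1) p1 (by linarith) hb
        fun e he => (hj1 e he).trans_lt (by linarith)).2

/-- Validity with the last event removed and invalidity after prolongation pin down the stopping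
time through `stopTime_eq`. The two lengths recover `i` and `j` from the run, so different pairs of
indices exclude each other. -/
theorem forwardStop_spec {i j : ℕ} (hs : ForwardStop C i j ω) :
    outX C ω ∈ stoppedForward E V ∧
      outL C ω = ω.2 / (1 - ω.2) * lastTime (firstEvents ω.1.2.1 j) ∧
      outX C ω = G.twoSided ω.1.1 (firstEvents ω.1.2.2 i) (firstEvents ω.1.2.1 j)
        (ω.2 / (1 - ω.2) * lastTime (firstEvents ω.1.2.1 j))
        (lastTime (firstEvents ω.1.2.1 j)) ∧
      (eventsUpTo ω.1.2.2 (ω.2 * stopTime C ω)).length = i ∧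
      (eventsUpTo ω.1.2.1 ((1 - ω.2) * stopTime C ω)).length = j := by
  have h1 : 0 < 1 - (ω.2 : ℝ) := by linarith [h.lt_one]
  have hfu := h.fwd.eventsUpTo_lastTime (ne_nil_of_lastTime_pos hs.pos)
  have hb := hs.before
  have hbu := h.bwd.eventsUpTo_eq_firstEvents (fun e he => (hb e he).le) hs.next
  obtain ⟨st1, st2⟩ := hs.stops
  have hb0 := hs.pos
  have hle := h.fwd.increasing j
  obtain ⟨l, e, hl, hle'⟩ := exists_append_of_ne_nil (ne_nil_of_lastTime_pos hs.pos)
  set b := lastTime (firstEvents ω.1.2.1 j) with hbdef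
  have e1 : (ω.2 : ℝ) * (b / (1 - ω.2)) = ω.2 / (1 - ω.2) * b := by ring
  have e2 : (1 - (ω.2 : ℝ)) * (b / (1 - ω.2)) = b := mul_div_cancel₀ _ h1.ne'
  have a0 : 0 ≤ (ω.2 : ℝ) / (1 - ω.2) * b := mul_nonneg (div_nonneg h.pos.le h1.le) hb0.le
  have hbefore1 : Before (b + 1) (firstEvents ω.1.2.1 j) := fun e he =>
    (le_lastTime hle he).trans_lt (by linarith)
  have hT : stopTime C ω = b / (1 - ω.2) := by
    refine h.stopTime_eq (a := ω.2 / (1 - ω.2) * b) (b := b) (a' := ω.2 / (1 - ω.2) * b)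
      (b' := b + 1) (div_pos hb0 h1) a0 hb0.le a0 (by linarith) ?_ ?_ ?_ ?_ ?_ ?_
    · rw [e1, hbu]; exact hb.filter _
    · rw [e2]; exact before_filter_lt _ _
    · rwa [e1, hbu]
    · rwa [e2, hfu]
    · rw [e1, e2, hbu, hfu, filter_lt_of_before hb]
      rw [hl] at st1 hle ⊢
      rw [dropRight_twoSided] at st1
      rw [hle', filter_lt_append_singleton hle, ← hle']
      exact st1
    · rw [e1, e2, hbu, hfu]
      rwa [extendRight_twoSided] at st2
  rw [← hT] at e1 e2
  refine ⟨?_, e1, ?_, ?_, ?_⟩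
  · rw [h.mem_stoppedForward_iff, e2, hfu]
    exact exists_mem_eq_lastTime (ne_nil_of_lastTime_pos hs.pos)
  · change G.twoSided _ _ _ _ _ = _
    rw [e1, e2, hbu, hfu]
  · rw [e1, hbu, hs.length_bwd]
  · rw [e2, hfu, hs.length_fwd]

theorem exists_backwardStop (hf : outX C ω ∈ stoppedBackward E V) :
    ∃ i j, BackwardStop C i j ω := by
  have h1 : 0 < 1 - (ω.2 : ℝ) := by linarith [h.lt_one]
  have hpos := h.pos
  obtain ⟨j, hj, hjl, hj1, hj2⟩ := h.fwd.eventsUpTo_spec ((1 - ω.2) * stopTime C ω)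
  obtain ⟨i, hi, hil, hi1, hi2⟩ := h.bwd.eventsUpTo_spec (ω.2 * stopTime C ω)
  have hmem := h.mem_stoppedBackward_iff.1 hf
  have hb := h.before_of_notMem_stoppedForward fun hf' => h.stoppedForward_iff.1 hf' hf
  have p1 := mul_nonneg h.pos.le h.stopTime_nonneg
  have p2 := mul_nonneg h1.le h.stopTime_nonneg
  have hs := fun a' b' ha' hb' h3 h4 => h.stop_spec p1 p2 (a' := a') (b' := b') ha' hb'
    (before_filter_lt _ _) (hb.filter _) h3 h4
  rw [filter_lt_of_before hb] at hs
  rw [hi] at hmem hs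
  rw [hj] at hb hs
  have hlast := lastTime_eq_of_mem (h.bwd.increasing i) hi1 hmem
  obtain ⟨e, he, -⟩ := hmem
  have hne : firstEvents ω.1.2.2 i ≠ [] := List.ne_nil_of_mem he
  have ha : (1 - (ω.2 : ℝ)) / ω.2 * lastTime (firstEvents ω.1.2.2 i) =
      (1 - ω.2) * stopTime C ω := by
    rw [hlast]
    field_simp
  have hle := h.bwd.increasing i
  obtain ⟨l, e, hl, hle'⟩ := exists_append_of_ne_nil hne
  refine ⟨i, j, hil, hlast ▸ mul_pos h.pos h.stopTime_pos, hjl, ?_, ?_, ?_⟩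
  · rwa [ha]
  · rwa [ha]
  · rw [ha, hlast]
    have hs' := hs (ω.2 * stopTime C ω + 1) ((1 - ω.2) * stopTime C ω) (by linarith) p2
      (fun e he => (hi1 e he).trans_lt (by linarith)) hb
    constructor
    · have := hs'.1
      rw [hl] at hlast hle this ⊢
      rw [lastTime_append_singleton] at hlast
      obtain ⟨t, u⟩ := e
      simp only at hlast
      subst hlast
      rw [filter_lt_append_singleton hle] at this
      rwa [dropLeft_twoSided _ _ (increasing_append_singleton.1 hle).2 (h.fwd.after j) p1]
    · rw [extendLeft_twoSided]
      exact hs'.2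

theorem backwardStop_spec {i j : ℕ} (hs : BackwardStop C i j ω) :
    outX C ω ∈ stoppedBackward E V ∧
      outL C ω = lastTime (firstEvents ω.1.2.2 i) ∧
      outX C ω = G.twoSided ω.1.1 (firstEvents ω.1.2.2 i) (firstEvents ω.1.2.1 j)
        (lastTime (firstEvents ω.1.2.2 i))
        ((1 - ω.2) / ω.2 * lastTime (firstEvents ω.1.2.2 i)) ∧
      (eventsUpTo ω.1.2.2 (ω.2 * stopTime C ω)).length = i ∧
      (eventsUpTo ω.1.2.1 ((1 - ω.2) * stopTime C ω)).length = j := by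
  have h1 : 0 < 1 - (ω.2 : ℝ) := by linarith [h.lt_one]
  have hpos := h.pos
  have hfu := h.bwd.eventsUpTo_lastTime (ne_nil_of_lastTime_pos hs.pos)
  have hb := hs.before
  have hbu := h.fwd.eventsUpTo_eq_firstEvents (fun e he => (hb e he).le) hs.next
  obtain ⟨st1, st2⟩ := hs.stops
  have hb0 := hs.pos
  have hle := h.bwd.increasing i
  obtain ⟨l, e, hl, hle'⟩ := exists_append_of_ne_nil (ne_nil_of_lastTime_pos hs.pos)
  set a := lastTime (firstEvents ω.1.2.2 i) with hadef
  have e1 : (ω.2 : ℝ) * (a / ω.2) = a := mul_div_cancel₀ _ hpos.ne'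
  have e2 : (1 - (ω.2 : ℝ)) * (a / ω.2) = (1 - ω.2) / ω.2 * a := by ring
  have a0 : 0 ≤ (1 - (ω.2 : ℝ)) / ω.2 * a := mul_nonneg (div_nonneg h1.le hpos.le) hb0.le
  have hbefore1 : Before (a + 1) (firstEvents ω.1.2.2 i) := fun e he =>
    (le_lastTime hle he).trans_lt (by linarith)
  have hT : stopTime C ω = a / ω.2 := by
    refine h.stopTime_eq (a := a) (b := (1 - ω.2) / ω.2 * a) (a' := a + 1)
      (b' := (1 - ω.2) / ω.2 * a) (div_pos hb0 hpos) hb0.le a0 (by linarith) a0 ?_ ?_ ?_ ?_ ?_ ?_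
    · rw [e1]; exact before_filter_lt _ _
    · rw [e2, hbu]; exact hb.filter _
    · rwa [e1, hfu]
    · rwa [e2, hbu]
    · rw [e1, e2, hbu, hfu, filter_lt_of_before hb]
      -- The last backward event is destructured, so that its time can be identified with the left
      -- end and the event at time 0 of the segment removed.
      have ha := hb0.le
      rw [hl] at st1 hle ⊢
      obtain ⟨t, u⟩ := e
      simp only at hle'
      rw [hle'] at st1 ha ⊢
      rw [filter_lt_append_singleton hle]
      rwa [dropLeft_twoSided _ _ (increasing_append_singleton.1 hle).2 (h.fwd.after j) ha] at st1
    · rw [e1, e2, hbu, hfu]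
      rwa [extendLeft_twoSided] at st2
  rw [← hT] at e1 e2
  refine ⟨?_, e1, ?_, ?_, ?_⟩
  · rw [h.mem_stoppedBackward_iff, e1, hfu]
    exact exists_mem_eq_lastTime (ne_nil_of_lastTime_pos hs.pos)
  · change G.twoSided _ _ _ _ _ = _
    rw [e1, e2, hbu, hfu]
  · rw [e1, hfu, hs.length_bwd]
  · rw [e2, hbu, hs.length_fwd]

end IsRegularRun

end ReversiblePDMP

end NutsPDMP

namespace NutsPDMP

/-! ### Almost sure properties of runs -/

section

variable {M : Type*}

theorem length_firstEvents_of_forall {N : ℕ → Option (ℝ × M)} {n : ℕ}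
    (h : ∀ k < n, ∃ e, N k = some e) : (firstEvents N n).length = n := by
  induction n with
  | zero => rfl
  | succ n ih =>
    exact length_firstEvents_succ_iff.2
      ⟨ih fun k hk => h k (hk.trans n.lt_succ_self), h n n.lt_succ_self⟩

/-- Once `none` appears nothing follows, so every initial piece is a complete one for a possibly
smaller index. Laws are available only for complete pieces. -/
theorem exists_firstEvents_eq {N : ℕ → Option (ℝ × M)}
    (h : ∀ n, N n = none → N (n + 1) = none) (n : ℕ) :
    ∃ m, firstEvents N n = firstEvents N m ∧ (firstEvents N m).length = m := by
  induction n with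
  | zero => exact ⟨0, rfl, rfl⟩
  | succ n ih =>
    cases hn : N n with
    | none =>
      obtain ⟨m, h1, h2⟩ := ih
      exact ⟨m, by rw [firstEvents_succ, hn, h1]; simp, h2⟩
    | some e =>
      refine ⟨n + 1, rfl, length_firstEvents_of_forall fun k hk => ?_⟩
      cases hk' : N k with
      | some e => exact ⟨e, rfl⟩
      | none =>
        have : ∀ j, k ≤ j → N j = none := fun j hj => by
          induction j, hj using Nat.le_induction with
          | base => exact hk'
          | succ j _ ih => exact h j ih
        rw [this n (Nat.lt_succ_iff.1 hk)] at hn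
        cases hn

set_option linter.unusedSectionVars false

variable [MeasureSpace M] [SigmaFinite (volume : Measure M)]

theorem measurableSet_after_firstEvents (n : ℕ) :
    MeasurableSet {N : ℕ → Option (ℝ × M) | Increasing (firstEvents N n) ∧
      After 0 (firstEvents N n)} :=
  (measurable_firstEvents n measurableSet_increasing).inter (measurableSet_setOfPred.2
    (Measurable.after measurable_const (measurable_firstEvents n)))

theorem measurableSet_eq_none (n : ℕ) :
    MeasurableSet {N : ℕ → Option (ℝ × M) | N n = none} := by
  have h := (measurable_pi_apply (X := fun _ : ℕ => Option (ℝ × M)) n)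
    (measurableSet_ne_none (M := M)).compl
  convert h using 1
  ext N
  simp

theorem measurableSet_none_none (n : ℕ) :
    MeasurableSet {N : ℕ → Option (ℝ × M) | N n = none → N (n + 1) = none} := by
  convert (measurableSet_eq_none n).compl.union (measurableSet_eq_none (M := M) (n + 1)) using 1
  ext N
  simp [imp_iff_not_or]

variable {E : Type*} [MeasurableSpace E] {D : Dynamics E M} {L : Rate E M} {K : Kernel E (ℕ → Option (ℝ × M))}

theorem IsEventLaw.ae_firstEvents [IsMarkovKernel K] (hK : IsEventLaw D L K)
    (hD : D.IsMeasurable) (z : E) (n : ℕ) :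
    ∀ᵐ N ∂K z, (firstEvents N n).length = n →
      Increasing (firstEvents N n) ∧ After 0 (firstEvents N n) := by
  have hs : MeasurableSet {l : List (ℝ × M) | ¬ (Increasing l ∧ After 0 l)} :=
    (measurableSet_increasing.inter (measurableSet_setOfPred.2
      (Measurable.after measurable_const measurable_id))).compl
  have h := hK.lintegral_firstEvents hD z n (F := fun l => ind (¬ (Increasing l ∧ After 0 l)))
    (measurable_ind hs)
  have h0 : ∫⁻ l, ind (∀ x ∈ l, 0 < x.1) * (eventDensity D L z l *
      ind (¬ (Increasing l ∧ After 0 l))) ∂orderedMeasure M n = 0 := by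
    refine (lintegral_congr_ae ?_).trans lintegral_zero
    filter_upwards [ae_increasing_orderedMeasure n] with l hl
    by_cases h : ∀ x ∈ l, 0 < x.1
    · rw [ind_neg (p := ¬ _) (not_not.2 ⟨hl, h⟩), mul_zero, mul_zero]
    · rw [ind_neg h, zero_mul]
  have hm : Measurable fun N : ℕ → Option (ℝ × M) => ind ((firstEvents N n).length = n) *
      ind (¬ (Increasing (firstEvents N n) ∧ After 0 (firstEvents N n))) :=
    (measurable_ind (measurableSet_length n)).mul
      (measurable_ind (measurableSet_after_firstEvents n).compl)
  rw [h0] at h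
  replace h := (lintegral_eq_zero_iff hm).1 h
  filter_upwards [h] with N hN hlen
  by_contra hcon
  have h' : ind _ * ind _ = (0 : ℝ≥0∞) := hN
  rw [ind_pos hlen, ind_pos hcon, one_mul] at h'
  exact one_ne_zero h'

theorem IsEventLaw.ae_none_none (hK : IsEventLaw D L K) (z : E) :
    ∀ᵐ N ∂K z, ∀ n, N n = none → N (n + 1) = none :=
  ae_all_iff.2 fun n => hK.none_none z n

theorem IsEventLaw.ae_increasing [IsMarkovKernel K] (hK : IsEventLaw D L K)
    (hD : D.IsMeasurable) (z : E) (n : ℕ) :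
    ∀ᵐ N ∂K z, Increasing (firstEvents N n) ∧ After 0 (firstEvents N n) := by
  filter_upwards [hK.ae_none_none z, ae_all_iff.2 fun m => hK.ae_firstEvents hD z m]
    with N h1 h2
  obtain ⟨m, hm, hl⟩ := exists_firstEvents_eq h1 n
  rw [hm]
  exact h2 m hl

end

namespace ReversiblePDMP

variable {E V Vr : Type*} [MeasureSpace E] [MeasureSpace V] [MeasureSpace Vr]
  [SigmaFinite (volume : Measure E)] [SigmaFinite (volume : Measure V)]
  [SigmaFinite (volume : Measure Vr)] {G : ReversiblePDMP E V Vr}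
  {π : E → ℝ≥0∞} [IsProbabilityMeasure ((volume : Measure E).withDensity π)]
  {Kf : Kernel E (ℕ → Option (ℝ × V))} [IsMarkovKernel Kf]
  {Kb : Kernel E (ℕ → Option (ℝ × Vr))} [IsMarkovKernel Kb]

set_option linter.unusedSectionVars false

theorem ae_runLaw_fwd {p : (ℕ → Option (ℝ × V)) → Prop} (hp : MeasurableSet {N | p N})
    (h : ∀ z, ∀ᵐ N ∂Kf z, p N) : ∀ᵐ ω ∂runLaw π Kf Kb, p ω.1.2.1 := by
  unfold runLaw
  refine Measure.quasiMeasurePreserving_fst.ae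
    (p := fun q : E × ((ℕ → Option (ℝ × V)) × (ℕ → Option (ℝ × Vr))) => p q.2.1) ?_
  refine Measure.ae_compProd_of_ae_ae
    (p := fun q : E × ((ℕ → Option (ℝ × V)) × (ℕ → Option (ℝ × Vr))) => p q.2.1)
    (hp.preimage measurable_snd.fst) (Filter.Eventually.of_forall fun z => ?_)
  rw [Kernel.prod_apply]
  exact Measure.quasiMeasurePreserving_fst.ae (h z)

theorem ae_runLaw_bwd {p : (ℕ → Option (ℝ × Vr)) → Prop} (hp : MeasurableSet {N | p N})
    (h : ∀ z, ∀ᵐ N ∂Kb z, p N) : ∀ᵐ ω ∂runLaw π Kf Kb, p ω.1.2.2 := by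
  unfold runLaw
  refine Measure.quasiMeasurePreserving_fst.ae
    (p := fun q : E × ((ℕ → Option (ℝ × V)) × (ℕ → Option (ℝ × Vr))) => p q.2.2) ?_
  refine Measure.ae_compProd_of_ae_ae
    (p := fun q : E × ((ℕ → Option (ℝ × V)) × (ℕ → Option (ℝ × Vr))) => p q.2.2)
    (hp.preimage measurable_snd.snd) (Filter.Eventually.of_forall fun z => ?_)
  rw [Kernel.prod_apply]
  exact Measure.quasiMeasurePreserving_snd.ae (h z)

theorem ae_runLaw_alpha {p : unitInterval → Prop} (h : ∀ᵐ α ∂(volume : Measure unitInterval), p α) :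
    ∀ᵐ ω ∂runLaw π Kf Kb, p ω.2 :=
  Measure.quasiMeasurePreserving_snd.ae h

/-- For a given pair of positive event times, the equation is satisfied by at most one value of the
independent continuous variable $\alpha$, and the pairs are finitely many. -/
theorem ae_runLaw_generic (j i : ℕ) : ∀ᵐ ω ∂runLaw π Kf Kb,
    ∀ e ∈ firstEvents ω.1.2.1 j, ∀ f ∈ firstEvents ω.1.2.2 i, 0 < e.1 → 0 < f.1 →
      (ω.2 : ℝ) * e.1 ≠ (1 - (ω.2 : ℝ)) * f.1 := by
  unfold runLaw
  have h1 : Measurable fun ω : Run E V Vr => firstEvents ω.1.2.1 j :=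
    (measurable_firstEvents j).comp measurable_fst.snd.fst
  have h2 : Measurable fun ω : Run E V Vr × (ℝ × V) => firstEvents ω.1.1.2.2 i :=
    (measurable_firstEvents i).comp measurable_fst.fst.snd.snd
  refine (Measure.ae_prod_iff_ae_ae ?_).2 (Filter.Eventually.of_forall fun q => ?_)
  · refine measurableSet_forall_mem h1 (measurableSet_forall_mem h2 ?_)
    have hα : Measurable fun q : (Run E V Vr × (ℝ × V)) × (ℝ × Vr) => (q.1.1.2 : ℝ) :=
      measurable_subtype_coe.comp measurable_fst.fst.snd
    have hm : MeasurableSet {q : (Run E V Vr × (ℝ × V)) × (ℝ × Vr) |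
        ¬ (0 < q.1.2.1 ∧ 0 < q.2.1 ∧
          (q.1.1.2 : ℝ) * q.1.2.1 = (1 - (q.1.1.2 : ℝ)) * q.2.1)} := by
      refine MeasurableSet.compl ?_
      refine (measurableSet_lt measurable_const measurable_fst.snd.fst).inter
        ((measurableSet_lt measurable_const measurable_snd.fst).inter (measurableSet_eq_fun ?_ ?_))
      · exact hα.mul measurable_fst.snd.fst
      · exact (measurable_const.sub hα).mul measurable_snd.fst
    simpa only [not_and, ne_eq] using hm
  · have hl : ∀ (l : List (ℝ × V)) (l' : List (ℝ × Vr)), ∀ᵐ α : unitInterval ∂volume,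
        ∀ e ∈ l, ∀ f ∈ l', 0 < e.1 → 0 < f.1 → (α : ℝ) * e.1 ≠ (1 - (α : ℝ)) * f.1 := by
      intro l l'
      have : ∀ e : ℝ × V, ∀ f : ℝ × Vr, ∀ᵐ α : unitInterval ∂volume,
          0 < e.1 → 0 < f.1 → (α : ℝ) * e.1 ≠ (1 - (α : ℝ)) * f.1 := by
        intro e f
        rw [ae_iff]
        refine (Set.Subsingleton.measure_zero ?_ _)
        intro α hα β hβ
        simp only [mem_ofPred_eq, not_forall, not_not, exists_prop] at hα hβ
        obtain ⟨he, hf, h1⟩ := hα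
        obtain ⟨-, -, h2⟩ := hβ
        refine Subtype.ext ?_
        have h3 : ((α : ℝ) - β) * (e.1 + f.1) = 0 := by linarith
        rcases mul_eq_zero.1 h3 with h4 | h4
        · linarith
        · linarith
      have h' : ∀ e : ℝ × V, ∀ᵐ α : unitInterval ∂volume, ∀ f ∈ l',
          0 < e.1 → 0 < f.1 → (α : ℝ) * e.1 ≠ (1 - (α : ℝ)) * f.1 := by
        intro e
        induction l' with
        | nil => simp
        | cons f l' ih =>
          filter_upwards [ih, this e f] with α h1 h2 g hg
          rcases List.mem_cons.1 hg with rfl | hg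
          · exact h2
          · exact h1 g hg
      induction l with
      | nil => simp
      | cons e l ih =>
        filter_upwards [ih, h' e] with α h1 h2 g hg
        rcases List.mem_cons.1 hg with rfl | hg
        · exact h2
        · exact h1 g hg
    exact hl (firstEvents q.2.1 j) (firstEvents q.2.2 i)

theorem ae_isRegularRun {Lf : Rate E V} {Lb : Rate E Vr} (hKf : IsEventLaw G.fwd Lf Kf)
    (hKb : IsEventLaw G.bwd Lb Kb) {C : G.StoppingCriterion}
    (hexpl : ∀ᵐ ω ∂(runLaw π Kf Kb), NonExplosive ω.1.2.1 ∧ NonExplosive ω.1.2.2)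
    (hterm : ∀ᵐ ω ∂(runLaw π Kf Kb), (validTimes C ω).Nonempty ∧ BddAbove (validTimes C ω)) :
    ∀ᵐ ω ∂runLaw π Kf Kb, IsRegularRun C ω := by
  have h0 : ∀ᵐ ω ∂runLaw π Kf Kb, ω.2 ≠ 0 := ae_runLaw_alpha (Measure.ae_ne _ _)
  have h1 : ∀ᵐ ω ∂runLaw π Kf Kb, ω.2 ≠ 1 := ae_runLaw_alpha (Measure.ae_ne _ _)
  have hf := ae_all_iff.2 fun n => ae_runLaw_fwd (π := π) (Kb := Kb)
    (measurableSet_after_firstEvents n) fun z => hKf.ae_increasing G.isMeasurable_fwd z n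
  have hb := ae_all_iff.2 fun n => ae_runLaw_bwd (π := π) (Kf := Kf)
    (measurableSet_after_firstEvents n) fun z => hKb.ae_increasing G.isMeasurable_bwd z n
  have hf' := ae_all_iff.2 fun n => ae_runLaw_fwd (π := π) (Kb := Kb)
    (measurableSet_none_none n) fun z => hKf.none_none z n
  have hb' := ae_all_iff.2 fun n => ae_runLaw_bwd (π := π) (Kf := Kf)
    (measurableSet_none_none n) fun z => hKb.none_none z n
  have hg := ae_all_iff.2 fun j => ae_all_iff.2 fun i =>
    ae_runLaw_generic (π := π) (Kf := Kf) (Kb := Kb) j i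
  filter_upwards [h0, h1, hf, hb, hf', hb', hg, hexpl, hterm]
    with ω h0 h1 hf hb hf' hb' hg hexpl hterm
  have sf : IsEventSequence ω.1.2.1 := ⟨hf', fun n => (hf n).1, fun n => (hf n).2, hexpl.1⟩
  have sb : IsEventSequence ω.1.2.2 := ⟨hb', fun n => (hb n).1, fun n => (hb n).2, hexpl.2⟩
  refine ⟨sf, sb, unitInterval.pos_iff_ne_zero.2 h0, unitInterval.lt_one_iff_ne_one.2 h1,
    fun j i e f he hf => ?_, hterm.1, hterm.2⟩
  exact hg (j + 1) (i + 1) e (mem_firstEvents.2 ⟨j, j.lt_succ_self, he⟩) f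
    (mem_firstEvents.2 ⟨i, i.lt_succ_self, hf⟩) (sf.pos he) (sb.pos hf)

/-! ### Measurability of the output -/

variable {β : Type*} [MeasurableSpace β]

@[fun_prop]
theorem _root_.Measurable.twoSided {z : β → E} {lb : β → List (ℝ × Vr)} {lf : β → List (ℝ × V)}
    {a b : β → ℝ} (hz : Measurable z) (hlb : Measurable lb) (hlf : Measurable lf)
    (ha : Measurable a) (hb : Measurable b) :
    Measurable fun x => G.twoSided (z x) (lb x) (lf x) (a x) (b x) := by
  simp only [ReversiblePDMP.twoSided]
  fun_prop

@[fun_prop]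
theorem _root_.Measurable.firstEvents {M : Type*} [MeasurableSpace M]
    {N : β → ℕ → Option (ℝ × M)} (hN : Measurable N) (n : ℕ) :
    Measurable fun x => firstEvents (N x) n := (measurable_firstEvents n).comp hN

theorem measurable_stateAt_fwd {t : β → ℝ} {w : β → Path E V} (ht : Measurable t)
    (hw : Measurable w) : Measurable fun x => G.fwd.stateAt (t x) (w x) :=
  G.isMeasurable_fwd.stateAt.comp (ht.prodMk hw)

theorem measurable_leftPart {x : β → Segment E V} {l : β → ℝ} (hx : Measurable x)
    (hl : Measurable l) : Measurable fun b => leftPart (x b) (l b) :=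
  hx.fst.fst.prodMk (Measurable.listFilter hx.fst.snd (by
    simpa only [decide_eq_true_eq] using
      measurableSet_le (f := fun p : β × (ℝ × V) => p.2.1) (g := fun p => l p.1)
        measurable_snd.fst (hl.comp measurable_fst)))

theorem measurable_stateIn {x : β → Segment E V} {l : β → ℝ} (hx : Measurable x)
    (hl : Measurable l) : Measurable fun b => G.stateIn (x b) (l b) :=
  measurable_stateAt_fwd hl (measurable_leftPart hx hl)

theorem measurableSet_stopsRight (C : G.StoppingCriterion) :
    MeasurableSet {x : Segment E V | StopsRight C x} := by
  have h1 : Measurable (dropRight : Segment E V → Segment E V) := by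
    unfold dropRight
    fun_prop
  have h2 : Measurable (extendRight : Segment E V → Segment E V) := by
    unfold extendRight
    fun_prop
  exact (h1 C.measurableSet_valid).inter (h2 C.measurableSet_valid).compl

theorem measurableSet_stopsLeft (C : G.StoppingCriterion) :
    MeasurableSet {x : Segment E V | StopsLeft C x} := by
  have h1 : Measurable G.dropLeft := by
    unfold dropLeft
    have : Measurable fun x : Segment E V => G.stateIn x 0 :=
      measurable_stateIn measurable_id measurable_const
    fun_prop
  have h2 : Measurable G.extendLeft := by
    unfold extendLeft
    fun_prop
  exact (h1 C.measurableSet_valid).inter (h2 C.measurableSet_valid).compl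

/-- The output of a run that is stopped by its `j`-th forward event after `i` backward events. -/
noncomputable def forwardOutput (G : ReversiblePDMP E V Vr) (i j : ℕ) (ω : Run E V Vr) :
    Segment E V × ℝ :=
  (G.twoSided ω.1.1 (firstEvents ω.1.2.2 i) (firstEvents ω.1.2.1 j)
    (ω.2 / (1 - ω.2) * lastTime (firstEvents ω.1.2.1 j)) (lastTime (firstEvents ω.1.2.1 j)),
    ω.2 / (1 - ω.2) * lastTime (firstEvents ω.1.2.1 j))

/-- The output of a run that is stopped by its `i`-th backward event after `j` forward events. -/
noncomputable def backwardOutput (G : ReversiblePDMP E V Vr) (i j : ℕ) (ω : Run E V Vr) :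
    Segment E V × ℝ :=
  (G.twoSided ω.1.1 (firstEvents ω.1.2.2 i) (firstEvents ω.1.2.1 j)
    (lastTime (firstEvents ω.1.2.2 i)) ((1 - ω.2) / ω.2 * lastTime (firstEvents ω.1.2.2 i)),
    lastTime (firstEvents ω.1.2.2 i))

theorem measurable_forwardOutput (i j : ℕ) : Measurable (G.forwardOutput i j) := by
  unfold forwardOutput
  fun_prop

theorem measurable_backwardOutput (i j : ℕ) : Measurable (G.backwardOutput i j) := by
  unfold backwardOutput
  fun_prop

theorem measurableSet_forwardStop (C : G.StoppingCriterion) (i j : ℕ) :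
    MeasurableSet {ω : Run E V Vr | ForwardStop C i j ω} := by
  have h1 : MeasurableSet {ω : Run E V Vr | (firstEvents ω.1.2.1 j).length = j} :=
    (measurableSet_length j).preimage measurable_fst.snd.fst
  have h2 : MeasurableSet {ω : Run E V Vr | (firstEvents ω.1.2.2 i).length = i} :=
    (measurableSet_length i).preimage measurable_fst.snd.snd
  have h3 : MeasurableSet {ω : Run E V Vr | 0 < lastTime (firstEvents ω.1.2.1 j)} :=
    measurableSet_setOfPred.2 (by fun_prop)
  have h4 : MeasurableSet {ω : Run E V Vr | ∀ e ∈ ω.1.2.2 i,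
      ω.2 / (1 - ω.2) * lastTime (firstEvents ω.1.2.1 j) < e.1} := by
    have : Measurable fun ω : Run E V Vr => (ω.1.2.2 i).toList :=
      measurable_toList.comp (by fun_prop)
    have := measurableSet_forall_mem (P := fun (ω : Run E V Vr) (e : ℝ × Vr) =>
      (ω.2 : ℝ) / (1 - ω.2) * lastTime (firstEvents ω.1.2.1 j) < e.1) this
      (measurableSet_lt (by fun_prop) (by fun_prop))
    simpa only [Option.mem_toList, Option.mem_def] using this
  have h5 : MeasurableSet {ω : Run E V Vr |
      Before (ω.2 / (1 - ω.2) * lastTime (firstEvents ω.1.2.1 j)) (firstEvents ω.1.2.2 i)} :=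
    measurableSet_setOfPred.2 (by fun_prop)
  have h6 : MeasurableSet {ω : Run E V Vr | StopsRight C (G.forwardOutput i j ω).1} :=
    (measurableSet_stopsRight C).preimage (measurable_forwardOutput i j).fst
  convert h1.inter (h3.inter (h2.inter (h4.inter (h5.inter h6)))) using 1
  ext ω
  exact ⟨fun h => ⟨h.1, h.2, h.3, h.4, h.5, h.6⟩, fun ⟨a, b, c, d, e, f⟩ => ⟨a, b, c, d, e, f⟩⟩

theorem measurableSet_backwardStop (C : G.StoppingCriterion) (i j : ℕ) :
    MeasurableSet {ω : Run E V Vr | BackwardStop C i j ω} := by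
  have h1 : MeasurableSet {ω : Run E V Vr | (firstEvents ω.1.2.1 j).length = j} :=
    (measurableSet_length j).preimage measurable_fst.snd.fst
  have h2 : MeasurableSet {ω : Run E V Vr | (firstEvents ω.1.2.2 i).length = i} :=
    (measurableSet_length i).preimage measurable_fst.snd.snd
  have h3 : MeasurableSet {ω : Run E V Vr | 0 < lastTime (firstEvents ω.1.2.2 i)} :=
    measurableSet_setOfPred.2 (by fun_prop)
  have h4 : MeasurableSet {ω : Run E V Vr | ∀ e ∈ ω.1.2.1 j,
      (1 - ω.2) / ω.2 * lastTime (firstEvents ω.1.2.2 i) < e.1} := by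
    have : Measurable fun ω : Run E V Vr => (ω.1.2.1 j).toList :=
      measurable_toList.comp (by fun_prop)
    have := measurableSet_forall_mem (P := fun (ω : Run E V Vr) (e : ℝ × V) =>
      (1 - (ω.2 : ℝ)) / ω.2 * lastTime (firstEvents ω.1.2.2 i) < e.1) this
      (measurableSet_lt (by fun_prop) (by fun_prop))
    simpa only [Option.mem_toList, Option.mem_def] using this
  have h5 : MeasurableSet {ω : Run E V Vr |
      Before ((1 - ω.2) / ω.2 * lastTime (firstEvents ω.1.2.2 i)) (firstEvents ω.1.2.1 j)} :=
    measurableSet_setOfPred.2 (by fun_prop)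
  have h6 : MeasurableSet {ω : Run E V Vr | StopsLeft C (G.backwardOutput i j ω).1} :=
    (measurableSet_stopsLeft C).preimage (measurable_backwardOutput i j).fst
  convert h2.inter (h3.inter (h1.inter (h4.inter (h5.inter h6)))) using 1
  ext ω
  exact ⟨fun h => ⟨h.1, h.2, h.3, h.4, h.5, h.6⟩, fun ⟨a, b, c, d, e, f⟩ => ⟨a, b, c, d, e, f⟩⟩

end ReversiblePDMP

end NutsPDMP

namespace NutsPDMP

/-! ### Change of variables for the position of the origin -/

/-- The position `a` of the origin, when it divides a segment in proportion `α : 1 - α` and the right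
part has length `b`. -/
theorem lintegral_unitInterval_ratio {b : ℝ} (hb : 0 < b) (k : ℝ → ℝ≥0∞) :
    ∫⁻ α : unitInterval, k (α / (1 - α) * b) =
      ∫⁻ a : ℝ, ind (0 < a) * (ENNReal.ofReal (b / (a + b) ^ 2) * k a) := by
  -- The substitution is $\alpha=a/(a+b)$, the inverse of $a=\frac{\alpha}{1-\alpha}b$, with
  -- derivative $b/(a+b)^2$. In terms of $T=a+b$ this is the factor $(T-a)/T^2$.
  have himg : (fun a : ℝ => a / (a + b)) '' Ioi 0 = Ioo 0 1 := by
    ext α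
    simp only [mem_image, mem_Ioi, mem_Ioo]
    constructor
    · rintro ⟨a, ha, rfl⟩
      exact ⟨div_pos ha (by linarith), (div_lt_one (by linarith)).2 (by linarith)⟩
    · rintro ⟨h0, h1⟩
      have h2 : 0 < 1 - α := by linarith
      refine ⟨α / (1 - α) * b, mul_pos (div_pos h0 h2) hb, ?_⟩
      field_simp
      ring
  have h1 : ∫⁻ α : unitInterval, k (α / (1 - α) * b) =
      ∫⁻ α in Ioo (0 : ℝ) 1, k (α / (1 - α) * b) := by
    rw [setLIntegral_congr Ioo_ae_eq_Icc]
    exact lintegral_subtype_comap measurableSet_Icc fun α : ℝ => k (α / (1 - α) * b)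
  rw [h1, ← himg, lintegral_image_eq_lintegral_abs_deriv_mul measurableSet_Ioi
    (f' := fun a => b / (a + b) ^ 2), setLIntegral_eq_ind measurableSet_Ioi]
  · refine lintegral_congr fun a => ind_mul_congr Iff.rfl fun ha => ?_
    have ha' : (0 : ℝ) < a := ha
    have e : a / (a + b) / (1 - a / (a + b)) * b = a := by
      have e1 : 1 - a / (a + b) = b / (a + b) := by
        field_simp
        ring
      rw [e1]
      field_simp
    rw [e, abs_of_nonneg (by positivity)]
  · intro a ha
    have ha' : (0 : ℝ) < a := ha
    have h := ((hasDerivAt_id a).div ((hasDerivAt_id a).add_const b) (by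
      show a + b ≠ 0
      positivity)).hasDerivWithinAt (s := Ioi 0)
    refine h.congr_deriv ?_
    show (1 * (a + b) - a * 1) / (a + b) ^ 2 = b / (a + b) ^ 2
    ring
  · intro x hx y hy hxy
    have hx' : (0 : ℝ) < x := hx
    have hy' : (0 : ℝ) < y := hy
    simp only at hxy
    rw [div_eq_div_iff (by positivity) (by positivity)] at hxy
    have : (x - y) * b = 0 := by linarith
    rcases mul_eq_zero.1 this with h | h
    · linarith
    · exact absurd h hb.ne'

/-- The uniform law is invariant under $\alpha\mapsto1-\alpha$, which exchanges the two directions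
of time. -/
theorem lintegral_unitInterval_ratio_symm {a : ℝ} (ha : 0 < a) {k : ℝ → ℝ≥0∞} (hk : Measurable k) :
    ∫⁻ α : unitInterval, k ((1 - α) / α * a) =
      ∫⁻ b : ℝ, ind (0 < b) * (ENNReal.ofReal (a / (a + b) ^ 2) * k b) := by
  have hm : Measurable fun α : unitInterval => k ((1 - α) / α * a) := hk.comp (by fun_prop)
  have h := (unitInterval.measurePreserving_symm).lintegral_comp hm
  simp only [unitInterval.coe_symm_eq, sub_sub_cancel] at h
  rw [← h, lintegral_unitInterval_ratio ha]
  simp only [add_comm a]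

/-! ### Integrals over runs -/

namespace ReversiblePDMP

variable {E V Vr : Type*} [MeasureSpace E] [MeasureSpace V] [MeasureSpace Vr]
  [SigmaFinite (volume : Measure E)] [SigmaFinite (volume : Measure V)]
  [SigmaFinite (volume : Measure Vr)] {G : ReversiblePDMP E V Vr}
  {π : E → ℝ≥0∞} [IsProbabilityMeasure ((volume : Measure E).withDensity π)]
  {Kf : Kernel E (ℕ → Option (ℝ × V))} [IsMarkovKernel Kf]
  {Kb : Kernel E (ℕ → Option (ℝ × Vr))} [IsMarkovKernel Kb] {C : G.StoppingCriterion}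

set_option linter.unusedSectionVars false

/-- The supremum in `stopTime` runs over an uncountable set of times. Instead, the space of runs is
covered almost surely by countably many measurable pieces, on each of which the output has an
explicit measurable formula. -/
theorem aemeasurable_out (hreg : ∀ᵐ ω ∂runLaw π Kf Kb, IsRegularRun C ω) :
    AEMeasurable (fun ω => (outX C ω, outL C ω)) (runLaw π Kf Kb) := by
  set s : Bool × ℕ × ℕ → Set (Run E V Vr) := fun p =>
    bif p.1 then {ω | ForwardStop C p.2.1 p.2.2 ω} else {ω | BackwardStop C p.2.1 p.2.2 ω} with hs
  have hmem : ∀ᵐ ω ∂runLaw π Kf Kb, ω ∈ ⋃ p, s p := by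
    filter_upwards [hreg] with ω h
    by_cases hf : outX C ω ∈ stoppedForward E V
    · obtain ⟨i, j, hij⟩ := h.exists_forwardStop hf
      exact mem_iUnion.2 ⟨(true, i, j), hij⟩
    · have hb : outX C ω ∈ stoppedBackward E V := by
        by_contra hb
        exact hf (h.stoppedForward_iff.2 hb)
      obtain ⟨i, j, hij⟩ := h.exists_backwardStop hb
      exact mem_iUnion.2 ⟨(false, i, j), hij⟩
  rw [← Measure.restrict_eq_self_of_ae_mem hmem, aemeasurable_iUnion_iff]
  rintro ⟨p, i, j⟩
  cases p with
  | true =>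
    refine ⟨G.forwardOutput i j, measurable_forwardOutput i j, ?_⟩
    filter_upwards [ae_restrict_mem (measurableSet_forwardStop C i j), ae_restrict_of_ae hreg]
      with ω hω h
    obtain ⟨-, h1, h2, -⟩ := h.forwardStop_spec hω
    exact Prod.ext h2 h1
  | false =>
    refine ⟨G.backwardOutput i j, measurable_backwardOutput i j, ?_⟩
    filter_upwards [ae_restrict_mem (measurableSet_backwardStop C i j), ae_restrict_of_ae hreg]
      with ω hω h
    obtain ⟨-, h1, h2, -⟩ := h.backwardStop_spec hω
    exact Prod.ext h2 h1

theorem lintegral_forwardStop_sum (hreg : ∀ᵐ ω ∂runLaw π Kf Kb, IsRegularRun C ω)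
    (F : Segment E V × ℝ → ℝ≥0∞) :
    ∫⁻ ω, ind (outX C ω ∈ stoppedForward E V) * F (outX C ω, outL C ω) ∂runLaw π Kf Kb =
      ∫⁻ ω, ∑' i, ∑' j, ind (ForwardStop C i j ω) * F (G.forwardOutput i j ω)
        ∂runLaw π Kf Kb := by
  refine lintegral_congr_ae ?_
  filter_upwards [hreg] with ω h
  by_cases hf : outX C ω ∈ stoppedForward E V
  · obtain ⟨i, j, hij⟩ := h.exists_forwardStop hf
    obtain ⟨-, e1, e2, e3, e4⟩ := h.forwardStop_spec hij
    have hun : ∀ i' j', ForwardStop C i' j' ω → i' = i ∧ j' = j := fun i' j' h' => by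
      obtain ⟨-, -, -, g3, g4⟩ := h.forwardStop_spec h'
      exact ⟨g3.symm.trans e3, g4.symm.trans e4⟩
    rw [tsum_eq_single i, tsum_eq_single j]
    · rw [ind_pos hf, ind_pos hij, e1, e2]
      rfl
    · intro j' hj'
      rw [ind_neg fun h' => hj' (hun _ _ h').2, zero_mul]
    · intro i' hi'
      refine ENNReal.tsum_eq_zero.2 fun j' => ?_
      rw [ind_neg fun h' => hi' (hun _ _ h').1, zero_mul]
  · rw [ind_neg hf, zero_mul]
    symm
    refine ENNReal.tsum_eq_zero.2 fun i => ENNReal.tsum_eq_zero.2 fun j => ?_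
    rw [ind_neg fun h' => hf (h.forwardStop_spec h').1, zero_mul]

theorem lintegral_backwardStop_sum (hreg : ∀ᵐ ω ∂runLaw π Kf Kb, IsRegularRun C ω)
    (F : Segment E V × ℝ → ℝ≥0∞) :
    ∫⁻ ω, ind (outX C ω ∈ stoppedBackward E V) * F (outX C ω, outL C ω) ∂runLaw π Kf Kb =
      ∫⁻ ω, ∑' i, ∑' j, ind (BackwardStop C i j ω) * F (G.backwardOutput i j ω)
        ∂runLaw π Kf Kb := by
  refine lintegral_congr_ae ?_
  filter_upwards [hreg] with ω h
  by_cases hf : outX C ω ∈ stoppedBackward E V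
  · obtain ⟨i, j, hij⟩ := h.exists_backwardStop hf
    obtain ⟨-, e1, e2, e3, e4⟩ := h.backwardStop_spec hij
    have hun : ∀ i' j', BackwardStop C i' j' ω → i' = i ∧ j' = j := fun i' j' h' => by
      obtain ⟨-, -, -, g3, g4⟩ := h.backwardStop_spec h'
      exact ⟨g3.symm.trans e3, g4.symm.trans e4⟩
    rw [tsum_eq_single i, tsum_eq_single j]
    · rw [ind_pos hf, ind_pos hij, e1, e2]
      rfl
    · intro j' hj'
      rw [ind_neg fun h' => hj' (hun _ _ h').2, zero_mul]
    · intro i' hi'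
      refine ENNReal.tsum_eq_zero.2 fun j' => ?_
      rw [ind_neg fun h' => hi' (hun _ _ h').1, zero_mul]
  · rw [ind_neg hf, zero_mul]
    symm
    refine ENNReal.tsum_eq_zero.2 fun i => ENNReal.tsum_eq_zero.2 fun j => ?_
    rw [ind_neg fun h' => hf (h.backwardStop_spec h').1, zero_mul]

theorem lintegral_runLaw {F : Run E V Vr → ℝ≥0∞} (hF : Measurable F) :
    ∫⁻ ω, F ω ∂runLaw π Kf Kb = ∫⁻ z, (∫⁻ α : unitInterval, (∫⁻ N, (∫⁻ M, F ((z, (N, M)), α) ∂Kb z)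
      ∂Kf z)) ∂((volume : Measure E).withDensity π) := by
  unfold runLaw
  rw [lintegral_prod_symm _ hF.aemeasurable]
  have h1 : ∀ α : unitInterval, ∫⁻ q, F (q, α) ∂(((volume : Measure E).withDensity π) ⊗ₘ
      (Kf ×ₖ Kb)) = ∫⁻ z, (∫⁻ N, (∫⁻ M, F ((z, (N, M)), α) ∂Kb z) ∂Kf z)
        ∂((volume : Measure E).withDensity π) := by
    intro α
    have hα : Measurable fun q => F (q, α) := hF.comp measurable_prodMk_right
    rw [Measure.lintegral_compProd hα]
    refine lintegral_congr fun z => ?_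
    rw [Kernel.prod_apply]
    have hz : Measurable fun q : (ℕ → Option (ℝ × V)) × (ℕ → Option (ℝ × Vr)) =>
      F ((z, q), α) := hF.comp (by fun_prop)
    rw [lintegral_prod _ hz.aemeasurable]
  simp only [h1]
  refine lintegral_lintegral_swap ?_
  refine Measurable.aemeasurable ?_
  have h2 : Measurable fun p : (unitInterval × E) × (ℕ → Option (ℝ × V)) =>
      ∫⁻ M, F ((p.1.2, (p.2, M)), p.1.1) ∂Kb p.1.2 := by
    have : Measurable fun p : ((unitInterval × E) × (ℕ → Option (ℝ × V))) ×
        (ℕ → Option (ℝ × Vr)) => F ((p.1.1.2, (p.1.2, p.2)), p.1.1.1) := hF.comp (by fun_prop)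
    exact this.lintegral_kernel_prod_right' (κ := Kb.comap _ measurable_fst.snd)
  exact h2.lintegral_kernel_prod_right' (κ := Kf.comap _ measurable_snd)

end ReversiblePDMP

end NutsPDMP

namespace NutsPDMP

/-! ### Density of the events of a stopped run -/

section Stop

variable {E M₁ M₂ : Type*} [MeasurableSpace E] [MeasureSpace M₁] [MeasureSpace M₂]
  [SigmaFinite (volume : Measure M₁)] [SigmaFinite (volume : Measure M₂)]
  {D₁ : Dynamics E M₁} {L₁ : Rate E M₁} {K₁ : Kernel E (ℕ → Option (ℝ × M₁))} [IsMarkovKernel K₁]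
  {D₂ : Dynamics E M₂} {L₂ : Rate E M₂} {K₂ : Kernel E (ℕ → Option (ℝ × M₂))} [IsMarkovKernel K₂]

theorem Before.lastTime_le {M : Type*} [MeasurableSpace M] {l : List (ℝ × M)} {a : ℝ}
    (h : Before a l) (ha : 0 ≤ a) : lastTime l ≤ a := by
  by_cases hl : l = []
  · subst hl
    exact ha
  · obtain ⟨e, he, h1⟩ := exists_mem_eq_lastTime hl
    exact h1 ▸ (h e he).le

/-- The `j`-th event of `N` stops the process, after `i` events of `N'`, which are those before
time `c`. -/
def StopsAfter (c : ℝ) (i j : ℕ) (N : ℕ → Option (ℝ × M₁)) (N' : ℕ → Option (ℝ × M₂)) : Prop :=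
  ((firstEvents N j).length = j ∧ 0 < lastTime (firstEvents N j)) ∧
    ((firstEvents N' i).length = i ∧ ∀ e ∈ N' i, c < e.1) ∧ Before c (firstEvents N' i)

/-- The direction that stops the process contributes its first `j` events, with no condition on what
follows. The other contributes its events up to a horizon fixed by the first, together with the
absence of further ones. Summing over `i` and `j` rebuilds integrals over lists of all lengths. -/
theorem lintegral_stopsAfter (hK₁ : IsEventLaw D₁ L₁ K₁) (hD₁ : D₁.IsMeasurable)
    (hK₂ : IsEventLaw D₂ L₂ K₂) (hD₂ : D₂.IsMeasurable)
    (hm : ∀ x, ∫⁻ v, D₂.markDensity x v = 1) (z : E) {r : ℝ} (hr : 0 ≤ r)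
    {Φ : List (ℝ × M₁) × List (ℝ × M₂) × ℝ → ℝ≥0∞} (hΦ : Measurable Φ) :
    ∫⁻ N, (∫⁻ N', ∑' j, ∑' i, ind (StopsAfter (r * lastTime (firstEvents N j)) i j N N') *
        Φ (firstEvents N j, firstEvents N' i, r * lastTime (firstEvents N j)) ∂K₂ z) ∂K₁ z =
      ∫⁻ l, ind (After 0 l ∧ 0 < lastTime l) * (eventDensity D₁ L₁ z l *
        ∫⁻ l', ind (After 0 l' ∧ Before (r * lastTime l) l') *
          (pathDensity D₂ L₂ (r * lastTime l) z l' * Φ (l, l', r * lastTime l))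
            ∂orderedListMeasure M₂) ∂orderedListMeasure M₁ := by
  have hF : Measurable fun l : List (ℝ × M₁) => ind (0 < lastTime l) *
      ∫⁻ l', ind (After 0 l' ∧ Before (r * lastTime l) l') *
          (pathDensity D₂ L₂ (r * lastTime l) z l' * Φ (l, l', r * lastTime l))
            ∂orderedListMeasure M₂ := by
    refine Measurable.mul (by fun_prop) ?_
    have : Measurable fun p : List (ℝ × M₁) × List (ℝ × M₂) =>
        ind (After 0 p.2 ∧ Before (r * lastTime p.1) p.2) *
          (pathDensity D₂ L₂ (r * lastTime p.1) z p.2 * Φ (p.1, p.2, r * lastTime p.1)) := by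
      fun_prop (disch := assumption)
    exact this.lintegral_prod_right'
  have h1 : ∀ N : ℕ → Option (ℝ × M₁), ∫⁻ N', ∑' j, ∑' i,
      ind (StopsAfter (r * lastTime (firstEvents N j)) i j N N') *
        Φ (firstEvents N j, firstEvents N' i, r * lastTime (firstEvents N j)) ∂K₂ z =
      ∑' j, ind ((firstEvents N j).length = j) * (ind (0 < lastTime (firstEvents N j)) *
        ∫⁻ l', ind (After 0 l' ∧ Before (r * lastTime (firstEvents N j)) l') *
          (pathDensity D₂ L₂ (r * lastTime (firstEvents N j)) z l' *
            Φ (firstEvents N j, l', r * lastTime (firstEvents N j))) ∂orderedListMeasure M₂) := by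
    intro N
    have hnext : ∀ (c : ℝ) (i : ℕ), Measurable fun N' : ℕ → Option (ℝ × M₂) =>
        ind ((firstEvents N' i).length = i ∧ ∀ e ∈ N' i, c < e.1) := fun c i =>
      measurable_ind ((measurableSet_length i).inter (measurableSet_preimage
        (f := fun N' : ℕ → Option (ℝ × M₂) => N' i) (measurable_pi_apply i)
        (measurableSet_forall_lt c)))
    have hterm : ∀ i j, Measurable fun N' : ℕ → Option (ℝ × M₂) =>
        ind (StopsAfter (r * lastTime (firstEvents N j)) i j N N') *
        Φ (firstEvents N j, firstEvents N' i, r * lastTime (firstEvents N j)) := fun i j => by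
      simp only [StopsAfter, ind_and _ (Before _ _), ind_and _ (_ ∧ Before _ _)]
      exact (measurable_const.mul ((hnext _ i).mul (by fun_prop))).mul (by fun_prop)
    rw [lintegral_tsum fun j => (Measurable.tsum fun i => hterm i j).aemeasurable]
    refine tsum_congr fun j => ?_
    rw [lintegral_tsum fun i => (hterm i j).aemeasurable, ← mul_assoc, ← ind_and,
      lintegral_orderedListMeasure, ← ENNReal.tsum_mul_left]
    refine tsum_congr fun i => ?_
    by_cases hj : (firstEvents N j).length = j ∧ 0 < lastTime (firstEvents N j)
    · rw [ind_pos hj, one_mul]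
      obtain ⟨c, hc⟩ : ∃ c, r * lastTime (firstEvents N j) = c := ⟨_, rfl⟩
      have hc0 : 0 ≤ c := hc ▸ mul_nonneg hr hj.2.le
      simp only [hc]
      have := hK₂.lintegral_firstEvents_next hD₂ hm z i c
        (F := fun l' => ind (Before c l') * Φ (firstEvents N j, l', c)) (by fun_prop)
        (fun l' hl' => by rw [ind_neg fun h => hl' (h.lastTime_le hc0), zero_mul])
      refine Eq.trans (lintegral_congr fun N' => ?_) (this.trans (lintegral_congr fun l' => ?_))
      · rw [StopsAfter, ind_and, ind_pos hj, one_mul, ind_and, mul_assoc]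
      · rw [ind_and]
        change ind (After 0 l') * _ = _
        ring
    · rw [ind_neg hj, zero_mul]
      refine (lintegral_congr fun N' => ?_).trans lintegral_zero
      rw [StopsAfter, ind_and, ind_neg hj, zero_mul, zero_mul]
  simp only [h1]
  have hFN : ∀ j, Measurable fun N : ℕ → Option (ℝ × M₁) =>
      ind ((firstEvents N j).length = j) * (ind (0 < lastTime (firstEvents N j)) *
        ∫⁻ l', ind (After 0 l' ∧ Before (r * lastTime (firstEvents N j)) l') *
          (pathDensity D₂ L₂ (r * lastTime (firstEvents N j)) z l' *
            Φ (firstEvents N j, l', r * lastTime (firstEvents N j))) ∂orderedListMeasure M₂) :=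
    fun j => (measurable_ind (measurableSet_length j)).mul (hF.comp (measurable_firstEvents j))
  rw [lintegral_tsum fun j => (hFN j).aemeasurable, lintegral_orderedListMeasure]
  refine tsum_congr fun j => ?_
  rw [hK₁.lintegral_firstEvents hD₁ z j hF]
  refine lintegral_congr fun l => ?_
  rw [ind_and]
  change ind (After 0 l) * _ = _
  ring

/-- The two directions are abstract here, so that the choices $r=\alpha/(1-\alpha)$ and
$r=(1-\alpha)/\alpha$ cover forward and backward stopping. -/
theorem lintegral_stopsAfter_ratio (hK₁ : IsEventLaw D₁ L₁ K₁) (hD₁ : D₁.IsMeasurable)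
    (hK₂ : IsEventLaw D₂ L₂ K₂) (hD₂ : D₂.IsMeasurable)
    (hm : ∀ x, ∫⁻ v, D₂.markDensity x v = 1) (z : E) {r : unitInterval → ℝ} (hr : ∀ α, 0 ≤ r α)
    (hrm : Measurable r)
    (hr' : ∀ b : ℝ, 0 < b → ∀ k : ℝ → ℝ≥0∞, Measurable k → ∫⁻ α : unitInterval, k (r α * b) =
      ∫⁻ a : ℝ, ind (0 < a) * (ENNReal.ofReal (b / (a + b) ^ 2) * k a))
    {Φ : List (ℝ × M₁) × List (ℝ × M₂) × ℝ → ℝ≥0∞} (hΦ : Measurable Φ) :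
    ∫⁻ α : unitInterval, (∫⁻ N, (∫⁻ N', ∑' j, ∑' i,
      ind (StopsAfter (r α * lastTime (firstEvents N j)) i j N N') *
        Φ (firstEvents N j, firstEvents N' i, r α * lastTime (firstEvents N j)) ∂K₂ z) ∂K₁ z) =
      ∫⁻ l, ind (After 0 l ∧ 0 < lastTime l) * (eventDensity D₁ L₁ z l *
        ∫⁻ a : ℝ, ind (0 < a) * (ENNReal.ofReal (lastTime l / (a + lastTime l) ^ 2) *
          ∫⁻ l', ind (After 0 l' ∧ Before a l') *
            (pathDensity D₂ L₂ a z l' * Φ (l, l', a)) ∂orderedListMeasure M₂))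
              ∂orderedListMeasure M₁ := by
  have hk : Measurable fun p : List (ℝ × M₁) × ℝ =>
      ∫⁻ l', ind (After 0 l' ∧ Before p.2 l') *
        (pathDensity D₂ L₂ p.2 z l' * Φ (p.1, l', p.2)) ∂orderedListMeasure M₂ := by
    have : Measurable fun q : (List (ℝ × M₁) × ℝ) × List (ℝ × M₂) =>
        ind (After 0 q.2 ∧ Before q.1.2 q.2) *
          (pathDensity D₂ L₂ q.1.2 z q.2 * Φ (q.1.1, q.2, q.1.2)) := by
      fun_prop (disch := assumption)
    exact this.lintegral_prod_right'
  obtain ⟨k, hkk⟩ : ∃ k : List (ℝ × M₁) × ℝ → ℝ≥0∞, ∀ l a, k (l, a) =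
      ∫⁻ l', ind (After 0 l' ∧ Before a l') *
        (pathDensity D₂ L₂ a z l' * Φ (l, l', a)) ∂orderedListMeasure M₂ :=
    ⟨fun p => ∫⁻ l', ind (After 0 l' ∧ Before p.2 l') *
      (pathDensity D₂ L₂ p.2 z l' * Φ (p.1, l', p.2)) ∂orderedListMeasure M₂, fun _ _ => rfl⟩
  replace hk : Measurable k :=
    (funext fun p : List (ℝ × M₁) × ℝ => hkk p.1 p.2 : k = _) ▸ hk
  simp only [lintegral_stopsAfter hK₁ hD₁ hK₂ hD₂ hm z (hr _) hΦ, ← hkk]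
  rw [lintegral_lintegral_swap (Measurable.aemeasurable (by fun_prop (disch := assumption)))]
  refine lintegral_congr fun l => ?_
  by_cases hl : After 0 l ∧ 0 < lastTime l
  · have hkl : Measurable fun a => k (l, a) := by fun_prop
    have hkl' : Measurable fun α => k (l, r α * lastTime l) := by fun_prop
    rw [ind_pos hl]
    simp only [one_mul]
    rw [lintegral_const_mul _ hkl', hr' _ hl.2 _ hkl]
  · rw [ind_neg hl]
    simp

end Stop

namespace ReversiblePDMP

variable {E V Vr : Type*} [MeasureSpace E] [MeasureSpace V] [MeasureSpace Vr]
  [SigmaFinite (volume : Measure E)] [SigmaFinite (volume : Measure V)]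
  [SigmaFinite (volume : Measure Vr)] {G : ReversiblePDMP E V Vr}
  {π : E → ℝ≥0∞} [IsProbabilityMeasure ((volume : Measure E).withDensity π)]
  {Kf : Kernel E (ℕ → Option (ℝ × V))} [IsMarkovKernel Kf]
  {Kb : Kernel E (ℕ → Option (ℝ × Vr))} [IsMarkovKernel Kb] {C : G.StoppingCriterion}
  {Lf : Rate E V} {Lb : Rate E Vr}

set_option linter.unusedSectionVars false

theorem lintegral_runLaw_symm {F : Run E V Vr → ℝ≥0∞} (hF : Measurable F) :
    ∫⁻ ω, F ω ∂runLaw π Kf Kb = ∫⁻ z, (∫⁻ α : unitInterval, (∫⁻ M, (∫⁻ N, F ((z, (N, M)), α) ∂Kf z)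
      ∂Kb z)) ∂((volume : Measure E).withDensity π) := by
  rw [lintegral_runLaw hF]
  refine lintegral_congr fun z => lintegral_congr fun α => ?_
  exact lintegral_lintegral_swap (Measurable.aemeasurable (by fun_prop))

@[fun_prop]
theorem _root_.Measurable.stopsRight {β : Type*} [MeasurableSpace β] (C : G.StoppingCriterion)
    {x : β → Segment E V} (hx : Measurable x) : Measurable fun b => StopsRight C (x b) :=
  measurableSet_setOfPred.1 (hx (measurableSet_stopsRight C))

@[fun_prop]
theorem _root_.Measurable.stopsLeft {β : Type*} [MeasurableSpace β] (C : G.StoppingCriterion)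
    {x : β → Segment E V} (hx : Measurable x) : Measurable fun b => StopsLeft C (x b) :=
  measurableSet_setOfPred.1 (hx (measurableSet_stopsLeft C))

theorem lintegral_stoppedForward (hKf : IsEventLaw G.fwd Lf Kf) (hKb : IsEventLaw G.bwd Lb Kb)
    (hreg : ∀ᵐ ω ∂runLaw π Kf Kb, IsRegularRun C ω)
    {F : Segment E V × ℝ → ℝ≥0∞} (hF : Measurable F) :
    ∫⁻ ω, ind (outX C ω ∈ stoppedForward E V) * F (outX C ω, outL C ω) ∂runLaw π Kf Kb =
      ∫⁻ z, (∫⁻ l, ind (After 0 l ∧ 0 < lastTime l) * (eventDensity G.fwd Lf z l *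
        ∫⁻ a : ℝ, ind (0 < a) * (ENNReal.ofReal (lastTime l / (a + lastTime l) ^ 2) *
          ∫⁻ l', ind (After 0 l' ∧ Before a l') * (pathDensity G.bwd Lb a z l' *
            (ind (StopsRight C (G.twoSided z l' l a (lastTime l))) *
              F (G.twoSided z l' l a (lastTime l), a))) ∂orderedListMeasure Vr))
                ∂orderedListMeasure V) ∂((volume : Measure E).withDensity π) := by
  have hm : Measurable fun ω => ∑' i, ∑' j, ind (ForwardStop C i j ω) *
      F (G.forwardOutput i j ω) := Measurable.tsum fun i => Measurable.tsum fun j =>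
    (measurable_ind (measurableSet_forwardStop C i j)).mul
      (hF.comp (measurable_forwardOutput i j))
  rw [lintegral_forwardStop_sum hreg F, lintegral_runLaw hm]
  refine lintegral_congr fun z => ?_
  have h := lintegral_stopsAfter_ratio hKf G.isMeasurable_fwd hKb G.isMeasurable_bwd
    G.lintegral_rdensity z (r := fun α : unitInterval => α / (1 - α))
    (fun α => div_nonneg α.2.1 (sub_nonneg.2 α.2.2)) (by fun_prop)
    (fun b hb k _ => lintegral_unitInterval_ratio hb k)
    (Φ := fun p => ind (StopsRight C (G.twoSided z p.2.1 p.1 p.2.2 (lastTime p.1))) *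
      F (G.twoSided z p.2.1 p.1 p.2.2 (lastTime p.1), p.2.2)) (by fun_prop)
  refine Eq.trans ?_ h
  refine lintegral_congr fun α => lintegral_congr fun N => lintegral_congr fun M => ?_
  rw [ENNReal.tsum_comm]
  refine tsum_congr fun j => tsum_congr fun i => ?_
  rw [← mul_assoc, ← ind_and]
  refine ind_mul_congr ⟨fun h => ?_, fun h => ?_⟩ fun _ => rfl
  · exact ⟨⟨⟨h.1, h.2⟩, ⟨h.3, h.4⟩, h.5⟩, h.6⟩
  · obtain ⟨⟨⟨h1, h2⟩, ⟨h3, h4⟩, h5⟩, h6⟩ := h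
    exact ⟨h1, h2, h3, h4, h5, h6⟩

theorem lintegral_stoppedBackward (hKf : IsEventLaw G.fwd Lf Kf) (hKb : IsEventLaw G.bwd Lb Kb)
    (hreg : ∀ᵐ ω ∂runLaw π Kf Kb, IsRegularRun C ω)
    {F : Segment E V × ℝ → ℝ≥0∞} (hF : Measurable F) :
    ∫⁻ ω, ind (outX C ω ∈ stoppedBackward E V) * F (outX C ω, outL C ω) ∂runLaw π Kf Kb =
      ∫⁻ z, (∫⁻ l, ind (After 0 l ∧ 0 < lastTime l) * (eventDensity G.bwd Lb z l *
        ∫⁻ b : ℝ, ind (0 < b) * (ENNReal.ofReal (lastTime l / (b + lastTime l) ^ 2) *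
          ∫⁻ l', ind (After 0 l' ∧ Before b l') * (pathDensity G.fwd Lf b z l' *
            (ind (StopsLeft C (G.twoSided z l l' (lastTime l) b)) *
              F (G.twoSided z l l' (lastTime l) b, lastTime l))) ∂orderedListMeasure V))
                ∂orderedListMeasure Vr) ∂((volume : Measure E).withDensity π) := by
  have hm : Measurable fun ω => ∑' i, ∑' j, ind (BackwardStop C i j ω) *
      F (G.backwardOutput i j ω) := Measurable.tsum fun i => Measurable.tsum fun j =>
    (measurable_ind (measurableSet_backwardStop C i j)).mul
      (hF.comp (measurable_backwardOutput i j))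
  rw [lintegral_backwardStop_sum hreg F, lintegral_runLaw_symm hm]
  refine lintegral_congr fun z => ?_
  have h := lintegral_stopsAfter_ratio hKb G.isMeasurable_bwd hKf G.isMeasurable_fwd
    G.lintegral_density z (r := fun α : unitInterval => (1 - α) / α)
    (fun α => div_nonneg (sub_nonneg.2 α.2.2) α.2.1) (by fun_prop)
    (fun b hb k hk => (lintegral_unitInterval_ratio_symm hb hk).trans
      (by simp only [add_comm b]))
    (Φ := fun p => ind (StopsLeft C (G.twoSided z p.1 p.2.1 (lastTime p.1) p.2.2)) *
      F (G.twoSided z p.1 p.2.1 (lastTime p.1) p.2.2, lastTime p.1)) (by fun_prop)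
  refine Eq.trans ?_ h
  refine lintegral_congr fun α => lintegral_congr fun M => lintegral_congr fun N => ?_
  refine tsum_congr fun i => tsum_congr fun j => ?_
  rw [← mul_assoc, ← ind_and]
  refine ind_mul_congr ⟨fun h => ?_, fun h => ?_⟩ fun _ => rfl
  · exact ⟨⟨⟨h.1, h.2⟩, ⟨h.3, h.4⟩, h.5⟩, h.6⟩
  · obtain ⟨⟨⟨h1, h2⟩, ⟨h3, h4⟩, h5⟩, h6⟩ := h
    exact ⟨h1, h2, h3, h4, h5, h6⟩

end ReversiblePDMP

end NutsPDMP

namespace NutsPDMP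

/-! ### Moving the origin of a two-sided path -/

section

variable {M : Type*} [MeasureSpace M] [SigmaFinite (volume : Measure M)]

theorem lintegral_orderedListMeasure_append_shift (a : ℝ) {F : List (ℝ × M) → ℝ≥0∞}
    (hF : Measurable F) :
    ∫⁻ l, F l ∂orderedListMeasure M =
      ∫⁻ l, ind (Before a l) * ∫⁻ l', ind (After 0 l') * F (l ++ shift a l')
        ∂orderedListMeasure M ∂orderedListMeasure M := by
  rw [lintegral_orderedListMeasure_split a hF]
  refine lintegral_congr fun l => ?_
  rw [lintegral_const_mul' _ _ (ind_ne_top _)]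
  have hm : Measurable fun l' : List (ℝ × M) => ind (After a l') * F (l ++ l') := by fun_prop
  refine congrArg (ind (Before a l) * ·) ?_
  refine (lintegral_orderedListMeasure_shift a hm).symm.trans ?_
  simp only [after_shift, sub_self]

theorem lintegral_markList_append_shift (a : ℝ) {F : M × List (ℝ × M) → ℝ≥0∞}
    (hF : Measurable F) :
    ∫⁻ m, F m ∂markList M =
      ∫⁻ m, ind (Before a m.2) * ∫⁻ l', ind (After 0 l') * F (m.1, m.2 ++ shift a l')
        ∂orderedListMeasure M ∂markList M := by
  have hm : Measurable fun p : (M × List (ℝ × M)) × List (ℝ × M) =>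
      ind (After 0 p.2) * F (p.1.1, p.1.2 ++ shift a p.2) := by fun_prop
  have hm' : Measurable fun m : M × List (ℝ × M) => ind (Before a m.2) *
      ∫⁻ l', ind (After 0 l') * F (m.1, m.2 ++ shift a l') ∂orderedListMeasure M :=
    Measurable.mul (by fun_prop) hm.lintegral_prod_right'
  unfold markList
  rw [lintegral_prod _ hF.aemeasurable, lintegral_prod _ hm'.aemeasurable]
  refine lintegral_congr fun v => ?_
  exact lintegral_orderedListMeasure_append_shift a (F := fun l => F (v, l)) (by fun_prop)

end

namespace ReversiblePDMP

variable {E V Vr β : Type*} [MeasureSpace E] [MeasureSpace V] [MeasureSpace Vr]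
  [MeasurableSpace β] {G : ReversiblePDMP E V Vr} {ψ : ℝ → Path E Vr → ℝ}

set_option linter.unusedSectionVars false

@[fun_prop]
theorem _root_.Measurable.rightEvents {x : β → Segment E V} {l : β → ℝ} (hx : Measurable x)
    (hl : Measurable l) : Measurable fun b => rightEvents (x b) (l b) :=
  .shift hl.neg (Measurable.listFilter hx.fst.snd (by
    simpa only [decide_eq_true_eq] using
      measurableSet_lt (f := fun p : β × (ℝ × V) => l p.1) (g := fun p => p.2.1)
        (hl.comp measurable_fst) measurable_snd.fst))

theorem leftPart_append_shift {l₁ l₂ : List (ℝ × V)} {a : ℝ} (h₁ : ∀ e ∈ l₁, e.1 ≤ a)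
    (h₂ : After 0 l₂) (x : E) (T : ℝ) :
    leftPart ((x, l₁ ++ shift a l₂), T) a = (x, l₁) := by
  unfold leftPart
  simp only [List.filter_append, Prod.mk.injEq, true_and]
  rw [List.filter_eq_self.2 (by simpa using h₁), List.filter_eq_nil_iff.2, List.append_nil]
  have : After a (shift a l₂) := after_shift.2 (by rwa [sub_self])
  intro e he
  simpa using this e he

theorem rightEvents_append_shift {l₁ l₂ : List (ℝ × V)} {a : ℝ} (h₁ : ∀ e ∈ l₁, e.1 ≤ a)
    (h₂ : After 0 l₂) (x : E) (T : ℝ) :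
    rightEvents ((x, l₁ ++ shift a l₂), T) a = l₂ := by
  unfold rightEvents
  have : After a (shift a l₂) := after_shift.2 (by rwa [sub_self])
  simp only [List.filter_append]
  rw [List.filter_eq_nil_iff.2 (by simpa using h₁), List.nil_append,
    List.filter_eq_self.2 (fun e he => by simpa using this e he), shift_shift, add_neg_cancel, shift_zero]

variable [SigmaFinite (volume : Measure E)] [SigmaFinite (volume : Measure V)]
  [SigmaFinite (volume : Measure Vr)] [TopologicalSpace E] [TopologicalSpace Vr]

@[fun_prop]
theorem _root_.Measurable.leftPart {x : β → Segment E V} {l : β → ℝ} (hx : Measurable x)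
    (hl : Measurable l) : Measurable fun b => leftPart (x b) (l b) :=
  measurable_leftPart hx hl

/-- For fixed `a` the backward part is replaced by its reversal, which costs the inverse volume
change, and the forward events are glued behind it after a shift by `a`. The canonical measure
factorises at `a`, so the glued path again has the canonical law. -/
theorem lintegral_twoSided_fwd (hψ : G.IsVolumeChange ψ) (hcont : G.ContinuousReversal ψ)
    {Q : ℝ × Path E Vr × List (ℝ × V) → ℝ≥0∞} (hQ : Measurable Q) :
    ∫⁻ a : ℝ, ind (0 < a) * ∫⁻ w, ind (After 0 w.2 ∧ Before a w.2) *
        ∫⁻ l, ind (After 0 l) * Q (a, w, l) ∂orderedListMeasure V ∂allPaths E Vr =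
      ∫⁻ w, ind (After 0 w.2) * (∫⁻ a : ℝ, ind (0 < a) *
        ((volumeChange ψ a (G.R a (leftPart (w, 0) a)))⁻¹ *
          Q (a, G.R a (leftPart (w, 0) a), rightEvents (w, 0) a))) ∂allPaths E V := by
  have hv : Measurable fun p : ℝ × Path E Vr => volumeChange ψ p.1 p.2 :=
    measurable_volumeChange hψ
  obtain ⟨v, hvd⟩ : ∃ v : ℝ × Path E Vr → ℝ≥0∞, ∀ a w, volumeChange ψ a w = v (a, w) :=
    ⟨fun p => volumeChange ψ p.1 p.2, fun _ _ => rfl⟩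
  simp only [hvd] at hv ⊢
  change Measurable v at hv
  simp only [← lintegral_const_mul' _ _ (ind_ne_top (After 0 _))]
  rw [lintegral_lintegral_swap (μ := allPaths E V) (Measurable.aemeasurable (by fun_prop))]
  refine lintegral_congr fun a => ?_
  by_cases ha : 0 < a
  swap
  · simp only [ind_neg ha, zero_mul, mul_zero, lintegral_zero]
  simp only [ind_pos ha, one_mul]
  have hk : Measurable fun w : Path E Vr =>
      ∫⁻ l, ind (After 0 l) * Q (a, w, l) ∂orderedListMeasure V := by
    have : Measurable fun p : Path E Vr × List (ℝ × V) => ind (After 0 p.2) * Q (a, p.1, p.2) := by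
      fun_prop
    exact this.lintegral_prod_right'
  have h := lintegral_reversal hψ hcont ha (F := fun w => (v (a, w))⁻¹ *
    ∫⁻ l, ind (After 0 l) * Q (a, w, l) ∂orderedListMeasure V) (by fun_prop)
  -- The reversal formula produces a factor `volumeChange`; it is inserted together with its
  -- inverse, which is legitimate because it is positive and finite.
  have e : ∫⁻ w, ind (After 0 w.2 ∧ Before a w.2) * ∫⁻ l, ind (After 0 l) * Q (a, w, l)
        ∂orderedListMeasure V ∂allPaths E Vr =
      ∫⁻ w, ind (After 0 w.2 ∧ Before a w.2) * (volumeChange ψ a w * ((v (a, w))⁻¹ *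
        ∫⁻ l, ind (After 0 l) * Q (a, w, l) ∂orderedListMeasure V)) ∂allPaths E Vr := by
    refine lintegral_congr_ae ?_
    filter_upwards [ae_increasing_allPaths] with w hw
    refine ind_mul_congr Iff.rfl fun hw' => ?_
    obtain ⟨h0, ht⟩ := volumeChange_pos hψ hcont hw hw'.1 ((lastTime_lt_iff hw ha).2 hw'.2).le
    rw [← hvd, ← mul_assoc, ENNReal.mul_inv_cancel h0 ht, one_mul]
  rw [e, ← h]
  unfold allPaths
  rw [lintegral_prod _ (by fun_prop), lintegral_prod _ (by fun_prop)]
  refine lintegral_congr fun x => ?_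
  refine Eq.trans ?_ (lintegral_orderedListMeasure_append_shift a (by fun_prop)).symm
  refine lintegral_congr fun l₁ => ?_
  simp only
  by_cases h1 : Before a l₁
  swap
  · rw [ind_neg h1, ind_neg (fun h => h1 h.2), zero_mul, zero_mul]
  rw [ind_and, ind_pos h1, mul_one, one_mul]
  have hQ' : Measurable fun l : List (ℝ × V) =>
    ind (After 0 l) * Q (a, G.R a (x, l₁), l) := by fun_prop
  rw [← lintegral_const_mul _ hQ', ← lintegral_const_mul' _ _ (ind_ne_top _)]
  refine lintegral_congr fun l₂ => ?_
  rw [mul_left_comm, mul_left_comm _ (ind (After 0 l₂)), ← mul_assoc (ind (After 0 l₂)),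
    ← mul_assoc (ind (After 0 l₂)), ← ind_and, ← ind_and, mul_left_comm]
  refine ind_mul_congr ⟨fun h => ⟨h.1, ?_⟩, fun h => ⟨h.1, fun e he => ?_⟩⟩ fun h => ?_
  · intro e he
    rcases List.mem_append.1 he with he | he
    · exact h.2 e he
    · exact ha.trans ((after_shift.2 (by rw [sub_self]; exact h.1) : After a _) e he)
  · exact h.2 e (List.mem_append_left _ he)
  · have hle : ∀ e ∈ l₁, e.1 ≤ a := fun e he => (h1 e he).le
    rw [leftPart_append_shift hle h.1, rightEvents_append_shift hle h.1]

/-- Here the backward part ends with an event at its horizon, so `lintegral_boundary` takes the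
place of the reversal formula. The resulting path begins with a jump at time 0, and the length `b`
of the forward part is traded for the total length `T = a + b`. -/
theorem lintegral_twoSided_bwd (hψ : G.IsVolumeChange ψ) (hcont : G.ContinuousReversal ψ)
    {Q : ℝ × Path E Vr × List (ℝ × V) → ℝ≥0∞} (hQ : Measurable Q) :
    ∫⁻ w, ind (w.2 ≠ [] ∧ After 0 w.2) * (∫⁻ b : ℝ, (∫⁻ l, ind (After 0 l) * Q (b, w, l)
        ∂orderedListMeasure V)) ∂allPaths E Vr =
      ∫⁻ x : E, ∫⁻ T : ℝ, (∫⁻ m, ind (After 0 m.2) * (∫⁻ a : ℝ, ind (0 < a) *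
        ((volumeChange ψ a (G.R a (leftPart ((x, (0, m.1) :: m.2), 0) a)))⁻¹ *
          Q (T - a, G.R a (leftPart ((x, (0, m.1) :: m.2), 0) a),
            rightEvents ((x, (0, m.1) :: m.2), 0) a))) ∂markList V) := by
  have hv : Measurable fun p : ℝ × Path E Vr => volumeChange ψ p.1 p.2 :=
    measurable_volumeChange hψ
  obtain ⟨v, hvd⟩ : ∃ v : ℝ × Path E Vr → ℝ≥0∞, ∀ a w, volumeChange ψ a w = v (a, w) :=
    ⟨fun p => volumeChange ψ p.1 p.2, fun _ _ => rfl⟩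
  simp only [hvd] at hv ⊢
  change Measurable v at hv
  have hk : Measurable fun p : Path E Vr × ℝ =>
      ∫⁻ l, ind (After 0 l) * Q (p.2, p.1, l) ∂orderedListMeasure V := by
    have : Measurable fun p : (Path E Vr × ℝ) × List (ℝ × V) =>
      ind (After 0 p.2) * Q (p.1.2, p.1.1, p.2) := by fun_prop
    exact this.lintegral_prod_right'
  obtain ⟨k, hkd⟩ : ∃ k : Path E Vr × ℝ → ℝ≥0∞, ∀ w b,
      ∫⁻ l, ind (After 0 l) * Q (b, w, l) ∂orderedListMeasure V = k (w, b) :=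
    ⟨fun p => ∫⁻ l, ind (After 0 l) * Q (p.2, p.1, l) ∂orderedListMeasure V, fun _ _ => rfl⟩
  simp only [hkd] at hk ⊢
  change Measurable k at hk
  have hk' : Measurable fun w => ∫⁻ b : ℝ, k (w, b) := hk.lintegral_prod_right'
  have h := lintegral_boundary hψ hcont (F := fun w => (v (lastTime w.2, w))⁻¹ *
    ∫⁻ b : ℝ, k (w, b)) (by fun_prop)
  have e : ∫⁻ w, ind (w.2 ≠ [] ∧ After 0 w.2) * (∫⁻ b : ℝ, k (w, b)) ∂allPaths E Vr =
      ∫⁻ w, ind (w.2 ≠ [] ∧ After 0 w.2) * (volumeChange ψ (lastTime w.2) w *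
        ((v (lastTime w.2, w))⁻¹ * ∫⁻ b : ℝ, k (w, b))) ∂allPaths E Vr := by
    refine lintegral_congr_ae ?_
    filter_upwards [ae_increasing_allPaths] with w hw
    refine ind_mul_congr Iff.rfl fun hw' => ?_
    obtain ⟨h0, ht⟩ := volumeChange_pos hψ hcont hw hw'.2 le_rfl
    rw [← hvd, ← mul_assoc, ENNReal.mul_inv_cancel h0 ht, one_mul]
  rw [e, h]
  refine lintegral_congr fun x => ?_
  have hgm : Measurable fun p : ℝ × ℝ × (V × List (ℝ × V)) => ind (After 0 p.2.2.2) *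
      (ind (0 < p.1) * ((v (p.1, G.R p.1 (leftPart ((x, (0, p.2.2.1) :: p.2.2.2), 0) p.1)))⁻¹ *
        Q (p.2.1, G.R p.1 (leftPart ((x, (0, p.2.2.1) :: p.2.2.2), 0) p.1),
            rightEvents ((x, (0, p.2.2.1) :: p.2.2.2), 0) p.1))) := by fun_prop
  obtain ⟨g, hg⟩ : ∃ g : ℝ × ℝ × (V × List (ℝ × V)) → ℝ≥0∞, ∀ a b m, ind (After 0 m.2) *
      (ind (0 < a) * ((v (a, G.R a (leftPart ((x, (0, m.1) :: m.2), 0) a)))⁻¹ *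
        Q (b, G.R a (leftPart ((x, (0, m.1) :: m.2), 0) a),
            rightEvents ((x, (0, m.1) :: m.2), 0) a))) = g (a, b, m) :=
    ⟨fun p => ind (After 0 p.2.2.2) *
      (ind (0 < p.1) * ((v (p.1, G.R p.1 (leftPart ((x, (0, p.2.2.1) :: p.2.2.2), 0) p.1)))⁻¹ *
        Q (p.2.1, G.R p.1 (leftPart ((x, (0, p.2.2.1) :: p.2.2.2), 0) p.1),
            rightEvents ((x, (0, p.2.2.1) :: p.2.2.2), 0) p.1))), fun _ _ _ => rfl⟩
  simp only [hg] at hgm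
  change Measurable g at hgm
  simp only [← lintegral_const_mul' _ _ (ind_ne_top (After 0 _)), hg]
  have e1 : ∀ T : ℝ, ∫⁻ m, (∫⁻ a : ℝ, g (a, T - a, m)) ∂markList V =
      ∫⁻ a : ℝ, ∫⁻ m, g (a, T - a, m) ∂markList V := fun T =>
    lintegral_lintegral_swap (Measurable.aemeasurable (by fun_prop))
  simp only [e1]
  have hgi : Measurable fun p : ℝ × ℝ => ∫⁻ m, g (p.1, p.2, m) ∂markList V := by
    have : Measurable fun q : (ℝ × ℝ) × (V × List (ℝ × V)) => g (q.1.1, q.1.2, q.2) := by fun_prop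
    exact this.lintegral_prod_right'
  have hgs : Measurable fun p : ℝ × ℝ => ∫⁻ m, g (p.2, p.1 - p.2, m) ∂markList V :=
    hgi.comp (by fun_prop : Measurable fun p : ℝ × ℝ => (p.2, p.1 - p.2))
  rw [lintegral_lintegral_swap (μ := volume) (ν := volume)
    (f := fun T a => ∫⁻ m, g (a, T - a, m) ∂markList V) hgs.aemeasurable]
  refine lintegral_congr fun a => ?_
  rw [lintegral_sub_right_eq_self (fun b => ∫⁻ m, g (a, b, m) ∂markList V) a]
  have hkm : ∀ m : V × List (ℝ × V), Measurable fun b => k (G.R a (x, (0, m.1) :: m.2), b) :=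
    fun m => by fun_prop
  -- The jump at time 0 becomes the last event of the reversed path, at time `a`.
  have e2 : ∀ m : V × List (ℝ × V), lastTime (G.R a (x, (0, m.1) :: m.2)).2 = a := fun m => by
    simp [R, Dynamics.lastTime_reverse_cons]
  have hvm : ∀ m : V × List (ℝ × V), Measurable fun b : ℝ =>
    (v (a, G.R a (x, (0, m.1) :: m.2)))⁻¹ * k (G.R a (x, (0, m.1) :: m.2), b) :=
    fun m => by fun_prop
  simp only [e2, ← lintegral_const_mul _ (hkm _), ← lintegral_const_mul _ (hvm _)]
  rw [lintegral_lintegral_swap (Measurable.aemeasurable (by fun_prop))]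
  refine lintegral_congr fun b => ?_
  refine Eq.trans ?_ (lintegral_markList_append_shift a (by fun_prop)).symm
  refine lintegral_congr fun m => ?_
  change ind (0 < a ∧ After 0 m.2 ∧ Before a m.2) * _ = _
  by_cases h1 : Before a m.2
  swap
  · rw [ind_neg h1, ind_neg (fun h => h1 h.2.2), zero_mul, zero_mul]
  rw [← and_assoc, ind_and, ind_pos h1, mul_one, one_mul, ← hkd]
  have hQ' : Measurable fun l : List (ℝ × V) =>
    ind (After 0 l) * Q (b, G.R a (x, (0, m.1) :: m.2), l) := by fun_prop
  rw [← lintegral_const_mul _ hQ', ← lintegral_const_mul' _ _ (ind_ne_top _)]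
  refine lintegral_congr fun l₂ => ?_
  rw [← hg, mul_left_comm _ (ind (After 0 l₂)), mul_left_comm (ind (0 < a ∧ _)),
    ← mul_assoc (ind (After 0 (_ ++ _))), ← ind_and]
  refine ind_mul_congr Iff.rfl fun h2 => ?_
  refine ind_mul_congr ⟨fun h => ⟨?_, h.1⟩, fun h => ⟨h.2, fun e he => ?_⟩⟩ fun h => ?_
  · intro e he
    rcases List.mem_append.1 he with he | he
    · exact h.2 e he
    · exact h.1.trans ((after_shift.2 (by rw [sub_self]; exact h2) : After a _) e he)
  · exact h.1 e (List.mem_append_left _ he)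
  · have hle : ∀ e ∈ (0, m.1) :: m.2, e.1 ≤ a := by
      simpa using ⟨h.1.le, fun t v hv => (h1 _ hv).le⟩
    have e3 := leftPart_append_shift hle h2 x 0
    have e4 := rightEvents_append_shift hle h2 x 0
    rw [List.cons_append] at e3 e4
    simp only [e3, e4]

end ReversiblePDMP

end NutsPDMP

namespace NutsPDMP

/-! ### Joint density of the stopped path and of the position of its origin -/

section

variable {M : Type*} [MeasurableSpace M]

theorem Increasing.exists_append_shift {l : List (ℝ × M)} (h : Increasing l) (a : ℝ) :
    ∃ l₁ l₂, l = l₁ ++ shift a l₂ ∧ (∀ e ∈ l₁, e.1 ≤ a) ∧ After 0 l₂ := by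
  refine ⟨l.filter (fun e => e.1 ≤ a), shift (-a) (l.filter fun e => a < e.1), ?_, ?_, ?_⟩
  · rw [shift_shift, neg_add_cancel, shift_zero]
    refine Increasing.ext h ?_ fun e => ?_
    · refine List.pairwise_append.2 ⟨h.filter _, h.filter _, fun x hx y hy => ?_⟩
      simp only [List.mem_filter, decide_eq_true_eq] at hx hy
      exact hx.2.trans_lt hy.2
    · simp only [List.mem_append, List.mem_filter, decide_eq_true_eq, ← and_or_left, le_or_gt,
        and_true]
  · intro e he
    simpa using (List.mem_filter.1 he).2
  · refine after_shift.2 fun e he => ?_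
    simpa using (List.mem_filter.1 he).2

end

namespace ReversiblePDMP

variable {E V Vr β : Type*} [MeasureSpace E] [MeasureSpace V] [MeasureSpace Vr]
  [MeasurableSpace β] {G : ReversiblePDMP E V Vr} {ψ : ℝ → Path E Vr → ℝ}
  {π : E → ℝ≥0∞} {Lf : Rate E V} {Lb : Rate E Vr}

set_option linter.unusedSectionVars false

/-- The weight of a position of the origin, with the measurable version of the volume change. -/
noncomputable def weight (G : ReversiblePDMP E V Vr) (π : E → ℝ≥0∞) (ψ : ℝ → Path E Vr → ℝ)
    (Lf : Rate E V) (Lb : Rate E Vr) (x : Segment E V) (a : ℝ) : ℝ≥0∞ :=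
  π (G.stateIn x a) *
    pathDensity G.bwd Lb a (G.stateIn x a) (G.R a (leftPart x a)).2 *
    pathDensity G.fwd Lf (x.2 - a) (G.stateIn x a) (rightEvents x a) *
    (volumeChange ψ a (G.R a (leftPart x a)))⁻¹

theorem stateIn_append_shift {l₁ l₂ : List (ℝ × V)} {a : ℝ} (h₁ : ∀ e ∈ l₁, e.1 ≤ a)
    (h₂ : After 0 l₂) (x : E) (T : ℝ) :
    G.stateIn ((x, l₁ ++ shift a l₂), T) a = (G.R a (x, l₁)).1 := by
  unfold stateIn
  rw [leftPart_append_shift h₁ h₂]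
  exact (Dynamics.reverse_fst (rev := G.mark) a (x, l₁)).symm

theorem twoSided_R (x : E) (l₁ l₂ : List (ℝ × V)) (a b : ℝ) :
    G.twoSided (G.R a (x, l₁)).1 (G.R a (x, l₁)).2 l₂ a b = ((x, l₁ ++ shift a l₂), a + b) := by
  unfold twoSided
  rw [Prod.mk.eta, Rinv_R]

variable [SigmaFinite (volume : Measure E)] [SigmaFinite (volume : Measure V)]
  [SigmaFinite (volume : Measure Vr)] [TopologicalSpace E] [TopologicalSpace Vr]

theorem measurable_weight (hψ : G.IsVolumeChange ψ) (hπ : Measurable π) :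
    Measurable fun p : Segment E V × ℝ => weight G π ψ Lf Lb p.1 p.2 := by
  have h1 : Measurable fun p : Segment E V × ℝ => G.stateIn p.1 p.2 :=
    measurable_stateIn measurable_fst measurable_snd
  have h2 : Measurable fun p : Segment E V × ℝ => volumeChange ψ p.2 (G.R p.2 (leftPart p.1 p.2)) :=
    .volumeChange hψ (by fun_prop) (by fun_prop)
  have hf := G.isMeasurable_fwd
  have hb := G.isMeasurable_bwd
  unfold weight
  fun_prop (disch := assumption)

/-- Tonelli, to bring the position `a` to the outside and to join the initial state with the
backward events: the reversal acts on such pairs, at fixed `a`. -/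
theorem lintegral_rotate {α₁ α₂ α₃ α₄ : Type*} [MeasurableSpace α₁] [MeasurableSpace α₂]
    [MeasurableSpace α₃] [MeasurableSpace α₄] {μ₁ : Measure α₁} {μ₂ : Measure α₂}
    {μ₃ : Measure α₃} {μ₄ : Measure α₄} [SFinite μ₁] [SFinite μ₂] [SFinite μ₃] [SFinite μ₄]
    {f : α₁ → α₂ → α₃ → α₄ → ℝ≥0∞}
    (hf : Measurable fun p : α₁ × α₂ × α₃ × α₄ => f p.1 p.2.1 p.2.2.1 p.2.2.2) :
    ∫⁻ x, (∫⁻ y, (∫⁻ s, (∫⁻ t, f x y s t ∂μ₄) ∂μ₃) ∂μ₂) ∂μ₁ =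
      ∫⁻ s, (∫⁻ p, (∫⁻ y, f p.1 y s p.2 ∂μ₂) ∂μ₁.prod μ₄) ∂μ₃ := by
  have h1 : Measurable fun p : (α₁ × α₂ × α₃) => ∫⁻ t, f p.1 p.2.1 p.2.2 t ∂μ₄ := by
    have : Measurable fun q : (α₁ × α₂ × α₃) × α₄ => f q.1.1 q.1.2.1 q.1.2.2 q.2 :=
      hf.comp (by fun_prop : Measurable fun q : (α₁ × α₂ × α₃) × α₄ =>
        (q.1.1, q.1.2.1, q.1.2.2, q.2))
    exact this.lintegral_prod_right'
  have h2 : ∀ x, ∫⁻ y, (∫⁻ s, (∫⁻ t, f x y s t ∂μ₄) ∂μ₃) ∂μ₂ =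
      ∫⁻ s, (∫⁻ y, (∫⁻ t, f x y s t ∂μ₄) ∂μ₂) ∂μ₃ := fun x => by
    have : Measurable fun p : α₂ × α₃ => ∫⁻ t, f x p.1 p.2 t ∂μ₄ :=
      h1.comp (by fun_prop : Measurable fun p : α₂ × α₃ => (x, p))
    exact lintegral_lintegral_swap this.aemeasurable
  have h3 : Measurable fun p : α₁ × α₃ => ∫⁻ y, (∫⁻ t, f p.1 y p.2 t ∂μ₄) ∂μ₂ := by
    have : Measurable fun q : (α₁ × α₃) × α₂ => ∫⁻ t, f q.1.1 q.2 q.1.2 t ∂μ₄ :=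
      h1.comp (by fun_prop : Measurable fun q : (α₁ × α₃) × α₂ => (q.1.1, q.2, q.1.2))
    exact this.lintegral_prod_right'
  simp only [h2]
  rw [lintegral_lintegral_swap h3.aemeasurable]
  refine lintegral_congr fun s => ?_
  have h4 : Measurable fun p : α₁ × α₄ => ∫⁻ y, f p.1 y s p.2 ∂μ₂ := by
    have : Measurable fun q : (α₁ × α₄) × α₂ => f q.1.1 q.2 s q.1.2 :=
      hf.comp (by fun_prop : Measurable fun q : (α₁ × α₄) × α₂ => (q.1.1, q.2, s, q.1.2))
    exact this.lintegral_prod_right'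
  rw [lintegral_prod _ h4.aemeasurable]
  refine lintegral_congr fun x => ?_
  have : Measurable fun p : α₂ × α₄ => f x p.1 s p.2 :=
    hf.comp (by fun_prop : Measurable fun p : α₂ × α₄ => (x, p.1, s, p.2))
  exact lintegral_lintegral_swap this.aemeasurable

/-- Integral over the initial state, the events in the direction where the process is stopped, the
length of the other part and its events. -/
theorem lintegral_expand {M M' : Type*} [MeasureSpace M] [MeasureSpace M']
    [SigmaFinite (volume : Measure M)] [SigmaFinite (volume : Measure M')] (hπ : Measurable π)
    {A : E × List (ℝ × M) → ℝ≥0∞} (hA : Measurable A) {B : List (ℝ × M) × ℝ → ℝ≥0∞}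
    (hB : Measurable B) {K : E × List (ℝ × M) × ℝ × List (ℝ × M') → ℝ≥0∞} (hK : Measurable K) :
    ∫⁻ z, (∫⁻ l, ind (After 0 l ∧ 0 < lastTime l) * (A (z, l) *
      ∫⁻ a : ℝ, ind (0 < a) * (B (l, a) *
        ∫⁻ l', ind (After 0 l' ∧ Before a l') * K (z, l, a, l') ∂orderedListMeasure M'))
          ∂orderedListMeasure M) ∂((volume : Measure E).withDensity π) =
      ∫⁻ z, (∫⁻ l, (∫⁻ a : ℝ, (∫⁻ l', ind (After 0 l ∧ 0 < lastTime l) *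
        (ind (0 < a ∧ After 0 l' ∧ Before a l') * (π z * (A (z, l) * (B (l, a) *
          K (z, l, a, l'))))) ∂orderedListMeasure M')) ∂orderedListMeasure M) := by
  have h1 : ∀ z l a, Measurable fun l' => ind (After 0 l' ∧ Before a l') * K (z, l, a, l') :=
    fun z l a => by fun_prop
  have h2 : Measurable fun p : E × List (ℝ × M) × ℝ =>
      ∫⁻ l', ind (After 0 l' ∧ Before p.2.2 l') * K (p.1, p.2.1, p.2.2, l')
        ∂orderedListMeasure M' := by
    have : Measurable fun q : (E × List (ℝ × M) × ℝ) × List (ℝ × M') =>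
        ind (After 0 q.2 ∧ Before q.1.2.2 q.2) * K (q.1.1, q.1.2.1, q.1.2.2, q.2) := by fun_prop
    exact this.lintegral_prod_right'
  obtain ⟨k, hk⟩ : ∃ k : E × List (ℝ × M) × ℝ → ℝ≥0∞, ∀ z l a,
      ∫⁻ l', ind (After 0 l' ∧ Before a l') * K (z, l, a, l') ∂orderedListMeasure M' =
        k (z, l, a) := ⟨fun p => ∫⁻ l', ind (After 0 l' ∧ Before p.2.2 l') *
          K (p.1, p.2.1, p.2.2, l') ∂orderedListMeasure M', fun _ _ _ => rfl⟩
  have e1 : ∀ z l a, ∫⁻ l', ind (After 0 l ∧ 0 < lastTime l) *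
        (ind (0 < a ∧ After 0 l' ∧ Before a l') * (π z * (A (z, l) * (B (l, a) *
          K (z, l, a, l'))))) ∂orderedListMeasure M' = (π z * (ind (After 0 l ∧ 0 < lastTime l) *
          A (z, l))) * (ind (0 < a) * (B (l, a) * k (z, l, a))) := fun z l a => by
    rw [← hk, ← lintegral_const_mul _ (h1 z l a), ← lintegral_const_mul' _ _ (ind_ne_top _),
      ← lintegral_const_mul]
    · refine lintegral_congr fun l' => ?_
      rw [ind_and (0 < a)]
      ring
    · exact ((h1 z l a).const_mul _).const_mul _
  simp only [hk] at h2
  change Measurable k at h2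
  simp only [hk, e1]
  have h3 : ∀ z l, Measurable fun a => ind (0 < a) * (B (l, a) * k (z, l, a)) :=
    fun z l => by fun_prop
  simp only [lintegral_const_mul _ (h3 _ _)]
  have h4 : Measurable fun p : E × List (ℝ × M) => ∫⁻ a, ind (0 < a) *
      (B (p.2, a) * k (p.1, p.2, a)) := by
    have : Measurable fun q : (E × List (ℝ × M)) × ℝ => ind (0 < q.2) *
      (B (q.1.2, q.2) * k (q.1.1, q.1.2, q.2)) := by fun_prop
    exact this.lintegral_prod_right'
  obtain ⟨j, hj⟩ : ∃ j : E × List (ℝ × M) → ℝ≥0∞, ∀ z l,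
      ∫⁻ a, ind (0 < a) * (B (l, a) * k (z, l, a)) = j (z, l) :=
    ⟨fun p => ∫⁻ a, ind (0 < a) * (B (p.2, a) * k (p.1, p.2, a)), fun _ _ => rfl⟩
  simp only [hj] at h4 ⊢
  change Measurable j at h4
  have h5 : Measurable fun z => ∫⁻ l, ind (After 0 l ∧ 0 < lastTime l) * (A (z, l) * j (z, l))
      ∂orderedListMeasure M := by
    have : Measurable fun q : E × List (ℝ × M) => ind (After 0 q.2 ∧ 0 < lastTime q.2) *
      (A q * j q) := by fun_prop
    exact this.lintegral_prod_right'
  rw [lintegral_withDensity_eq_lintegral_mul _ hπ h5]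
  refine lintegral_congr fun z => ?_
  have h6 : Measurable fun l => ind (After 0 l ∧ 0 < lastTime l) * (A (z, l) * j (z, l)) := by
    fun_prop
  rw [Pi.mul_apply, ← lintegral_const_mul _ h6]
  refine lintegral_congr fun l => ?_
  ring

/-- The joint density of stopped path and origin in the coordinates of the glued path. Its length
needs no coordinate of its own, being the time of the last event. -/
theorem lintegral_forward_weight (hψ : G.IsVolumeChange ψ) (hcont : G.ContinuousReversal ψ)
    (hπ : Measurable π) {H : Segment E V × ℝ → ℝ≥0∞} (hH : Measurable H) :
    ∫⁻ z, (∫⁻ l, ind (After 0 l ∧ 0 < lastTime l) * (eventDensity G.fwd Lf z l *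
        ∫⁻ a : ℝ, ind (0 < a) * (ENNReal.ofReal (lastTime l / (a + lastTime l) ^ 2) *
          ∫⁻ l', ind (After 0 l' ∧ Before a l') * (pathDensity G.bwd Lb a z l' *
            H (G.twoSided z l' l a (lastTime l), a)) ∂orderedListMeasure Vr))
                ∂orderedListMeasure V) ∂((volume : Measure E).withDensity π) =
      ∫⁻ w, ind (After 0 w.2) * (∫⁻ a : ℝ, ind (0 < a ∧ a < lastTime w.2) *
        (weight G π ψ Lf Lb (w, lastTime w.2) a *
          ENNReal.ofReal ((lastTime w.2 - a) / lastTime w.2 ^ 2) * H ((w, lastTime w.2), a)))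
            ∂allPaths E V := by
  have hf := G.isMeasurable_fwd
  have hb := G.isMeasurable_bwd
  have h1 := lintegral_expand hπ (A := fun p => eventDensity G.fwd Lf p.1 p.2)
    (by fun_prop (disch := assumption))
    (B := fun p => ENNReal.ofReal (lastTime p.1 / (p.2 + lastTime p.1) ^ 2)) (by fun_prop)
    (K := fun p => pathDensity G.bwd Lb p.2.2.1 p.1 p.2.2.2 *
      H (G.twoSided p.1 p.2.2.2 p.2.1 p.2.2.1 (lastTime p.2.1), p.2.2.1))
    (by fun_prop (disch := assumption))
  simp only at h1
  rw [h1]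
  refine (lintegral_rotate ?_).trans ?_
  · fun_prop (disch := assumption)
  obtain ⟨Q, hQ, hQd⟩ : ∃ Q : ℝ × Path E Vr × List (ℝ × V) → ℝ≥0∞, Measurable Q ∧ ∀ a w l, Q (a, w, l) =
      ind (0 < lastTime l) * (π w.1 * (eventDensity G.fwd Lf w.1 l *
        (ENNReal.ofReal (lastTime l / (a + lastTime l) ^ 2) * (pathDensity G.bwd Lb a w.1 w.2 *
          H (G.twoSided w.1 w.2 l a (lastTime l), a))))) :=
    ⟨fun p => ind (0 < lastTime p.2.2) * (π p.2.1.1 * (eventDensity G.fwd Lf p.2.1.1 p.2.2 *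
        (ENNReal.ofReal (lastTime p.2.2 / (p.1 + lastTime p.2.2) ^ 2) *
        (pathDensity G.bwd Lb p.1 p.2.1.1 p.2.1.2 *
          H (G.twoSided p.2.1.1 p.2.1.2 p.2.2 p.1 (lastTime p.2.2), p.1))))),
      by fun_prop (disch := assumption), fun _ _ _ => by dsimp only⟩
  have h2 := lintegral_twoSided_fwd hψ hcont hQ
  have e1 : ∀ a : ℝ, ind (0 < a) * ∫⁻ w, ind (After 0 w.2 ∧ Before a w.2) *
        ∫⁻ l, ind (After 0 l) * Q (a, w, l) ∂orderedListMeasure V ∂allPaths E Vr =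
      ∫⁻ w, (∫⁻ l, ind (After 0 l ∧ 0 < lastTime l) * (ind (0 < a ∧ After 0 w.2 ∧ Before a w.2) *
        (π w.1 * (eventDensity G.fwd Lf w.1 l *
        (ENNReal.ofReal (lastTime l / (a + lastTime l) ^ 2) * (pathDensity G.bwd Lb a w.1 w.2 *
          H (G.twoSided w.1 w.2 l a (lastTime l), a)))))) ∂orderedListMeasure V)
            ∂allPaths E Vr := fun a => by
    rw [← lintegral_const_mul' _ _ (ind_ne_top _)]
    refine lintegral_congr fun w => ?_
    rw [← lintegral_const_mul' _ _ (ind_ne_top _), ← lintegral_const_mul' _ _ (ind_ne_top _)]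
    refine lintegral_congr fun l => ?_
    rw [hQd, ind_and (0 < a), ind_and (After 0 l)]
    ring
  simp only [← e1]
  refine h2.trans (lintegral_congr_ae ?_)
  filter_upwards [ae_increasing_allPaths] with w hw
  refine ind_mul_congr Iff.rfl fun hw0 => lintegral_congr fun a => ?_
  rw [ind_and, mul_assoc]
  refine ind_mul_congr Iff.rfl fun ha => ?_
  obtain ⟨x, l⟩ := w
  obtain ⟨l₁, l₂, rfl, hl₁, hl₂⟩ := Increasing.exists_append_shift hw a
  unfold weight
  rw [leftPart_append_shift hl₁ hl₂, rightEvents_append_shift hl₁ hl₂, hQd]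
  simp only
  rw [leftPart_append_shift hl₁ hl₂, rightEvents_append_shift hl₁ hl₂,
    stateIn_append_shift hl₁ hl₂]
  -- Without an event after `a` both sides vanish: the process cannot have been stopped forward, and
  -- `a` is not smaller than the last event time.
  by_cases hne : l₂ = []
  · subst hne
    have h3 : ¬ a < lastTime l₁ := fun h => by
      have hne' : l₁ ≠ [] := by
        rintro rfl
        exact absurd h (not_lt.2 ha.le)
      obtain ⟨e, he, h'⟩ := exists_mem_eq_lastTime hne'
      exact absurd (h' ▸ hl₁ e he) (not_le.2 h)
    have h4 : l₁ ++ shift a ([] : List (ℝ × V)) = l₁ := List.append_nil _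
    rw [h4, ind_neg h3, zero_mul, ind_neg (by simp [lastTime]), zero_mul, mul_zero]
  · have hne' : shift a l₂ ≠ [] := by simpa [shift] using hne
    have hpos := lastTime_pos hl₂ hne
    rw [lastTime_append hne', lastTime_shift hne, add_sub_cancel_right, ind_pos hpos,
      ind_pos (by linarith), one_mul, one_mul, pathDensity_lastTime, twoSided_R,
      add_comm a (lastTime l₂)]
    ring

/-- When stopped backward, a path is described by its left limit `x`, the mark of the event at time
0, the later events, and its length `T`, which is now a free coordinate. -/
theorem lintegral_backward_weight (hψ : G.IsVolumeChange ψ) (hcont : G.ContinuousReversal ψ)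
    (hπ : Measurable π) {H : Segment E V × ℝ → ℝ≥0∞} (hH : Measurable H) :
    ∫⁻ z, (∫⁻ l, ind (After 0 l ∧ 0 < lastTime l) * (eventDensity G.bwd Lb z l *
        ∫⁻ b : ℝ, ind (0 < b) * (ENNReal.ofReal (lastTime l / (b + lastTime l) ^ 2) *
          ∫⁻ l', ind (After 0 l' ∧ Before b l') * (pathDensity G.fwd Lf b z l' *
            H (G.twoSided z l l' (lastTime l) b, lastTime l)) ∂orderedListMeasure V))
                ∂orderedListMeasure Vr) ∂((volume : Measure E).withDensity π) =
      ∫⁻ x : E, ∫⁻ T : ℝ, (∫⁻ m, ind (After 0 m.2 ∧ Before T m.2) *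
        (∫⁻ a : ℝ, ind (0 < a ∧ a < T) *
        (weight G π ψ Lf Lb ((x, (0, m.1) :: m.2), T) a *
          ENNReal.ofReal (a / T ^ 2) * H (((x, (0, m.1) :: m.2), T), a))) ∂markList V) := by
  have hf := G.isMeasurable_fwd
  have hb := G.isMeasurable_bwd
  have h1 := lintegral_expand hπ (A := fun p => eventDensity G.bwd Lb p.1 p.2)
    (by fun_prop (disch := assumption))
    (B := fun p => ENNReal.ofReal (lastTime p.1 / (p.2 + lastTime p.1) ^ 2)) (by fun_prop)
    (K := fun p => pathDensity G.fwd Lf p.2.2.1 p.1 p.2.2.2 *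
      H (G.twoSided p.1 p.2.1 p.2.2.2 (lastTime p.2.1) p.2.2.1, lastTime p.2.1))
    (by fun_prop (disch := assumption))
  simp only at h1
  rw [h1]
  obtain ⟨Q, hQ, hQd⟩ : ∃ Q : ℝ × Path E Vr × List (ℝ × V) → ℝ≥0∞, Measurable Q ∧ ∀ b w l, Q (b, w, l) =
      ind (0 < b ∧ Before b l) * (π w.1 * (eventDensity G.bwd Lb w.1 w.2 *
        (ENNReal.ofReal (lastTime w.2 / (b + lastTime w.2) ^ 2) * (pathDensity G.fwd Lf b w.1 l *
          H (G.twoSided w.1 w.2 l (lastTime w.2) b, lastTime w.2))))) :=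
    ⟨fun p => ind (0 < p.1 ∧ Before p.1 p.2.2) * (π p.2.1.1 *
        (eventDensity G.bwd Lb p.2.1.1 p.2.1.2 *
        (ENNReal.ofReal (lastTime p.2.1.2 / (p.1 + lastTime p.2.1.2) ^ 2) *
        (pathDensity G.fwd Lf p.1 p.2.1.1 p.2.2 *
          H (G.twoSided p.2.1.1 p.2.1.2 p.2.2 (lastTime p.2.1.2) p.1, lastTime p.2.1.2))))),
      by fun_prop (disch := assumption), fun _ _ _ => by dsimp only⟩
  have h2 := lintegral_twoSided_bwd hψ hcont hQ
  have h3 : Measurable fun p : Path E Vr × ℝ => ∫⁻ l, ind (After 0 l) * Q (p.2, p.1, l)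
      ∂orderedListMeasure V := by
    have : Measurable fun q : (Path E Vr × ℝ) × List (ℝ × V) => ind (After 0 q.2) *
      Q (q.1.2, q.1.1, q.2) := by fun_prop
    exact this.lintegral_prod_right'
  have h4 : Measurable fun w : Path E Vr => ind (w.2 ≠ [] ∧ After 0 w.2) *
      (∫⁻ b : ℝ, (∫⁻ l, ind (After 0 l) * Q (b, w, l) ∂orderedListMeasure V)) :=
    Measurable.mul (by fun_prop) h3.lintegral_prod_right'
  have e1 : ∀ z l, ind (l ≠ [] ∧ After 0 l) *
      (∫⁻ b : ℝ, (∫⁻ l', ind (After 0 l') * Q (b, (z, l), l') ∂orderedListMeasure V)) =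
      ∫⁻ b : ℝ, (∫⁻ l', ind (After 0 l ∧ 0 < lastTime l) *
        (ind (0 < b ∧ After 0 l' ∧ Before b l') * (π z * (eventDensity G.bwd Lb z l *
        (ENNReal.ofReal (lastTime l / (b + lastTime l) ^ 2) * (pathDensity G.fwd Lf b z l' *
          H (G.twoSided z l l' (lastTime l) b, lastTime l)))))) ∂orderedListMeasure V) :=
    fun z l => by
    rw [← lintegral_const_mul' _ _ (ind_ne_top _)]
    refine lintegral_congr fun b => ?_
    rw [← lintegral_const_mul' _ _ (ind_ne_top _)]
    refine lintegral_congr fun l' => ?_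
    refine ind_mul_congr ⟨fun h => ⟨h.2, lastTime_pos h.2 h.1⟩, fun h =>
      ⟨ne_nil_of_lastTime_pos h.2, h.1⟩⟩ fun _ => ?_
    rw [hQd, ← mul_assoc, ← ind_and]
    exact ind_mul_congr ⟨fun h => ⟨h.2.1, h.1, h.2.2⟩, fun h => ⟨h.2.1, h.1, h.2.2⟩⟩ fun _ => rfl
  simp only [← e1]
  rw [lintegral_prod _ h4.aemeasurable] at h2
  refine h2.trans (lintegral_congr fun x => lintegral_congr fun T => lintegral_congr_ae ?_)
  have hinc : ∀ᵐ m ∂markList V, Increasing m.2 :=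
    Measure.quasiMeasurePreserving_snd.ae ae_increasing_orderedListMeasure
  filter_upwards [hinc] with m hm
  rw [ind_and, mul_assoc]
  refine ind_mul_congr Iff.rfl fun hm0 => ?_
  rw [← lintegral_const_mul' _ _ (ind_ne_top _)]
  refine lintegral_congr fun a => ?_
  rw [← mul_assoc (ind (Before T m.2)), ← ind_and, and_left_comm, ind_and,
    mul_assoc (ind (0 < a))]
  refine ind_mul_congr Iff.rfl fun ha => ?_
  obtain ⟨v, l⟩ := m
  obtain ⟨l₁, l₂, rfl, hl₁, hl₂⟩ := Increasing.exists_append_shift hm a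
  have hl : ∀ e ∈ (0, v) :: l₁, e.1 ≤ a := by
    simpa using ⟨ha.le, fun t u hu => hl₁ _ hu⟩
  simp only [← List.cons_append]
  unfold weight
  rw [leftPart_append_shift hl hl₂, rightEvents_append_shift hl hl₂, hQd]
  rw [leftPart_append_shift hl hl₂, rightEvents_append_shift hl hl₂,
    stateIn_append_shift hl hl₂]
  have e2 : lastTime (G.R a (x, (0, v) :: l₁)).2 = a := by
    simp [R, Dynamics.lastTime_reverse_cons]
  -- The reversed path ends with an event exactly at its horizon, so its survival factor is one.
  have e3 : pathDensity G.bwd Lb a (G.R a (x, (0, v) :: l₁)).1 (G.R a (x, (0, v) :: l₁)).2 =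
      eventDensity G.bwd Lb (G.R a (x, (0, v) :: l₁)).1 (G.R a (x, (0, v) :: l₁)).2 := by
    have := pathDensity_lastTime (D := G.bwd) (L := Lb) (G.R a (x, (0, v) :: l₁)).1
      (G.R a (x, (0, v) :: l₁)).2
    rwa [e2] at this
  rw [e2, e3, twoSided_R, sub_add_cancel, add_sub_cancel]
  rw [mul_left_comm]
  refine ind_mul_congr ⟨fun h => ⟨fun e he => ?_, by linarith [h.1]⟩, fun h =>
    ⟨by linarith [h.2], before_shift.1 fun e he => h.1 e (List.mem_append_right _ he)⟩⟩
    fun _ => by ring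
  rcases List.mem_append.1 he with he | he
  · linarith [hl₁ e he, h.1]
  · exact before_shift.2 h.2 e he

end ReversiblePDMP

end NutsPDMP

namespace NutsPDMP

/-! ### Disintegration -/

section Disintegration

variable {Ω S : Type*} [MeasurableSpace Ω] [MeasurableSpace S] {μ : Measure Ω}
  [IsProbabilityMeasure μ] {X : Ω → S} {L : Ω → ℝ} {A : Set S} {m : Measure S}
  {f : S × ℝ → ℝ≥0∞}

omit [IsProbabilityMeasure μ] in
/-- The law of `X` on `A`, when `(X, L)` has density `f` there. -/
theorem restrict_map_eq_withDensity (hX : AEMeasurable X μ) (hA : MeasurableSet A)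
    (hf : Measurable f)
    (h : ∀ F : S × ℝ → ℝ≥0∞, Measurable F → ∫⁻ ω, ind (X ω ∈ A) * F (X ω, L ω) ∂μ =
      ∫⁻ x, (∫⁻ a : ℝ, f (x, a) * F (x, a)) ∂m) :
    (μ.map X).restrict A = m.withDensity fun x => ∫⁻ a : ℝ, f (x, a) := by
  ext B hB
  have hfx : ∀ x, Measurable fun a => f (x, a) := fun x => by fun_prop
  have hAm : Measurable fun x => ind (x ∈ A) := measurable_ind hA
  have hBm : Measurable fun x => ind (x ∈ B) := measurable_ind hB
  have h1 : (μ.map X).restrict A B = ∫⁻ x, ind (x ∈ A) * ind (x ∈ B) ∂μ.map X := by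
    rw [← setLIntegral_eq_ind hA]
    exact (lintegral_ind hB).symm
  have hABm : Measurable fun x => ind (x ∈ A) * ind (x ∈ B) := hAm.mul hBm
  rw [h1, lintegral_map' hABm.aemeasurable hX, withDensity_apply _ hB,
    setLIntegral_eq_ind hB]
  refine (h (fun p => ind (p.1 ∈ B)) (hBm.comp measurable_fst)).trans
    (lintegral_congr fun x => ?_)
  simp only
  rw [lintegral_mul_const _ (hfx x), mul_comm]

/-- The density `f` divided by its marginal `W` defines a kernel whose composition with the law of
`X` on `A` is the joint law, and disintegrations are unique. The property `p` is carried along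
because that law has the density `W` with respect to `m`; this also gives positivity and finiteness
of `W`. -/
theorem condDistrib_eq_of_lintegral [SFinite m] (hX : AEMeasurable X μ) (hL : AEMeasurable L μ)
    (hA : MeasurableSet A) (hf : Measurable f)
    (h : ∀ F : S × ℝ → ℝ≥0∞, Measurable F → ∫⁻ ω, ind (X ω ∈ A) * F (X ω, L ω) ∂μ =
      ∫⁻ x, (∫⁻ a : ℝ, f (x, a) * F (x, a)) ∂m) {p : S → Prop} (hp : ∀ᵐ x ∂m, p x) :
    ∀ᵐ x ∂μ.map X, x ∈ A → p x ∧ 0 < ∫⁻ a : ℝ, f (x, a) ∧ ∫⁻ a : ℝ, f (x, a) < ∞ ∧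
      condDistrib L X μ x =
        (∫⁻ a : ℝ, f (x, a))⁻¹ • (volume : Measure ℝ).withDensity fun a => f (x, a) := by
  have hfx : ∀ x, Measurable fun a => f (x, a) := fun x => by fun_prop
  have hWm : Measurable fun x => ∫⁻ a : ℝ, f (x, a) := hf.lintegral_prod_right'
  have hν := restrict_map_eq_withDensity hX hA hf h
  obtain ⟨W, hW⟩ : ∃ W : S → ℝ≥0∞, ∀ x, ∫⁻ a : ℝ, f (x, a) = W x := ⟨_, fun _ => rfl⟩
  simp only [hW] at hWm hν ⊢
  change Measurable W at hWm
  have hprob : IsProbabilityMeasure (μ.map X) := Measure.isProbabilityMeasure_map hX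
  have hfin : ∀ᵐ x ∂m, W x < ∞ := by
    refine ae_lt_top hWm ?_
    rw [← setLIntegral_univ, ← withDensity_apply _ MeasurableSet.univ]
    change m.withDensity (fun x => W x) univ ≠ ∞
    rw [← hν]
    exact measure_ne_top _ _
  have hgood : ∀ᵐ x ∂(μ.map X).restrict A, p x ∧ 0 < W x ∧ W x < ∞ := by
    rw [hν]
    refine (ae_withDensity_iff hWm).2 ?_
    filter_upwards [hp, hfin] with x h1 h2 h3
    exact ⟨h1, pos_iff_ne_zero.2 h3, h2⟩
  -- The indicator sets the kernel to zero where the marginal is degenerate, so that it is finite at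
  -- every point and not only almost everywhere.
  obtain ⟨g, hg⟩ : ∃ g : S → ℝ → ℝ≥0∞, ∀ x a, g x a =
      ind (W x ≠ 0 ∧ W x ≠ ∞) * (W x)⁻¹ * f (x, a) := ⟨_, fun _ _ => rfl⟩
  have hi : Measurable fun x => ind (W x ≠ 0 ∧ W x ≠ ∞) := measurable_ind
    ((hWm (measurableSet_singleton 0).compl).inter (hWm (measurableSet_singleton ∞).compl))
  have hgm : Measurable (Function.uncurry g) := by
    have : Function.uncurry g = fun q => ind (W q.1 ≠ 0 ∧ W q.1 ≠ ∞) * (W q.1)⁻¹ * f q :=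
      funext fun q => hg q.1 q.2
    rw [this]
    exact ((hi.comp measurable_fst).mul (hWm.comp measurable_fst).inv).mul hf
  have hgx : ∀ x, Measurable (g x) := fun x => hgm.of_uncurry_left
  set η : Kernel S ℝ := (Kernel.const S (volume : Measure ℝ)).withDensity g with hη
  have hηx : ∀ x, η x = (volume : Measure ℝ).withDensity (g x) := fun x => by
    rw [hη, Kernel.withDensity_apply _ hgm, Kernel.const_apply]
  have hηfin : IsFiniteKernel η := by
    refine ⟨1, ENNReal.one_lt_top, fun x => ?_⟩
    rw [hηx, withDensity_apply _ MeasurableSet.univ, setLIntegral_univ]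
    simp only [hg]
    rw [lintegral_const_mul _ (hfx x), hW, mul_assoc]
    by_cases hx : W x ≠ 0 ∧ W x ≠ ∞
    · rw [ind_pos hx, one_mul, ENNReal.inv_mul_cancel hx.1 hx.2]
    · rw [ind_neg hx, zero_mul]
      exact zero_le
  have hcomp : (μ.map X).restrict A ⊗ₘ condDistrib L X μ = (μ.map X).restrict A ⊗ₘ η := by
    refine Measure.ext_of_lintegral _ fun F hF => ?_
    have hAm : Measurable fun q : S × ℝ => ind (q.1 ∈ A) * F q :=
      ((measurable_ind hA).comp measurable_fst).mul hF
    have hFx : ∀ x, Measurable fun a => F (x, a) := fun x => by fun_prop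
    have e1 : ∫⁻ q, F q ∂((μ.map X).restrict A ⊗ₘ condDistrib L X μ) =
        ∫⁻ x, (∫⁻ a : ℝ, f (x, a) * F (x, a)) ∂m := by
      rw [← h F hF, Measure.lintegral_compProd hF, setLIntegral_eq_ind hA]
      simp only [← lintegral_const_mul _ (hFx _)]
      rw [← Measure.lintegral_compProd hAm, compProd_map_condDistrib hL,
        lintegral_map' hAm.aemeasurable (hX.prodMk hL)]
    have hηF : Measurable fun x => ∫⁻ a, F (x, a) ∂η x := hF.lintegral_kernel_prod_right'
    rw [e1, Measure.lintegral_compProd hF, hν, lintegral_withDensity_eq_lintegral_mul _ hWm hηF]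
    refine lintegral_congr_ae ?_
    filter_upwards [hfin] with x hx
    rw [Pi.mul_apply, hηx, lintegral_withDensity_eq_lintegral_mul _ (hgx x) (hFx x)]
    simp only [Pi.mul_apply, hg, mul_assoc]
    rw [lintegral_const_mul' _ _ (ind_ne_top _)]
    -- Where the marginal vanishes, `f (x, ·)` is zero almost everywhere, so both sides are zero.
    by_cases h0 : W x = 0
    · rw [h0, zero_mul]
      have hz := (lintegral_eq_zero_iff (hfx x)).1 ((hW x).trans h0)
      refine (lintegral_congr_ae ?_).trans lintegral_zero
      filter_upwards [hz] with a ha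
      rw [ha]
      exact zero_mul _
    · have hfF : Measurable fun a => f (x, a) * F (x, a) := by fun_prop
      rw [lintegral_const_mul _ hfF, ind_pos ⟨h0, hx.ne⟩, one_mul, ← mul_assoc,
        ENNReal.mul_inv_cancel h0 hx.ne, one_mul]
  have hae := Kernel.ae_eq_of_compProd_eq hcomp
  refine (ae_restrict_iff' hA).1 ?_
  filter_upwards [hgood, hae] with x ⟨h1, h2, h3⟩ h4
  refine ⟨h1, h2, h3, ?_⟩
  rw [h4, hηx, ← withDensity_smul _ (hfx x)]
  congr 1
  funext a
  rw [hg, ind_pos ⟨h2.ne', h3.ne⟩, one_mul]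
  rfl

end Disintegration

namespace ReversiblePDMP

variable {E V Vr : Type*} [MeasureSpace E] [MeasureSpace V] [MeasureSpace Vr]
  [SigmaFinite (volume : Measure E)] [SigmaFinite (volume : Measure V)]
  [SigmaFinite (volume : Measure Vr)] [TopologicalSpace E] [TopologicalSpace Vr]
  {G : ReversiblePDMP E V Vr} {ψ : ℝ → Path E Vr → ℝ}
  {π : E → ℝ≥0∞} [IsProbabilityMeasure ((volume : Measure E).withDensity π)]
  {Kf : Kernel E (ℕ → Option (ℝ × V))} [IsMarkovKernel Kf]
  {Kb : Kernel E (ℕ → Option (ℝ × Vr))} [IsMarkovKernel Kb] {C : G.StoppingCriterion}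
  {Lf : Rate E V} {Lb : Rate E Vr}

set_option linter.unusedSectionVars false

/-- At a position which is not an event time, both versions of the weight agree. -/
theorem weight_eq_pathWeight (hcont : G.ContinuousReversal ψ)
    (hψ : G.IsVolumeChange ψ) {x : Segment E V} (hx : Increasing x.1.2)
    (h0 : ∀ e ∈ x.1.2, 0 ≤ e.1) {a : ℝ} (ha : 0 < a) (hne : ∀ e ∈ x.1.2, e.1 ≠ a) :
    weight G π ψ Lf Lb x a = G.pathWeight π ψ Lf Lb x a := by
  have h1 : Increasing (leftPart x a).2 := hx.filter _
  have h2 : ∀ e ∈ (leftPart x a).2, 0 ≤ e.1 ∧ e.1 < a := fun e he => by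
    obtain ⟨h3, h4⟩ := List.mem_filter.1 he
    exact ⟨h0 e h3, lt_of_le_of_ne (by simpa using h4) (hne e h3)⟩
  have h3 : Increasing (G.R a (leftPart x a)).2 := Dynamics.increasing_reverse.2 h1
  have h4 : After 0 (G.R a (leftPart x a)).2 :=
    (Dynamics.forall_mem_reverse (P := fun t => 0 < t)).2 fun e he => by linarith [(h2 e he).2]
  have h5 : ∀ e ∈ (G.R a (leftPart x a)).2, e.1 ≤ a :=
    (Dynamics.forall_mem_reverse (P := fun t => t ≤ a)).2 fun e he => by linarith [(h2 e he).1]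
  have h6 : lastTime (G.R a (leftPart x a)).2 ≤ a := by
    by_cases hl : (G.R a (leftPart x a)).2 = []
    · rw [hl]
      exact ha.le
    · obtain ⟨e, he, h'⟩ := exists_mem_eq_lastTime hl
      exact h' ▸ h5 e he
  unfold weight pathWeight invVolumeChange
  rw [volumeChange_eq hcont h3 h4 h6, one_div, ENNReal.ofReal_inv_of_pos (hψ.pos _ _)]

/-- Only the event times of `x` are exceptional; they are finitely many, hence negligible as
positions of the origin. -/
theorem ae_weight_eq_pathWeight (hcont : G.ContinuousReversal ψ)
    (hψ : G.IsVolumeChange ψ) {x : Segment E V} (hx : Increasing x.1.2)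
    (h0 : ∀ e ∈ x.1.2, 0 ≤ e.1) :
    ∀ᵐ a : ℝ, 0 < a → weight G π ψ Lf Lb x a = G.pathWeight π ψ Lf Lb x a := by
  have hfin : (Prod.fst '' {e | e ∈ x.1.2}).Finite := (List.finite_toSet _).image _
  filter_upwards [hfin.countable.ae_notMem volume] with a hane ha
  exact weight_eq_pathWeight hcont hψ hx h0 ha fun e he h => hane ⟨e, he, h⟩

/-- The proposition `q` stands for the stopping condition, which does not involve `a`. A positive
integral forces it to hold, after which it disappears from the density. Passing from the open to the
closed interval changes nothing. -/
theorem hasDensityProportionalTo_of_weight (hcont : G.ContinuousReversal ψ)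
    (hψ : G.IsVolumeChange ψ) {x : Segment E V} (hx : Increasing x.1.2)
    (h0 : ∀ e ∈ x.1.2, 0 ≤ e.1) {c : ℝ → ℝ≥0∞} {q : Prop} {ν : Measure ℝ}
    (hpos : 0 < ∫⁻ a, ind (0 < a ∧ a < x.2) * (weight G π ψ Lf Lb x a * c a * ind q))
    (hfin : ∫⁻ a, ind (0 < a ∧ a < x.2) * (weight G π ψ Lf Lb x a * c a * ind q) < ∞)
    (hν : ν = (∫⁻ a, ind (0 < a ∧ a < x.2) * (weight G π ψ Lf Lb x a * c a * ind q))⁻¹ •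
      (volume : Measure ℝ).withDensity
        fun a => ind (0 < a ∧ a < x.2) * (weight G π ψ Lf Lb x a * c a * ind q)) :
    HasDensityProportionalTo ν x.2 fun a => G.pathWeight π ψ Lf Lb x a * c a := by
  have hq : q := by
    by_contra hq
    simp [ind_neg hq] at hpos
  have hae : (fun a => ind (0 < a ∧ a < x.2) * (weight G π ψ Lf Lb x a * c a * ind q)) =ᵐ[volume]
      (Ioo 0 x.2).indicator fun a => G.pathWeight π ψ Lf Lb x a * c a := by
    filter_upwards [ae_weight_eq_pathWeight (π := π) (Lf := Lf) (Lb := Lb) hcont hψ hx h0]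
      with a ha
    by_cases hm : a ∈ Ioo 0 x.2
    · rw [indicator_of_mem hm, ind_pos (mem_Ioo.1 hm), ind_pos hq, ha hm.1, one_mul, mul_one]
    · rw [indicator_of_notMem hm, ind_neg (fun h => hm (mem_Ioo.2 h)), zero_mul]
  have hint : ∫⁻ a, ind (0 < a ∧ a < x.2) * (weight G π ψ Lf Lb x a * c a * ind q) =
      ∫⁻ a in Icc 0 x.2, G.pathWeight π ψ Lf Lb x a * c a := by
    rw [lintegral_congr_ae hae, lintegral_indicator measurableSet_Ioo,
      setLIntegral_congr Ioo_ae_eq_Icc]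
  rw [hint] at hpos hfin hν
  refine ⟨hpos, hfin, ?_⟩
  rw [hν, withDensity_congr_ae hae, withDensity_indicator measurableSet_Ioo,
    Measure.restrict_congr_set Ioo_ae_eq_Icc]

theorem measurableSet_stoppedForward : MeasurableSet (stoppedForward E V) :=
  measurableSet_exists_mem (f := fun x : Segment E V => x.1.2) (P := fun x e => e.1 = x.2)
    measurable_fst.snd (measurableSet_eq_fun measurable_snd.fst measurable_fst.snd)

theorem measurableSet_stoppedBackward : MeasurableSet (stoppedBackward E V) :=
  measurableSet_exists_mem (f := fun x : Segment E V => x.1.2) (P := fun _ e => e.1 = 0)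
    measurable_fst.snd (measurableSet_eq_fun measurable_snd.fst measurable_const)

/-- The reference measure for `X` is the image of the canonical measure of paths under `w ↦ (w,
lastTime w.2)`: a path stopped forward ends at its last event. -/
theorem ae_condDistrib_stoppedForward (hψ : G.IsVolumeChange ψ) (hcont : G.ContinuousReversal ψ)
    (hKf : IsEventLaw G.fwd Lf Kf) (hKb : IsEventLaw G.bwd Lb Kb) (hπ : Measurable π)
    (hreg : ∀ᵐ ω ∂runLaw π Kf Kb, IsRegularRun C ω) :
    ∀ᵐ x ∂(runLaw π Kf Kb).map (outX C), x ∈ stoppedForward E V →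
      HasDensityProportionalTo (condDistrib (outL C) (outX C) (runLaw π Kf Kb) x) x.2
        fun l => G.pathWeight π ψ Lf Lb x l * ENNReal.ofReal ((x.2 - l) / x.2 ^ 2) := by
  have hout := aemeasurable_out hreg
  have hw := measurable_weight (Lf := Lf) (Lb := Lb) hψ hπ
  have hS : MeasurableSet {w : Path E V | After 0 w.2} := measurableSet_setOfPred.2 (by fun_prop)
  have hgm : Measurable fun w : Path E V => ((w, lastTime w.2) : Segment E V) := by fun_prop
  have hf : Measurable fun q : Segment E V × ℝ => ind (0 < q.2 ∧ q.2 < q.1.2) *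
      (weight G π ψ Lf Lb q.1 q.2 * ENNReal.ofReal ((q.1.2 - q.2) / q.1.2 ^ 2) *
        ind (StopsRight C q.1)) := by fun_prop
  have hp : ∀ᵐ x ∂((allPaths E V).restrict {w | After 0 w.2}).map
      (fun w => ((w, lastTime w.2) : Segment E V)),
      Increasing x.1.2 ∧ ∀ e ∈ x.1.2, 0 ≤ e.1 := by
    have hm : MeasurableSet {x : Segment E V | Increasing x.1.2 ∧ ∀ e ∈ x.1.2, 0 ≤ e.1} :=
      (measurable_fst.snd measurableSet_increasing).inter (measurableSet_forall_mem
        measurable_fst.snd (measurableSet_le measurable_const measurable_snd.fst))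
    refine (ae_map_iff hgm.aemeasurable hm).2 ?_
    filter_upwards [ae_restrict_mem hS, ae_restrict_of_ae ae_increasing_allPaths] with w h1 h2
    exact ⟨h2, fun e he => (h1 e he).le⟩
  have h := condDistrib_eq_of_lintegral hout.fst hout.snd measurableSet_stoppedForward hf
    (fun F hF => ?_) hp
  · filter_upwards [h] with x hx hxA
    obtain ⟨⟨h1, h2⟩, h3, h4, h5⟩ := hx hxA
    exact hasDensityProportionalTo_of_weight hcont hψ h1 h2 h3 h4 h5
  · have hfF : Measurable fun x : Segment E V => ∫⁻ a : ℝ, (ind (0 < a ∧ a < x.2) *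
      (weight G π ψ Lf Lb x a * ENNReal.ofReal ((x.2 - a) / x.2 ^ 2) *
        ind (StopsRight C x))) * F (x, a) := (hf.mul hF).lintegral_prod_right'
    rw [lintegral_stoppedForward hKf hKb hreg hF,
      lintegral_forward_weight hψ hcont hπ
        (H := fun q => ind (StopsRight C q.1) * F q) (by fun_prop),
      lintegral_map hfF hgm, lintegral_ind_mul hS]
    refine lintegral_congr fun w => lintegral_congr fun a => ?_
    ring

/-- The reference measure for `X` now uses as coordinates the left limit, the length, the mark of
the event at time 0 and the later events. The length is independent of the event times, apart from
bounding them. -/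
theorem ae_condDistrib_stoppedBackward (hψ : G.IsVolumeChange ψ) (hcont : G.ContinuousReversal ψ)
    (hKf : IsEventLaw G.fwd Lf Kf) (hKb : IsEventLaw G.bwd Lb Kb) (hπ : Measurable π)
    (hreg : ∀ᵐ ω ∂runLaw π Kf Kb, IsRegularRun C ω) :
    ∀ᵐ x ∂(runLaw π Kf Kb).map (outX C), x ∈ stoppedBackward E V →
      HasDensityProportionalTo (condDistrib (outL C) (outX C) (runLaw π Kf Kb) x) x.2
        fun l => G.pathWeight π ψ Lf Lb x l * ENNReal.ofReal (l / x.2 ^ 2) := by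
  have hout := aemeasurable_out hreg
  have hw := measurable_weight (Lf := Lf) (Lb := Lb) hψ hπ
  have hS : MeasurableSet {p : (E × ℝ) × (V × List (ℝ × V)) |
      After 0 p.2.2 ∧ Before p.1.2 p.2.2} := measurableSet_setOfPred.2 (by fun_prop)
  have hgm : Measurable fun p : (E × ℝ) × (V × List (ℝ × V)) =>
      (((p.1.1, (0, p.2.1) :: p.2.2), p.1.2) : Segment E V) := by fun_prop
  have hf : Measurable fun q : Segment E V × ℝ => ind (0 < q.2 ∧ q.2 < q.1.2) *
      (weight G π ψ Lf Lb q.1 q.2 * ENNReal.ofReal (q.2 / q.1.2 ^ 2) *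
        ind (StopsLeft C q.1)) := by fun_prop
  have hp : ∀ᵐ x ∂((((volume : Measure E).prod (volume : Measure ℝ)).prod (markList V)).restrict
      {p | After 0 p.2.2 ∧ Before p.1.2 p.2.2}).map
      (fun p => (((p.1.1, (0, p.2.1) :: p.2.2), p.1.2) : Segment E V)),
      Increasing x.1.2 ∧ ∀ e ∈ x.1.2, 0 ≤ e.1 := by
    have hm : MeasurableSet {x : Segment E V | Increasing x.1.2 ∧ ∀ e ∈ x.1.2, 0 ≤ e.1} :=
      (measurable_fst.snd measurableSet_increasing).inter (measurableSet_forall_mem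
        measurable_fst.snd (measurableSet_le measurable_const measurable_snd.fst))
    refine (ae_map_iff hgm.aemeasurable hm).2 ?_
    have hinc : ∀ᵐ p ∂((volume : Measure E).prod (volume : Measure ℝ)).prod (markList V),
        Increasing p.2.2 := Measure.quasiMeasurePreserving_snd.ae
      (Measure.quasiMeasurePreserving_snd.ae ae_increasing_orderedListMeasure)
    filter_upwards [ae_restrict_mem hS, ae_restrict_of_ae hinc] with p h1 h2
    refine ⟨List.pairwise_cons.2 ⟨fun e he => h1.1 e he, h2⟩, fun e he => ?_⟩
    rcases List.mem_cons.1 he with rfl | he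
    · exact le_rfl
    · exact (h1.1 e he).le
  have h := condDistrib_eq_of_lintegral hout.fst hout.snd measurableSet_stoppedBackward hf
    (fun F hF => ?_) hp
  · filter_upwards [h] with x hx hxA
    obtain ⟨⟨h1, h2⟩, h3, h4, h5⟩ := hx hxA
    exact hasDensityProportionalTo_of_weight (c := fun a => ENNReal.ofReal (a / x.2 ^ 2))
      hcont hψ h1 h2 h3 h4 h5
  · have hfF : Measurable fun x : Segment E V => ∫⁻ a : ℝ, (ind (0 < a ∧ a < x.2) *
      (weight G π ψ Lf Lb x a * ENNReal.ofReal (a / x.2 ^ 2) *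
        ind (StopsLeft C x))) * F (x, a) := (hf.mul hF).lintegral_prod_right'
    have hfg : Measurable fun p : (E × ℝ) × (V × List (ℝ × V)) =>
        ind (After 0 p.2.2 ∧ Before p.1.2 p.2.2) * ∫⁻ a : ℝ, (ind (0 < a ∧ a < p.1.2) *
          (weight G π ψ Lf Lb ((p.1.1, (0, p.2.1) :: p.2.2), p.1.2) a *
            ENNReal.ofReal (a / p.1.2 ^ 2) *
          ind (StopsLeft C ((p.1.1, (0, p.2.1) :: p.2.2), p.1.2)))) *
            F (((p.1.1, (0, p.2.1) :: p.2.2), p.1.2), a) :=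
      Measurable.mul (by fun_prop) (hfF.comp hgm)
    rw [lintegral_stoppedBackward hKf hKb hreg hF,
      lintegral_backward_weight hψ hcont hπ
        (H := fun q => ind (StopsLeft C q.1) * F q) (by fun_prop),
      lintegral_map hfF hgm, ← lintegral_ind_mul hS, lintegral_prod _ hfg.aemeasurable,
      lintegral_prod _ hfg.lintegral_prod_right'.aemeasurable]
    refine lintegral_congr fun x => lintegral_congr fun T => lintegral_congr fun m =>
      congrArg _ (lintegral_congr fun a => ?_)
    ring

end ReversiblePDMP

end NutsPDMP

/-! ### Conditional law of the position of the origin -/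

theorem mainTheorem5 {E V Vr : Type*}
    [MeasureSpace E] [SigmaFinite (volume : MeasureTheory.Measure E)]
    [TopologicalSpace E] [BorelSpace E]
    [MeasureSpace V] [SigmaFinite (volume : MeasureTheory.Measure V)]
    [MeasureSpace Vr] [SigmaFinite (volume : MeasureTheory.Measure Vr)]
    [TopologicalSpace Vr] [BorelSpace Vr]
    (G : NutsPDMP.ReversiblePDMP E V Vr)
    (ψ : ℝ → NutsPDMP.Path E Vr → ℝ)
    (hψ : G.IsVolumeChange ψ) (hcont : G.ContinuousReversal ψ)
    (Lf : NutsPDMP.Rate E V) (Lb : NutsPDMP.Rate E Vr)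
    (Kf : Kernel E (ℕ → Option (ℝ × V))) [IsMarkovKernel Kf]
    (hKf : NutsPDMP.IsEventLaw G.fwd Lf Kf)
    (Kb : Kernel E (ℕ → Option (ℝ × Vr))) [IsMarkovKernel Kb]
    (hKb : NutsPDMP.IsEventLaw G.bwd Lb Kb)
    (π : E → ℝ≥0∞) (hπ : Measurable π)
    [IsProbabilityMeasure ((volume : MeasureTheory.Measure E).withDensity π)]
    (hexpl : ∀ᵐ ω ∂(NutsPDMP.runLaw π Kf Kb),
      NutsPDMP.NonExplosive ω.1.2.1 ∧ NutsPDMP.NonExplosive ω.1.2.2)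
    (C : G.StoppingCriterion)
    (hterm : ∀ᵐ ω ∂(NutsPDMP.runLaw π Kf Kb),
      (NutsPDMP.ReversiblePDMP.validTimes C ω).Nonempty ∧
        BddAbove (NutsPDMP.ReversiblePDMP.validTimes C ω)) :
    AEMeasurable (NutsPDMP.ReversiblePDMP.outX C) (NutsPDMP.runLaw π Kf Kb) ∧
    AEMeasurable (NutsPDMP.ReversiblePDMP.outL C) (NutsPDMP.runLaw π Kf Kb) ∧
    (∀ᵐ ω ∂(NutsPDMP.runLaw π Kf Kb),
      (NutsPDMP.ReversiblePDMP.outX C ω ∈ NutsPDMP.stoppedForward E V ↔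
        NutsPDMP.ReversiblePDMP.outX C ω ∉ NutsPDMP.stoppedBackward E V)) ∧
    ∀ᵐ x ∂((NutsPDMP.runLaw π Kf Kb).map (NutsPDMP.ReversiblePDMP.outX C)),
      (x ∈ NutsPDMP.stoppedForward E V →
        NutsPDMP.HasDensityProportionalTo
          (condDistrib (NutsPDMP.ReversiblePDMP.outL C) (NutsPDMP.ReversiblePDMP.outX C)
            (NutsPDMP.runLaw π Kf Kb) x)
          x.2
          (fun l => G.pathWeight π ψ Lf Lb x l * ENNReal.ofReal ((x.2 - l) / x.2 ^ 2))) ∧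
      (x ∈ NutsPDMP.stoppedBackward E V →
        NutsPDMP.HasDensityProportionalTo
          (condDistrib (NutsPDMP.ReversiblePDMP.outL C) (NutsPDMP.ReversiblePDMP.outX C)
            (NutsPDMP.runLaw π Kf Kb) x)
          x.2
          (fun l => G.pathWeight π ψ Lf Lb x l * ENNReal.ofReal (l / x.2 ^ 2))) := by
  have hreg := NutsPDMP.ReversiblePDMP.ae_isRegularRun hKf hKb hexpl hterm
  have hout := NutsPDMP.ReversiblePDMP.aemeasurable_out hreg
  refine ⟨hout.fst, hout.snd, ?_, ?_⟩
  · filter_upwards [hreg] with ω h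
    exact h.stoppedForward_iff
  · filter_upwards [NutsPDMP.ReversiblePDMP.ae_condDistrib_stoppedForward hψ hcont hKf hKb hπ hreg,
      NutsPDMP.ReversiblePDMP.ae_condDistrib_stoppedBackward hψ hcont hKf hKb hπ hreg]
      with x h1 h2
    exact ⟨h1, h2⟩
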